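/- **Setting.** Fix $T>0$ and deterministic functions on $[0,T]$: $A,\bar A,\sigma,Q,\bar Q,S$ with values in $\mathbb{R}^{n\times n}$, $B$ with values in $\mathbb{R}^{n\times m}$, $R$ with values in $\mathbb{R}^{m\times m}$. All are measurable; $A,\bar A,B,Q,\bar Q,S,R$ are bounded and $\sigma\in L^2(0,T)$; $Q_t,\bar Q_t$ are symmetric non-negative definite and $R_t$ is symmetric with $R_t\ge\delta I$ for all $t\in[0,T]$ and some $\delta>0$. Let $\nu$ be a law on $\mathbb{R}^n$ with finite second moment. For $N\ge 2$ let $x_0^1,\dots,x_0^N$ be i.i.d. with law $\nu$ and let $W^1,\dots,W^N$ be independent $n$-dimensional standard Wiener processes, the family $(x_0^i)_i$ being independent of the family $(W^i)_i$, on a probability space $(\Omega,\mathcal F,\mathbb P)$. Let $\mathcal{G}_t=\sigma(x_0^j,W^j_s: s\le t,\ 1\le j\le N)$ and $\mathcal F^i_t=\sigma(x^i_0,W^i_s: s\le t)$. For a family $\mathcal H=(\mathcal H_t)_t$ of $\sigma$-algebras, $L^2_{\mathcal H}(0,T;\mathbb R^m)$ is the space of square-integrable $\mathcal H$-adapted $\mathbb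 R^m$-valued processes on $[0,T]$ (up to null sets). For a control $v$, a process $\mu$ and a state $x$ put $$\mathcal{C}(v,\mu,x)=\mathbb E\Big[\tfrac12\int_0^T \big(x_t^*Q_tx_t+v_t^*R_tv_t+(x_t-S_t\mu_t)^*\bar Q_t(x_t-S_t\mu_t)\big)\,dt+\tfrac12x_T^*Q_Tx_T+\tfrac12(x_T-S_T\mu_T)^*\bar Q_T(x_T-S_T\mu_T)\Big].$$ *$N$-player game.* Under controls $v^1,\dots,v^N\in L^2_{\mathcal G}(0,T;\mathbb R^m)$ the states solve $$dx^i_t=\Big(A_tx^i_t+B_tv^i_t+\bar A_t\mu^i_t\Big)dt+\sigma_t\,dW^i_t,\qquad x^i(0)=x^i_0,\qquad \mu^i_t=\frac1{N-1}\sum_{j\ne i}x^j_t,$$ and player $i$ has the cost $\mathcal J^i(v^1,\dots,v^N)=\mathcal C(v^i,\mu^i,x^i)$. *Mean field game.* Let $z:[0,T]\to\mathbb R^n$ be continuous. A control $u\in L^2_{\mathcal F^i}(0,T;\mathbb R^m)$ is an equilibrium strategy for $(x_0^i,W^i)$ with mean $z$ if the solution $y$ of $dy_t=(A_ty_t+B_tu_t+\bar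 A_tz_t)dt+\sigma_tdW^i_t$, $y_0=x_0^i$, satisfies $\mathbb E[y_t]=z_t$ for all $t\in[0,T]$, and $\mathcal C(u,z,y)\le\mathcal C(v,z,x)$ for every $v\in L^2_{\mathcal F^i}(0,T;\mathbb R^m)$, where $x$ solves $dx_t=(A_tx_t+B_tv_t+\bar A_tz_t)dt+\sigma_tdW^i_t$, $x_0=x_0^i$. **Theorem 4.4.** There is a constant $C\ge0$, depending only on the coefficients above (including $T$), on $\nu$ and on $z$, such that the following holds for every $N\ge2$ and all random data as above. If, for each $i$, $u^i$ is an equilibrium strategy of the mean field game for $(x_0^i,W^i)$ with the (common) mean $z$, then $(u^1,\dots,u^N)$ is a $C/\sqrt N$-Nash equilibrium of the $N$-player game: every $u^i$ is in $L^2_{\mathcal G}(0,T;\mathbb R^m)$, and for every $i$ and every $v^i\in L^2_{\mathcal G}(0,T;\mathbb R^m)$ $$\mathcal J^i(u^1,\dots,u^{i-1},v^i,u^{i+1},\dots,u^N)\ \ge\ \mathcal J^i(u^1,\dots,u^N)-\frac{C}{\sqrt N}.$$ -/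

import Mathlib

open MeasureTheory ProbabilityTheory Set Filter Topology
open scoped NNReal ENNReal Matrix

noncomputable section

namespace LQMFG

/-- A matrix-valued function of time that is (Lebesgue) measurable and bounded on `[0, T]`. -/
def IsBddMeas {k l : ℕ} (T : ℝ) (M : ℝ → Matrix (Fin k) (Fin l) ℝ) : Prop :=
  (∀ i j, AEMeasurable (fun t => M t i j) (volume.restrict (Icc 0 T))) ∧
    ∃ K : ℝ, ∀ t ∈ Icc 0 T, ∀ i j, |M t i j| ≤ K

/-- The coefficients of the linear-quadratic game with state space `ℝⁿ` and control space `ℝᵐ`,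
with the standing assumptions on them. Matrix-valued functions of time are only used on `[0, T]`.
`Matrix.PosSemidef` includes symmetry. -/
structure Game (n m : ℕ) where
  T : ℝ
  T_pos : 0 < T
  A : ℝ → Matrix (Fin n) (Fin n) ℝ
  B : ℝ → Matrix (Fin n) (Fin m) ℝ
  Abar : ℝ → Matrix (Fin n) (Fin n) ℝ
  σ : ℝ → Matrix (Fin n) (Fin n) ℝ
  Q : ℝ → Matrix (Fin n) (Fin n) ℝ
  Qbar : ℝ → Matrix (Fin n) (Fin n) ℝ
  S : ℝ → Matrix (Fin n) (Fin n) ℝ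
  R : ℝ → Matrix (Fin m) (Fin m) ℝ
  A_bdd : IsBddMeas T A
  B_bdd : IsBddMeas T B
  Abar_bdd : IsBddMeas T Abar
  σ_sq : ∀ i j, MemLp (fun t => σ t i j) 2 (volume.restrict (Icc 0 T))
  Q_bdd : IsBddMeas T Q
  Qbar_bdd : IsBddMeas T Qbar
  S_bdd : IsBddMeas T S
  R_bdd : IsBddMeas T R
  Q_nonneg : ∀ t ∈ Icc 0 T, (Q t).PosSemidef
  Qbar_nonneg : ∀ t ∈ Icc 0 T, (Qbar t).PosSemidef
  R_coercive : ∃ δ : ℝ, 0 < δ ∧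
    ∀ t ∈ Icc 0 T, (R t - δ • (1 : Matrix (Fin m) (Fin m) ℝ)).PosSemidef

/-! ### Wiener processes and the Wiener integral of a deterministic integrand -/

/-- An `n`-dimensional standard Wiener process: its coordinates are independent real Brownian
motions. -/
structure IsStdWiener {n : ℕ} {Ω : Type*} [MeasurableSpace Ω] (P : Measure Ω)
    (W : ℝ≥0 → Ω → Fin n → ℝ) : Prop where
  measurable : ∀ t, Measurable (W t)
  brownian : ∀ k, IsBrownianReal (fun t ω => W t ω k) P
  indep : iIndepFun (fun (k : Fin n) ω (t : ℝ≥0) => W t ω k) P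

/-- The matrix-valued step function `∑_{k < K} c_k 1_{(τ_k, τ_{k+1}]}`, where
`τ_0 ≤ τ_1 ≤ ⋯`. -/
structure StepFn (n : ℕ) where
  K : ℕ
  τ : ℕ → ℝ≥0
  mono : Monotone τ
  c : ℕ → Matrix (Fin n) (Fin n) ℝ

/-- The value of a step function at time `s`. -/
def StepFn.val {n : ℕ} (φ : StepFn n) (s : ℝ) : Matrix (Fin n) (Fin n) ℝ :=
  ∑ k ∈ Finset.range φ.K,
    (Ioc (φ.τ k : ℝ) (φ.τ (k + 1) : ℝ)).indicator (fun _ => φ.c k) s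

/-- The elementary integral `∫₀ᵗ φ dW = ∑_{k < K} c_k (W_{τ_{k+1} ∧ t} - W_{τ_k ∧ t})`. -/
def StepFn.integral {n : ℕ} (φ : StepFn n) {Ω : Type*} (W : ℝ≥0 → Ω → Fin n → ℝ)
    (t : ℝ) (ω : Ω) : Fin n → ℝ :=
  ∑ k ∈ Finset.range φ.K,
    φ.c k *ᵥ (W (min (φ.τ (k + 1)) t.toNNReal) ω - W (min (φ.τ k) t.toNNReal) ω)

/-- `I` is (a continuous version of) the stochastic integral `I_t = ∫₀ᵗ σ_s dW_s`,
`0 ≤ t ≤ T`, of the deterministic square-integrable function `σ`: the `L²(P)`-limit of the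
elementary integrals of step functions that converge to `σ` in `L²(0, T)`. -/
structure IsWienerIntegral {n : ℕ} {Ω : Type*} [MeasurableSpace Ω] (P : Measure Ω) (T : ℝ)
    (σ : ℝ → Matrix (Fin n) (Fin n) ℝ) (W : ℝ≥0 → Ω → Fin n → ℝ)
    (I : ℝ → Ω → Fin n → ℝ) : Prop where
  memLp : ∀ t ∈ Icc 0 T, MemLp (I t) 2 P
  approx : ∃ φ : ℕ → StepFn n,
    (∀ i j, Tendsto
      (fun k => eLpNorm (fun s => (φ k).val s i j - σ s i j) 2 (volume.restrict (Icc 0 T)))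
      atTop (𝓝 0)) ∧
    ∀ t ∈ Icc 0 T, Tendsto
      (fun k => eLpNorm (fun ω => (φ k).integral W t ω - I t ω) 2 P) atTop (𝓝 0)
  continuousOn : ∀ᵐ ω ∂P, ContinuousOn (fun t => I t ω) (Icc 0 T)

/-! ### Information and admissible controls -/

/-- The σ-algebra `σ(x₀, W_s : s ≤ t)`, the information of one player at time `t`. -/
abbrev playerInfo {n : ℕ} {Ω : Type*} (x₀ : Ω → Fin n → ℝ) (W : ℝ≥0 → Ω → Fin n → ℝ) (t : ℝ) :
    MeasurableSpace Ω :=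
  MeasurableSpace.comap x₀ inferInstance ⊔
    ⨆ s : ℝ≥0, ⨆ _ : (s : ℝ) ≤ t, MeasurableSpace.comap (W s) inferInstance

/-- The σ-algebra `σ(x₀¹, …, x₀ᴺ, W¹_s, …, Wᴺ_s : s ≤ t)`. -/
abbrev gameInfo {n N : ℕ} {Ω : Type*} (x₀ : Fin N → Ω → Fin n → ℝ)
    (W : Fin N → ℝ≥0 → Ω → Fin n → ℝ) (t : ℝ) : MeasurableSpace Ω :=
  ⨆ j, playerInfo (x₀ j) (W j) t

/-- The space `L²_𝓗(0, T; ℝᵐ)` of square-integrable processes on `[0, T]` adapted to the family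
`𝓗` of σ-algebras. As its elements are classes of processes, adaptedness is required for almost
every time and up to null sets. -/
structure IsAdmissible {m : ℕ} {Ω : Type*} [MeasurableSpace Ω] (P : Measure Ω) (T : ℝ)
    (H : ℝ → MeasurableSpace Ω) (v : ℝ → Ω → Fin m → ℝ) : Prop where
  memLp : MemLp (fun p : ℝ × Ω => v p.1 p.2) 2 ((volume.restrict (Icc 0 T)).prod P)
  adapted : ∀ᵐ t ∂(volume.restrict (Icc 0 T)), AEStronglyMeasurable[H t] (v t) P

/-! ### Dynamics and cost -/

/-- The quadratic form `x* M x`. -/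
def quad {k : ℕ} (M : Matrix (Fin k) (Fin k) ℝ) (x : Fin k → ℝ) : ℝ := x ⬝ᵥ (M *ᵥ x)

namespace Game

variable {n m : ℕ} (G : Game n m) {Ω : Type*} [MeasurableSpace Ω] (P : Measure Ω)

/-- `x` is a (continuous) solution on `[0, T]` of
`dx_t = (A_t x_t + B_t v_t + Abar_t μ_t) dt + σ_t dW_t`, `x_0 = x₀`,
with control `v` and interaction term `μ`. -/
structure IsState (x₀ : Ω → Fin n → ℝ) (W : ℝ≥0 → Ω → Fin n → ℝ) (v : ℝ → Ω → Fin m → ℝ)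
    (μ x : ℝ → Ω → Fin n → ℝ) : Prop where
  aestronglyMeasurable : ∀ t ∈ Icc 0 G.T, AEStronglyMeasurable (x t) P
  continuousOn : ∀ᵐ ω ∂P, ContinuousOn (fun t => x t ω) (Icc 0 G.T)
  integrable_drift : ∀ᵐ ω ∂P, IntervalIntegrable
    (fun s => G.A s *ᵥ x s ω + G.B s *ᵥ v s ω + G.Abar s *ᵥ μ s ω) volume 0 G.T
  eq : ∃ I : ℝ → Ω → Fin n → ℝ, IsWienerIntegral P G.T G.σ W I ∧
    ∀ᵐ ω ∂P, ∀ t ∈ Icc 0 G.T,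
      x t ω = x₀ ω
        + (∫ s in (0 : ℝ)..t, (G.A s *ᵥ x s ω + G.B s *ᵥ v s ω + G.Abar s *ᵥ μ s ω))
        + I t ω

/-- The quadratic cost of a player with control `v`, state `x` and interaction term `μ`:
`E[½ ∫₀ᵀ (x* Q x + v* R v + (x - S μ)* Qbar (x - S μ)) dt + ½ x_T* Q_T x_T
  + ½ (x_T - S_T μ_T)* Qbar_T (x_T - S_T μ_T)]`. -/
def cost (v : ℝ → Ω → Fin m → ℝ) (μ x : ℝ → Ω → Fin n → ℝ) : ℝ :=
  ∫ ω, ((1 / 2) * (∫ t in (0 : ℝ)..G.T, (quad (G.Q t) (x t ω) + quad (G.R t) (v t ω)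
          + quad (G.Qbar t) (x t ω - G.S t *ᵥ μ t ω)))
        + (1 / 2) * quad (G.Q G.T) (x G.T ω)
        + (1 / 2) * quad (G.Qbar G.T) (x G.T ω - G.S G.T *ᵥ μ G.T ω)) ∂P

/-! ### The mean field game -/

/-- `u` is an equilibrium strategy of the mean field game with initial state `x₀` and Wiener
process `W`, and `z` is the mean of its trajectory: the trajectory `y` of `u` in the mean field
`z` satisfies `E[y_t] = z_t`, and `u` minimizes the cost in the mean field `z` over all controls
adapted to `σ(x₀, W_s : s ≤ t)`. -/
structure IsMeanFieldEquilibrium (x₀ : Ω → Fin n → ℝ) (W : ℝ≥0 → Ω → Fin n → ℝ)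
    (z : ℝ → Fin n → ℝ) (u : ℝ → Ω → Fin m → ℝ) : Prop where
  admissible : IsAdmissible P G.T (playerInfo x₀ W) u
  continuousOn : ContinuousOn z (Icc 0 G.T)
  optimal : ∃ y : ℝ → Ω → Fin n → ℝ,
    G.IsState P x₀ W u (fun t _ => z t) y ∧
    (∀ t ∈ Icc 0 G.T, ∫ ω, y t ω ∂P = z t) ∧
    ∀ (v : ℝ → Ω → Fin m → ℝ) (x : ℝ → Ω → Fin n → ℝ),
      IsAdmissible P G.T (playerInfo x₀ W) v →
      G.IsState P x₀ W v (fun t _ => z t) x →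
      G.cost P u (fun t _ => z t) y ≤ G.cost P v (fun t _ => z t) x

/-! ### The game with finitely many players -/

/-- The average `(N - 1)⁻¹ ∑_{j ≠ i} x^j_t` of the states of the other players. -/
def othersMean {n N : ℕ} {Ω : Type*} (x : Fin N → ℝ → Ω → Fin n → ℝ) (i : Fin N) (t : ℝ)
    (ω : Ω) : Fin n → ℝ :=
  ((N : ℝ) - 1)⁻¹ • ∑ j ∈ Finset.univ.erase i, x j t ω

/-- `x = (x¹, …, xᴺ)` solves the coupled dynamics of the `N` players under the controls
`v = (v¹, …, vᴺ)`. -/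
def IsGameState {N : ℕ} (x₀ : Fin N → Ω → Fin n → ℝ) (W : Fin N → ℝ≥0 → Ω → Fin n → ℝ)
    (v : Fin N → ℝ → Ω → Fin m → ℝ) (x : Fin N → ℝ → Ω → Fin n → ℝ) : Prop :=
  ∀ i, G.IsState P (x₀ i) (W i) (v i) (othersMean x i) (x i)

/-- `u` is an `ε`-Nash equilibrium of the `N`-player game: no player `i` can lower his cost by
more than `ε` by changing to another control adapted to the information of all players. -/
def IsEpsNash {N : ℕ} (x₀ : Fin N → Ω → Fin n → ℝ) (W : Fin N → ℝ≥0 → Ω → Fin n → ℝ)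
    (u : Fin N → ℝ → Ω → Fin m → ℝ) (ε : ℝ) : Prop :=
  (∀ i, IsAdmissible P G.T (gameInfo x₀ W) (u i)) ∧
  ∀ (i : Fin N) (v : ℝ → Ω → Fin m → ℝ), IsAdmissible P G.T (gameInfo x₀ W) v →
    ∀ x y : Fin N → ℝ → Ω → Fin n → ℝ,
      G.IsGameState P x₀ W (Function.update u i v) x →
      G.IsGameState P x₀ W u y →
      G.cost P (u i) (othersMean y i) (y i) - ε ≤ G.cost P v (othersMean x i) (x i)

end Game

/-- The random data of `N` players: i.i.d. initial states with law `ν`, and independent standard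
Wiener processes that are independent of the initial states. -/
structure IsRandomData {n N : ℕ} {Ω : Type*} [MeasurableSpace Ω] (P : Measure Ω)
    (ν : Measure (Fin n → ℝ)) (x₀ : Fin N → Ω → Fin n → ℝ)
    (W : Fin N → ℝ≥0 → Ω → Fin n → ℝ) : Prop where
  measurable_init : ∀ i, Measurable (x₀ i)
  law_init : ∀ i, HasLaw (x₀ i) ν P
  indep_init : iIndepFun x₀ P
  wiener : ∀ i, IsStdWiener P (W i)
  indep_wiener : iIndepFun (fun (i : Fin N) ω (t : ℝ≥0) => W i t ω) P
  indep_init_wiener :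
    IndepFun (fun ω (i : Fin N) => x₀ i ω) (fun ω (i : Fin N) (t : ℝ≥0) => W i t ω) P

end LQMFG

end

noncomputable section

namespace LQMFG

/-! ### Matrices acting on vectors with the sup norm -/

/-! The cost is the diagonal of a positive semidefinite symmetric form `Game.form` on triples
(control, deviation `x - S μ`, state) in `L²`; the terminal terms fit in because `horizonEnd` puts a
unit mass at `T`. Hence the square root of the cost is a seminorm, and costs are compared by
estimating differences of triples.

Suppose player `i` plays `u i + w` and the others keep their equilibrium strategies. In the frozen
mean field `z` the states decouple: they are the trajectories `y j`, with `y i` replaced by `y i +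
resp w`. The `y j` are independent with mean `z`, so their averages are within `O(1/√N)` of `z` in
`L²`, and the deviating player shifts an average by only `O(‖w‖/N)`. The noise cancels in the
difference between game states and decoupled states, and a Grönwall argument for the coupled system,
with constants independent of `N`, bounds it by `O((1 + ‖w‖)/√N)` (`exists_coupled_gronwall`,
`exists_L2Bd_sub_decoupled`). So the root of the game cost differs by that much from the root of the
mean field cost of `u i + w` (`exists_abs_sqrt_form_sub_le`).

It remains to see that `u i` is optimal in the mean field even against controls that use the
information of all players (`form_le_form_of_optimal`). The first variation in direction `w` is `½ ∫
g · w`, with a gradient `g` measurable with respect to the information of player `i` at time `T`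
(`exists_gradient`). Optimality among the player's own controls says that `g s` has conditional mean
zero given his information at time `s`. The other players' data are independent of his, so adjoining
them leaves the conditional mean zero. The first variation thus vanishes for all admissible `w`, and
the second is nonnegative.

The error above grows with `‖w‖`, but a deviation matters only if it lowers the cost. Coercivity of
`R` then bounds the control, hence `w`, independently of `N` (`exists_control_le`), because
comparison with the zero control bounds the equilibrium cost (`exists_equilibrium_bound`). Factoring
the difference of the costs as a difference of squares of their roots gives the rate `1/√N`. -/

lemma norm_mulVec_le {k l : ℕ} {M : Matrix (Fin k) (Fin l) ℝ} {K : ℝ}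
    (hM : ∀ i j, |M i j| ≤ K) (hK : 0 ≤ K) (x : Fin l → ℝ) : ‖M *ᵥ x‖ ≤ l * K * ‖x‖ := by
  refine (pi_norm_le_iff_of_nonneg (by positivity)).2 fun i => ?_
  calc ‖(M *ᵥ x) i‖ ≤ ∑ j, ‖M i j * x j‖ := norm_sum_le Finset.univ fun j => M i j * x j
    _ ≤ ∑ _j : Fin l, K * ‖x‖ := by
        refine Finset.sum_le_sum fun j _ => ?_
        rw [norm_mul]
        exact mul_le_mul (hM i j) (norm_le_pi_norm x j) (norm_nonneg _) hK
    _ = l * K * ‖x‖ := by simp [mul_assoc]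

lemma norm_dotProduct_le {k : ℕ} (x y : Fin k → ℝ) : ‖x ⬝ᵥ y‖ ≤ k * (‖x‖ * ‖y‖) := by
  calc ‖x ⬝ᵥ y‖ ≤ ∑ j, ‖x j * y j‖ := norm_sum_le Finset.univ fun j => x j * y j
    _ ≤ ∑ _j : Fin k, ‖x‖ * ‖y‖ := by
        refine Finset.sum_le_sum fun j _ => ?_
        rw [norm_mul]
        exact mul_le_mul (norm_le_pi_norm x j) (norm_le_pi_norm y j) (norm_nonneg _)
          (norm_nonneg _)
    _ = k * (‖x‖ * ‖y‖) := by simp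

lemma norm_sq_le_dotProduct {k : ℕ} (x : Fin k → ℝ) : ‖x‖ ^ 2 ≤ x ⬝ᵥ x := by
  have h0 : 0 ≤ x ⬝ᵥ x := Finset.sum_nonneg fun i _ => mul_self_nonneg _
  have h : ‖x‖ ≤ Real.sqrt (x ⬝ᵥ x) := by
    refine (pi_norm_le_iff_of_nonneg (Real.sqrt_nonneg _)).2 fun i => ?_
    rw [Real.norm_eq_abs]
    refine Real.abs_le_sqrt ?_
    rw [sq]
    exact Finset.single_le_sum (f := fun i => x i * x i) (fun i _ => mul_self_nonneg _)
      (Finset.mem_univ i)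
  calc ‖x‖ ^ 2 ≤ Real.sqrt (x ⬝ᵥ x) ^ 2 := by gcongr
    _ = x ⬝ᵥ x := Real.sq_sqrt h0

lemma aestronglyMeasurable_mulVec {k l : ℕ} {α : Type*} [MeasurableSpace α] {μ : Measure α}
    {M : α → Matrix (Fin k) (Fin l) ℝ} {f : α → Fin l → ℝ}
    (hM : ∀ i j, AEMeasurable (fun a => M a i j) μ) (hf : AEStronglyMeasurable f μ) :
    AEStronglyMeasurable (fun a => M a *ᵥ f a) μ := by
  refine AEMeasurable.aestronglyMeasurable (aemeasurable_pi_lambda _ fun i => ?_)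
  have hf' := aemeasurable_pi_iff.1 hf.aemeasurable
  simp only [Matrix.mulVec, dotProduct]
  exact Finset.aemeasurable_fun_sum _ fun j _ => (hM i j).mul (hf' j)

lemma IsBddMeas.norm_mulVec_le {k l : ℕ} {T : ℝ} {M : ℝ → Matrix (Fin k) (Fin l) ℝ}
    (hM : IsBddMeas T M) :
    ∃ L : ℝ, 0 ≤ L ∧ ∀ t ∈ Icc 0 T, ∀ x, ‖M t *ᵥ x‖ ≤ L * ‖x‖ := by
  obtain ⟨-, K, hK⟩ := hM
  refine ⟨l * |K|, by positivity, fun t ht x => ?_⟩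
  exact LQMFG.norm_mulVec_le (fun i j => (hK t ht i j).trans (le_abs_self K)) (abs_nonneg K) x

lemma IsBddMeas.intervalIntegrable_mulVec {k l : ℕ} {T : ℝ} (hT : 0 ≤ T)
    {M : ℝ → Matrix (Fin k) (Fin l) ℝ}
    (hM : IsBddMeas T M) {f : ℝ → Fin l → ℝ} (hf : IntervalIntegrable f volume 0 T) :
    IntervalIntegrable (fun t => M t *ᵥ f t) volume 0 T := by
  obtain ⟨L, hL, hLM⟩ := hM.norm_mulVec_le
  rw [intervalIntegrable_iff_integrableOn_Icc_of_le hT] at hf ⊢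
  refine (hf.norm.const_mul L).mono' (aestronglyMeasurable_mulVec hM.1 hf.1) ?_
  filter_upwards [ae_restrict_mem measurableSet_Icc] with t ht using hLM t ht _

/-! ### Grönwall's inequality and linear equations with measurable coefficients -/

/-- The right-hand side `F` of the hypothesis has derivative `L f ≤ L F`, so `F exp(-L t)` is
antitone. No sign of `f` or `c` is needed. -/
lemma le_mul_exp_of_le_add_integral {f : ℝ → ℝ} {T c L : ℝ} (hf : ContinuousOn f (Icc 0 T))
    (hL : 0 ≤ L) (h : ∀ t ∈ Icc 0 T, f t ≤ c + L * ∫ s in (0 : ℝ)..t, f s) :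
    ∀ t ∈ Icc 0 T, f t ≤ c * Real.exp (L * t) := by
  intro t ht
  have hT : 0 ≤ T := ht.1.trans ht.2
  set F : ℝ → ℝ := fun t => c + L * ∫ s in (0 : ℝ)..t, f s with hF
  have hint : IntervalIntegrable f volume 0 T :=
    (hf.mono (by rw [uIcc_of_le hT])).intervalIntegrable
  have hFc : ContinuousOn F (Icc 0 T) := by
    have := intervalIntegral.continuousOn_primitive_interval' hint (left_mem_uIcc)
    rw [uIcc_of_le hT] at this
    exact continuousOn_const.add (continuousOn_const.mul this)
  have hFd : ∀ s ∈ Ioo 0 T, HasDerivAt F (L * f s) s := by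
    intro s hs
    have hfs : ContinuousAt f s := hf.continuousAt (Icc_mem_nhds hs.1 hs.2)
    have h1 : IntervalIntegrable f volume 0 s :=
      hint.mono_set (by rw [uIcc_of_le hs.1.le, uIcc_of_le hT]; exact Icc_subset_Icc_right hs.2.le)
    have hm : StronglyMeasurableAtFilter f (𝓝 s) volume :=
      (hf.mono Ioo_subset_Icc_self).stronglyMeasurableAtFilter isOpen_Ioo s hs
    exact ((intervalIntegral.integral_hasDerivAt_right h1 hm hfs).const_mul L).const_add c
  have hanti : AntitoneOn (fun s => F s * Real.exp (-(L * s))) (Icc 0 T) := by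
    have hd : ∀ s ∈ Ioo 0 T, HasDerivAt (fun s => F s * Real.exp (-(L * s)))
        (L * f s * Real.exp (-(L * s)) + F s * (Real.exp (-(L * s)) * (-(L * 1)))) s := by
      intro s hs
      exact (hFd s hs).mul ((((hasDerivAt_id s).const_mul L).neg).exp)
    refine antitoneOn_of_deriv_nonpos (convex_Icc 0 T) ?_ ?_ ?_
    · exact hFc.mul (by fun_prop)
    · rw [interior_Icc]
      exact fun s hs => (hd s hs).differentiableAt.differentiableWithinAt
    · rw [interior_Icc]
      intro s hs
      rw [(hd s hs).deriv]
      have h1 : f s ≤ F s := h s (Ioo_subset_Icc_self hs)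
      have h2 := Real.exp_pos (-(L * s))
      have : L * f s * Real.exp (-(L * s)) ≤ L * F s * Real.exp (-(L * s)) := by gcongr
      nlinarith
  have h1 := hanti (left_mem_Icc.2 hT) ht ht.1
  simp only [hF, intervalIntegral.integral_same, mul_zero, add_zero, neg_zero, Real.exp_zero,
    mul_one] at h1
  have h2 := h t ht
  calc f t ≤ F t := h2
    _ = F t * Real.exp (-(L * t)) * Real.exp (L * t) := by
        rw [mul_assoc, ← Real.exp_add]; simp
    _ ≤ c * Real.exp (L * t) := by gcongr

/-- `A` is only bounded and measurable, so the equation is meant in integral form and solved by the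
contraction principle. The unknown is `θ t = exp(-l t) x t`; the exponential weight makes the Picard
map a contraction on all of `[0, T]` at once. -/
lemma exists_linear_ode {n : ℕ} {T : ℝ} (hT : 0 ≤ T) {A : ℝ → Matrix (Fin n) (Fin n) ℝ}
    (hA : IsBddMeas T A) (x₀ : Fin n → ℝ) :
    ∃ x : ℝ → Fin n → ℝ, Continuous x ∧
      ∀ t ∈ Icc 0 T, x t = x₀ + ∫ s in (0 : ℝ)..t, A s *ᵥ x s := by
  obtain ⟨L, hL, hLA⟩ := hA.norm_mulVec_le
  -- The contraction ratio is `L / l`; this choice makes it at most `1/2`, and keeps `l` positive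
  -- when `L = 0`.
  set l : ℝ := 2 * L + 1 with hl
  have hl0 : 0 < l := by positivity
  let ext : C(Icc (0 : ℝ) T, Fin n → ℝ) → ℝ → Fin n → ℝ := fun θ => IccExtend hT θ
  have hext : ∀ θ, Continuous (ext θ) := fun θ => θ.continuous.Icc_extend'
  have hcont : ∀ θ, Continuous fun s => Real.exp (l * s) • ext θ s := fun θ =>
    (by fun_prop : Continuous fun s => Real.exp (l * s)).smul (hext θ)
  have hint : ∀ θ, IntervalIntegrable (fun s => A s *ᵥ (Real.exp (l * s) • ext θ s))
      volume 0 T := fun θ => hA.intervalIntegrable_mulVec hT ((hcont θ).intervalIntegrable _ _)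
  have hpc : ∀ θ, ContinuousOn
      (fun t => ∫ s in (0 : ℝ)..t, A s *ᵥ (Real.exp (l * s) • ext θ s)) (Icc 0 T) := by
    intro θ
    have := intervalIntegral.continuousOn_primitive_interval' (hint θ) left_mem_uIcc
    rwa [uIcc_of_le hT] at this
  let Φ : C(Icc (0 : ℝ) T, Fin n → ℝ) → C(Icc (0 : ℝ) T, Fin n → ℝ) := fun θ =>
    ⟨fun t => Real.exp (-(l * t)) •
      (x₀ + ∫ s in (0 : ℝ)..(t : ℝ), A s *ᵥ (Real.exp (l * s) • ext θ s)), by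
      have h1 := continuousOn_iff_continuous_domRestrict.1 (hpc θ)
      have h2 : Continuous fun t : Icc (0 : ℝ) T => Real.exp (-(l * t)) := by fun_prop
      exact h2.smul (continuous_const.add h1)⟩
  have hΦ : ContractingWith (1 / 2) Φ := by
    refine ⟨by norm_num, LipschitzWith.of_dist_le_mul fun θ η => ?_⟩
    rw [dist_eq_norm, dist_eq_norm, ContinuousMap.norm_le _ (by positivity)]
    rintro ⟨t, ht⟩
    have hsub : uIcc 0 t ⊆ uIcc 0 T := by
      rw [uIcc_of_le ht.1, uIcc_of_le hT]; exact Icc_subset_Icc_right ht.2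
    have e1 : (Φ θ - Φ η) ⟨t, ht⟩ = Real.exp (-(l * t)) •
        ∫ s in (0 : ℝ)..t, (A s *ᵥ (Real.exp (l * s) • ext θ s)
          - A s *ᵥ (Real.exp (l * s) • ext η s)) := by
      rw [intervalIntegral.integral_sub ((hint θ).mono_set hsub) ((hint η).mono_set hsub)]
      simp only [Φ, ContinuousMap.sub_apply, ContinuousMap.coe_mk, ← smul_sub]
      congr 1
      abel
    have e2 : ‖∫ s in (0 : ℝ)..t, (A s *ᵥ (Real.exp (l * s) • ext θ s)
          - A s *ᵥ (Real.exp (l * s) • ext η s))‖ ≤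
        ∫ s in (0 : ℝ)..t, L * ‖θ - η‖ * Real.exp (l * s) := by
      refine intervalIntegral.norm_integral_le_of_norm_le ht.1 ?_
        ((by fun_prop : Continuous fun s => L * ‖θ - η‖ * Real.exp (l * s)).intervalIntegrable _ _)
      refine Eventually.of_forall fun s hs => ?_
      have hs' : s ∈ Icc 0 T := ⟨hs.1.le, hs.2.trans ht.2⟩
      rw [← Matrix.mulVec_sub, ← smul_sub]
      refine (hLA s hs' _).trans ?_
      rw [norm_smul, Real.norm_eq_abs, abs_of_pos (Real.exp_pos _)]
      have : ‖ext θ s - ext η s‖ ≤ ‖θ - η‖ := by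
        simp only [ext, IccExtend_of_mem hT _ hs']
        exact (θ - η).norm_coe_le_norm ⟨s, hs'⟩
      calc L * (Real.exp (l * s) * ‖ext θ s - ext η s‖)
          ≤ L * (Real.exp (l * s) * ‖θ - η‖) := by gcongr
        _ = _ := by ring
    have e3 : ∫ s in (0 : ℝ)..t, L * ‖θ - η‖ * Real.exp (l * s)
        = L * ‖θ - η‖ * ((Real.exp (l * t) - 1) / l) := by
      rw [intervalIntegral.integral_const_mul,
        intervalIntegral.integral_comp_mul_left (fun x => Real.exp x) hl0.ne', integral_exp]
      simp [div_eq_inv_mul]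
    rw [e1, norm_smul, Real.norm_eq_abs, abs_of_pos (Real.exp_pos _)]
    calc Real.exp (-(l * t)) * _
        ≤ Real.exp (-(l * t)) * (L * ‖θ - η‖ * ((Real.exp (l * t) - 1) / l)) := by
          rw [← e3]; gcongr
      _ = L / l * ‖θ - η‖ * (Real.exp (-(l * t)) * Real.exp (l * t) - Real.exp (-(l * t))) := by
          field_simp
      _ = L / l * ‖θ - η‖ * (1 - Real.exp (-(l * t))) := by
          rw [← Real.exp_add]; simp
      _ ≤ 1 / 2 * ‖θ - η‖ * 1 := by
          have h1 : L / l ≤ 1 / 2 := by rw [div_le_iff₀ hl0]; linarith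
          have h2 := Real.exp_pos (-(l * t))
          have h3 : Real.exp (-(l * t)) ≤ 1 := by
            rw [Real.exp_le_one_iff]; have := mul_nonneg hl0.le ht.1; linarith
          gcongr
          linarith
      _ = _ := by simp
  set θ := hΦ.fixedPoint Φ with hθ
  have hfix : Φ θ = θ := hΦ.fixedPoint_isFixedPt
  refine ⟨fun t => Real.exp (l * t) • ext θ t, hcont θ, fun t ht => ?_⟩
  have h1 : ext θ t = Real.exp (-(l * t)) •
      (x₀ + ∫ s in (0 : ℝ)..t, A s *ᵥ (Real.exp (l * s) • ext θ s)) := by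
    have h2 := congrArg (fun f : C(Icc (0 : ℝ) T, Fin n → ℝ) => f ⟨t, ht⟩) hfix
    simp only [ext, IccExtend_of_mem hT _ ht]
    exact h2.symm
  show Real.exp (l * t) • ext θ t = _
  rw [h1, smul_smul, ← Real.exp_add]
  simp

lemma intervalIntegral_apply {l : ℕ} {f : ℝ → Fin l → ℝ} {a b : ℝ}
    (hf : IntervalIntegrable f volume a b) (i : Fin l) :
    (∫ s in a..b, f s) i = ∫ s in a..b, f s i :=
  ((ContinuousLinearMap.proj (R := ℝ) (φ := fun _ : Fin l => ℝ) i).intervalIntegral_comp_comm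
    hf).symm

lemma intervalIntegrable_apply {l : ℕ} {f : ℝ → Fin l → ℝ} {a b : ℝ}
    (hf : IntervalIntegrable f volume a b) (i : Fin l) :
    IntervalIntegrable (fun s => f s i) volume a b := by
  rw [intervalIntegrable_iff] at hf ⊢
  exact Integrable.eval hf i

lemma intervalIntegrable_of_apply {l : ℕ} {f : ℝ → Fin l → ℝ} {a b : ℝ}
    (hf : ∀ i, IntervalIntegrable (fun s => f s i) volume a b) :
    IntervalIntegrable f volume a b := by
  rw [intervalIntegrable_iff]
  exact Integrable.of_eval fun i => intervalIntegrable_iff.1 (hf i)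

/-- Integration by parts for absolutely continuous functions: the derivatives of the two primitives
are `a` and `b` only almost everywhere, which suffices. -/
lemma mul_eq_integral {T f₀ g₀ : ℝ} {f g a b : ℝ → ℝ}
    (ha : IntervalIntegrable a volume 0 T) (hb : IntervalIntegrable b volume 0 T)
    (hf : ∀ t ∈ Icc 0 T, f t = f₀ + ∫ s in (0 : ℝ)..t, a s)
    (hg : ∀ t ∈ Icc 0 T, g t = g₀ + ∫ s in (0 : ℝ)..t, b s) :
    ∀ t ∈ Icc 0 T, f t * g t = f₀ * g₀ + ∫ s in (0 : ℝ)..t, (a s * g s + f s * b s) := by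
  intro t ht
  have hT : 0 ≤ T := ht.1.trans ht.2
  have hsub : uIcc 0 t ⊆ uIcc 0 T := by
    rw [uIcc_of_le ht.1, uIcc_of_le hT]; exact Icc_subset_Icc_right ht.2
  replace ha := ha.mono_set hsub
  replace hb := hb.mono_set hsub
  set F : ℝ → ℝ := fun t => f₀ + ∫ s in (0 : ℝ)..t, a s
  set G : ℝ → ℝ := fun t => g₀ + ∫ s in (0 : ℝ)..t, b s
  have hF : AbsolutelyContinuousOnInterval F 0 t :=
    ((contDiff_const (c := f₀)).contDiffOn.absolutelyContinuousOnInterval).fun_add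
      (ha.absolutelyContinuousOnInterval_intervalIntegral left_mem_uIcc)
  have hG : AbsolutelyContinuousOnInterval G 0 t :=
    ((contDiff_const (c := g₀)).contDiffOn.absolutelyContinuousOnInterval).fun_add
      (hb.absolutelyContinuousOnInterval_intervalIntegral left_mem_uIcc)
  have h := hF.integral_deriv_mul_eq_sub hG
  have e : ∫ x in (0 : ℝ)..t, deriv F x * G x + F x * deriv G x
      = ∫ s in (0 : ℝ)..t, (a s * g s + f s * b s) := by
    refine intervalIntegral.integral_congr_ae ?_
    filter_upwards [ha.ae_hasDerivAt_integral, hb.ae_hasDerivAt_integral] with x hxa hxb hx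
    have hx' := uIoc_subset_uIcc hx
    have h1 : HasDerivAt F (a x) x := (hxa hx' 0 left_mem_uIcc).const_add f₀
    have h2 : HasDerivAt G (b x) x := (hxb hx' 0 left_mem_uIcc).const_add g₀
    have hxT : x ∈ Icc 0 T := by rw [← uIcc_of_le hT]; exact hsub hx'
    rw [h1.deriv, h2.deriv, hf x hxT, hg x hxT]
  rw [e] at h
  rw [h, hf t ht, hg t ht]
  simp [F, G]

lemma dotProduct_eq_integral {l : ℕ} {T : ℝ} {f₀ g₀ : Fin l → ℝ} {f g a b : ℝ → Fin l → ℝ}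
    (ha : IntervalIntegrable a volume 0 T) (hb : IntervalIntegrable b volume 0 T)
    (hf : ∀ t ∈ Icc 0 T, f t = f₀ + ∫ s in (0 : ℝ)..t, a s)
    (hg : ∀ t ∈ Icc 0 T, g t = g₀ + ∫ s in (0 : ℝ)..t, b s) :
    ∀ t ∈ Icc 0 T, f t ⬝ᵥ g t = f₀ ⬝ᵥ g₀ + ∫ s in (0 : ℝ)..t, (a s ⬝ᵥ g s + f s ⬝ᵥ b s) := by
  intro t ht
  have hT : 0 ≤ T := ht.1.trans ht.2
  have hsub : ∀ {t}, t ∈ Icc 0 T → uIcc 0 t ⊆ uIcc 0 T := fun {t} ht => by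
    rw [uIcc_of_le ht.1, uIcc_of_le hT]; exact Icc_subset_Icc_right ht.2
  have key : ∀ {h c : ℝ → Fin l → ℝ} {h₀ : Fin l → ℝ}, IntervalIntegrable c volume 0 T →
      (∀ t ∈ Icc 0 T, h t = h₀ + ∫ s in (0 : ℝ)..t, c s) →
      (∀ k, ∀ t ∈ Icc 0 T, h t k = h₀ k + ∫ s in (0 : ℝ)..t, c s k) ∧
      ∀ k, ContinuousOn (fun t => h t k) (uIcc 0 t) := by
    intro h c h₀ hc hh
    have h1 : ∀ k, ∀ t ∈ Icc 0 T, h t k = h₀ k + ∫ s in (0 : ℝ)..t, c s k := by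
      intro k t ht
      rw [hh t ht, Pi.add_apply, intervalIntegral_apply (hc.mono_set (hsub ht))]
    refine ⟨h1, fun k => ?_⟩
    have h2 := intervalIntegral.continuousOn_primitive_interval'
      (intervalIntegrable_apply hc k) left_mem_uIcc
    refine (((continuousOn_const (c := h₀ k)).add h2).congr fun s hs => ?_).mono (hsub ht)
    rw [uIcc_of_le hT] at hs
    exact h1 k s hs
  obtain ⟨hf1, hf2⟩ := key ha hf
  obtain ⟨hg1, hg2⟩ := key hb hg
  have h3 : ∀ k, IntervalIntegrable (fun s => a s k * g s k + f s k * b s k) volume 0 t := fun k =>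
    (((intervalIntegrable_apply ha k).mono_set (hsub ht)).mul_continuousOn (hg2 k)).add
      (((intervalIntegrable_apply hb k).mono_set (hsub ht)).continuousOn_mul (hf2 k))
  simp only [dotProduct, ← Finset.sum_add_distrib]
  rw [intervalIntegral.integral_finsetSum fun k _ => h3 k, ← Finset.sum_add_distrib]
  refine Finset.sum_congr rfl fun k _ => ?_
  exact mul_eq_integral (intervalIntegrable_apply ha k) (intervalIntegrable_apply hb k)
    (hf1 k) (hg1 k) t ht

/-- A fundamental matrix `Φ` of the linear equation `x' = A x` on `[0, T]`, and its inverse. -/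
structure FundSol {n : ℕ} (T : ℝ) (A : ℝ → Matrix (Fin n) (Fin n) ℝ) where
  Φ : ℝ → Matrix (Fin n) (Fin n) ℝ
  Ψ : ℝ → Matrix (Fin n) (Fin n) ℝ
  continuous_Φ : ∀ i j, Continuous fun t => Φ t i j
  continuous_Ψ : ∀ i j, Continuous fun t => Ψ t i j
  mul_eq_one : ∀ t ∈ Icc 0 T, Φ t * Ψ t = 1
  eq : ∀ t ∈ Icc 0 T, ∀ i j, Φ t i j = (1 : Matrix (Fin n) (Fin n) ℝ) i j
    + ∫ s in (0 : ℝ)..t, (A s * Φ s) i j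

lemma IsBddMeas.neg_transpose {k l : ℕ} {T : ℝ} {M : ℝ → Matrix (Fin k) (Fin l) ℝ}
    (hM : IsBddMeas T M) : IsBddMeas T fun t => -(M t)ᵀ :=
  ⟨fun i j => (hM.1 j i).neg, hM.2.imp fun _ h t ht i j => by simpa using h t ht j i⟩

lemma IsBddMeas.transpose {k l : ℕ} {T : ℝ} {M : ℝ → Matrix (Fin k) (Fin l) ℝ}
    (hM : IsBddMeas T M) : IsBddMeas T fun t => (M t)ᵀ :=
  ⟨fun i j => hM.1 j i, hM.2.imp fun _ h t ht i j => by simpa using h t ht j i⟩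

lemma isBddMeas_of_continuous {k l : ℕ} (T : ℝ) {M : ℝ → Matrix (Fin k) (Fin l) ℝ}
    (hM : ∀ i j, Continuous fun t => M t i j) : IsBddMeas T M := by
  refine ⟨fun i j => (hM i j).aemeasurable, ?_⟩
  have h : ∀ i j, ∃ K : ℝ, ∀ t ∈ Icc 0 T, |M t i j| ≤ K := fun i j =>
    isCompact_Icc.exists_bound_of_continuousOn (hM i j).continuousOn
  choose K hK using h
  refine ⟨∑ i, ∑ j, |K i j|, fun t ht i j => ?_⟩
  calc |M t i j| ≤ |K i j| := (hK i j t ht).trans (le_abs_self _)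
    _ ≤ ∑ j, |K i j| := Finset.single_le_sum (f := fun j => |K i j|)
        (fun j _ => abs_nonneg _) (Finset.mem_univ j)
    _ ≤ ∑ i, ∑ j, |K i j| := Finset.single_le_sum (f := fun i => ∑ j, |K i j|)
        (fun i _ => Finset.sum_nonneg fun j _ => abs_nonneg _) (Finset.mem_univ i)

/-- The columns of `Φ` solve `x' = A x`, and the rows of `Ψ` solve the adjoint equation `y' = -Aᵀ
y`. The products `y ⬝ᵥ x` are then constant in time, so `Ψ Φ = 1` persists from time `0`, and `Φ Ψ =
1` follows since the matrices are square. -/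
lemma nonempty_fundSol {n : ℕ} {T : ℝ} (hT : 0 ≤ T) {A : ℝ → Matrix (Fin n) (Fin n) ℝ}
    (hA : IsBddMeas T A) : Nonempty (FundSol T A) := by
  choose x hxc hx using fun j : Fin n =>
    exists_linear_ode hT hA ((1 : Matrix (Fin n) (Fin n) ℝ) j)
  choose y hyc hy using fun j : Fin n =>
    exists_linear_ode hT hA.neg_transpose ((1 : Matrix (Fin n) (Fin n) ℝ) j)
  have hsub : ∀ {t}, t ∈ Icc 0 T → uIcc 0 t ⊆ uIcc 0 T := fun {t} ht => by
    rw [uIcc_of_le ht.1, uIcc_of_le hT]; exact Icc_subset_Icc_right ht.2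
  have hxi : ∀ j, IntervalIntegrable (fun s => A s *ᵥ x j s) volume 0 T := fun j =>
    hA.intervalIntegrable_mulVec hT ((hxc j).intervalIntegrable _ _)
  have hyi : ∀ j, IntervalIntegrable (fun s => -(A s)ᵀ *ᵥ y j s) volume 0 T := fun j =>
    hA.neg_transpose.intervalIntegrable_mulVec hT ((hyc j).intervalIntegrable _ _)
  refine ⟨⟨fun t => .of fun i j => x j t i, fun t => .of fun i j => y i t j,
    fun i j => (continuous_apply i).comp (hxc j), fun i j => (continuous_apply j).comp (hyc i),
    fun t ht => ?_, fun t ht i j => ?_⟩⟩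
  · rw [mul_eq_one_comm]
    ext i j
    have h := dotProduct_eq_integral (hyi i) (hxi j) (hy i) (hx j) t ht
    have h0 : ∀ s, (-(A s)ᵀ *ᵥ y i s) ⬝ᵥ x j s + y i s ⬝ᵥ (A s *ᵥ x j s) = 0 := by
      intro s
      rw [Matrix.neg_mulVec, Matrix.mulVec_transpose, neg_dotProduct,
        ← Matrix.dotProduct_mulVec]
      simp
    simp only [h0, intervalIntegral.integral_zero, add_zero] at h
    have h1 : (1 : Matrix (Fin n) (Fin n) ℝ) i ⬝ᵥ (1 : Matrix (Fin n) (Fin n) ℝ) j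
        = (1 : Matrix (Fin n) (Fin n) ℝ) i j := by
      simp [dotProduct, Matrix.one_apply]
    rw [h1] at h
    exact h
  · have h := congrFun (hx j t ht) i
    rw [Pi.add_apply, intervalIntegral_apply ((hxi j).mono_set (hsub ht))] at h
    have h1 : (1 : Matrix (Fin n) (Fin n) ℝ) j i = (1 : Matrix (Fin n) (Fin n) ℝ) i j := by
      simp [Matrix.one_apply, eq_comm]
    rw [h1] at h
    exact h

namespace FundSol

variable {n : ℕ} {T : ℝ} {A : ℝ → Matrix (Fin n) (Fin n) ℝ} (F : FundSol T A)

/-- The solution `d` of `d' = A d + f`, `d 0 = 0`, by variation of constants. -/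
def flow (f : ℝ → Fin n → ℝ) (t : ℝ) : Fin n → ℝ :=
  F.Φ t *ᵥ ∫ s in (0 : ℝ)..t, F.Ψ s *ᵥ f s

lemma isBddMeas_Φ : IsBddMeas T F.Φ := isBddMeas_of_continuous T F.continuous_Φ

lemma isBddMeas_Ψ : IsBddMeas T F.Ψ := isBddMeas_of_continuous T F.continuous_Ψ

lemma continuousOn_flow (hT : 0 ≤ T) {f : ℝ → Fin n → ℝ}
    (hf : IntervalIntegrable f volume 0 T) : ContinuousOn (F.flow f) (Icc 0 T) := by
  have h1 := F.isBddMeas_Ψ.intervalIntegrable_mulVec hT hf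
  have h2 := intervalIntegral.continuousOn_primitive_interval' h1 left_mem_uIcc
  rw [uIcc_of_le hT] at h2
  refine continuousOn_pi.2 fun i => ?_
  simp only [flow, Matrix.mulVec, dotProduct]
  refine continuousOn_finsetSum (f := fun j t => F.Φ t i j * (∫ s in (0 : ℝ)..t, F.Ψ s *ᵥ f s) j)
    _ fun j _ => ?_
  exact (F.continuous_Φ i j).continuousOn.mul (continuousOn_pi.1 h2 j)

/-- The product rule for a row of `Φ` and the primitive of `Ψ f` gives two terms: one is `A` applied
to the flow, and in the other `Φ Ψ = 1` leaves `f`. -/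
lemma flow_eq (hT : 0 ≤ T) (hA : IsBddMeas T A) {f : ℝ → Fin n → ℝ}
    (hf : IntervalIntegrable f volume 0 T) :
    ∀ t ∈ Icc 0 T, F.flow f t = ∫ s in (0 : ℝ)..t, (A s *ᵥ F.flow f s + f s) := by
  intro t ht
  have hsub : uIcc 0 t ⊆ uIcc 0 T := by
    rw [uIcc_of_le ht.1, uIcc_of_le hT]; exact Icc_subset_Icc_right ht.2
  have hΨf := F.isBddMeas_Ψ.intervalIntegrable_mulVec hT hf
  have hfl : IntervalIntegrable (F.flow f) volume 0 T :=
    ContinuousOn.intervalIntegrable (by rw [uIcc_of_le hT]; exact F.continuousOn_flow hT hf)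
  have hAfl := hA.intervalIntegrable_mulVec hT hfl
  have hAΦ : ∀ i j, IntervalIntegrable (fun s => (A s * F.Φ s) i j) volume 0 T := fun i j =>
    intervalIntegrable_apply (hA.intervalIntegrable_mulVec hT (f := fun s k => F.Φ s k j)
      ((continuous_pi fun k => F.continuous_Φ k j).intervalIntegrable _ _)) i
  ext i
  have h := dotProduct_eq_integral (T := T) (f := fun t => F.Φ t i)
    (g := fun t => ∫ s in (0 : ℝ)..t, F.Ψ s *ᵥ f s) (a := fun s => (A s * F.Φ s) i)
    (f₀ := (1 : Matrix (Fin n) (Fin n) ℝ) i) (g₀ := 0)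
    (intervalIntegrable_of_apply (hAΦ i)) hΨf
    (fun s hs => by
      ext j
      have hsub' : uIcc 0 s ⊆ uIcc 0 T := by
        rw [uIcc_of_le hs.1, uIcc_of_le hT]; exact Icc_subset_Icc_right hs.2
      rw [Pi.add_apply, intervalIntegral_apply
        ((intervalIntegrable_of_apply (hAΦ i)).mono_set hsub'), F.eq s hs])
    (fun s _ => by simp) t ht
  rw [intervalIntegral_apply ((hAfl.add hf).mono_set hsub)]
  change F.Φ t i ⬝ᵥ _ = _
  rw [h, dotProduct_zero, zero_add]
  refine intervalIntegral.integral_congr fun s hs => ?_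
  have hs' : s ∈ Icc 0 T := by rw [← uIcc_of_le hT]; exact hsub hs
  have e1 : (A s * F.Φ s) i ⬝ᵥ (∫ r in (0 : ℝ)..s, F.Ψ r *ᵥ f r) = (A s *ᵥ F.flow f s) i := by
    rw [flow, Matrix.mulVec_mulVec]; rfl
  have e2 : F.Φ s i ⬝ᵥ (F.Ψ s *ᵥ f s) = f s i := by
    change (F.Φ s *ᵥ (F.Ψ s *ᵥ f s)) i = f s i
    rw [Matrix.mulVec_mulVec, F.mul_eq_one s hs', Matrix.one_mulVec]
  simp only [e1, e2, Pi.add_apply]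

/-- The forcing `r` contains the noise and need not have bounded variation, so it is subtracted
first: `y - r` solves an equation with the integrable input `A r`. Uniqueness is Grönwall with
initial constant `0`. This formula yields both the moment bounds and the measurability of states. -/
lemma eq_add_flow (hT : 0 ≤ T) (hA : IsBddMeas T A) {y r : ℝ → Fin n → ℝ}
    (hy : ContinuousOn y (Icc 0 T)) (hr : ContinuousOn r (Icc 0 T))
    (h : ∀ t ∈ Icc 0 T, y t = r t + ∫ s in (0 : ℝ)..t, A s *ᵥ y s) :
    ∀ t ∈ Icc 0 T, y t = r t + F.flow (fun s => A s *ᵥ r s) t := by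
  have hu : uIcc 0 T = Icc 0 T := uIcc_of_le hT
  have hsub : ∀ {t}, t ∈ Icc 0 T → uIcc 0 t ⊆ uIcc 0 T := fun {t} ht => by
    rw [uIcc_of_le ht.1, uIcc_of_le hT]; exact Icc_subset_Icc_right ht.2
  have hAr : IntervalIntegrable (fun s => A s *ᵥ r s) volume 0 T :=
    hA.intervalIntegrable_mulVec hT (ContinuousOn.intervalIntegrable (by rwa [hu]))
  have hAy : IntervalIntegrable (fun s => A s *ᵥ y s) volume 0 T :=
    hA.intervalIntegrable_mulVec hT (ContinuousOn.intervalIntegrable (by rwa [hu]))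
  have hfc := F.continuousOn_flow hT hAr
  have hAf : IntervalIntegrable (fun s => A s *ᵥ F.flow (fun s => A s *ᵥ r s) s) volume 0 T :=
    hA.intervalIntegrable_mulVec hT (ContinuousOn.intervalIntegrable (by rwa [hu]))
  obtain ⟨L, hL, hLA⟩ := hA.norm_mulVec_le
  set e : ℝ → Fin n → ℝ := fun t => y t - r t - F.flow (fun s => A s *ᵥ r s) t with he
  have hec : ContinuousOn e (Icc 0 T) := (hy.sub hr).sub hfc
  have hee : ∀ t ∈ Icc 0 T, e t = ∫ s in (0 : ℝ)..t, A s *ᵥ e s := by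
    intro t ht
    have e1 : ∀ s, A s *ᵥ e s = A s *ᵥ y s
        - (A s *ᵥ F.flow (fun s => A s *ᵥ r s) s + A s *ᵥ r s) := fun s => by
      simp only [he, Matrix.mulVec_sub]; abel
    simp only [e1]
    rw [intervalIntegral.integral_sub (hAy.mono_set (hsub ht)) ((hAf.add hAr).mono_set (hsub ht)),
      ← F.flow_eq hT hA hAr t ht]
    simp only [he]
    rw [h t ht]
    abel
  intro t ht
  have hb := le_mul_exp_of_le_add_integral (f := fun t => ‖e t‖) (c := 0) hec.norm hL
    (fun t ht => by
      have hi : IntervalIntegrable (fun s => L * ‖e s‖) volume 0 t :=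
        (ContinuousOn.intervalIntegrable (by rw [hu]; exact hec.norm.const_mul L)).mono_set
          (hsub ht)
      rw [zero_add, ← intervalIntegral.integral_const_mul]
      nth_rw 1 [hee t ht]
      refine intervalIntegral.norm_integral_le_of_norm_le ht.1 ?_ hi
      exact Eventually.of_forall fun s hs => hLA s ⟨hs.1.le, hs.2.trans ht.2⟩ _) t ht
  rw [zero_mul] at hb
  have h0 : e t = 0 := norm_le_zero_iff.1 hb
  simp only [he, sub_sub, sub_eq_zero] at h0
  exact h0

end FundSol

/-! ### Isometry and uniqueness of the Wiener integral -/

lemma eLpNorm_two_eq_sqrt {α E : Type*} [MeasurableSpace α] {μ : Measure α}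
    [NormedAddCommGroup E] {f : α → E} (hf : MemLp f 2 μ) :
    eLpNorm f 2 μ = ENNReal.ofReal (Real.sqrt (∫ a, ‖f a‖ ^ 2 ∂μ)) := by
  rw [hf.eLpNorm_eq_integral_rpow_norm two_ne_zero ENNReal.ofNat_ne_top]
  simp [Real.sqrt_eq_rpow]

lemma eLpNorm_pi_le_sum {α : Type*} [MeasurableSpace α] {μ : Measure α} {k : ℕ}
    {f : α → Fin k → ℝ} (hf : AEStronglyMeasurable f μ) :
    eLpNorm f 2 μ ≤ ∑ i, eLpNorm (fun a => f a i) 2 μ := by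
  have hf' := aemeasurable_pi_iff.1 hf.aemeasurable
  calc eLpNorm f 2 μ ≤ eLpNorm (∑ i, fun a => |f a i|) 2 μ := by
        refine eLpNorm_mono_real fun a => ?_
        refine (pi_norm_le_iff_of_nonneg (by simp [Finset.sum_nonneg])).2 fun i => ?_
        simp only [Finset.sum_apply, Real.norm_eq_abs]
        exact Finset.single_le_sum (f := fun i => |f a i|) (fun _ _ => abs_nonneg _)
          (Finset.mem_univ i)
    _ ≤ ∑ i, eLpNorm (fun a => |f a i|) 2 μ :=
        eLpNorm_sum_le (fun i _ => (hf' i).aestronglyMeasurable.norm) (by norm_num)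
    _ = ∑ i, eLpNorm (fun a => f a i) 2 μ :=
        Finset.sum_congr rfl fun i _ => eLpNorm_norm fun a => f a i

section Brownian

variable {Ω : Type*} [MeasurableSpace Ω] {P : Measure Ω}

lemma memLp_two_of_isPreBrownianReal {B : ℝ≥0 → Ω → ℝ} (hB : IsPreBrownianReal B P) (t : ℝ≥0) :
    MemLp (B t) 2 P :=
  (hB.isGaussianProcess.hasGaussianLaw_eval t).memLp_two

lemma integral_mul_of_isPreBrownianReal {B : ℝ≥0 → Ω → ℝ} (hB : IsPreBrownianReal B P)
    (s t : ℝ≥0) : ∫ ω, B s ω * B t ω ∂P = min s t := by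
  have : IsProbabilityMeasure P := hB.isGaussianProcess.isProbabilityMeasure
  have h := hB.covariance_eval s t
  rw [covariance_eq_sub (memLp_two_of_isPreBrownianReal hB s)
    (memLp_two_of_isPreBrownianReal hB t), hB.integral_eval, zero_mul, sub_zero] at h
  exact h

/-- The covariance of Brownian motion as an inner product of indicators, which makes `B s ↦ 1_(0,
s]` isometric. One time bounded by `T` suffices, because the minimum then lies in `[0, T]`. -/
lemma integral_indicator_mul_indicator {T : ℝ} {s t : ℝ≥0} (hs : (s : ℝ) ≤ T) :
    ∫ r in Icc 0 T, (Ioc (0 : ℝ) s).indicator 1 r * (Ioc (0 : ℝ) t).indicator 1 r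
      = min (s : ℝ) t := by
  have h : ∀ r : ℝ, (Ioc (0 : ℝ) s).indicator (1 : ℝ → ℝ) r * (Ioc (0 : ℝ) t).indicator 1 r
      = (Ioc (0 : ℝ) (min (s : ℝ) t)).indicator 1 r := by
    intro r
    simp only [indicator_apply, mem_Ioc, le_min_iff, Pi.one_apply]
    split_ifs <;> grind
  simp_rw [h]
  rw [integral_indicator_one measurableSet_Ioc, measureReal_restrict_apply measurableSet_Ioc]
  have : Ioc (0 : ℝ) (min (s : ℝ) t) ∩ Icc 0 T = Ioc (0 : ℝ) (min (s : ℝ) t) := by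
    refine inter_eq_left.2 fun x hx => ⟨hx.1.le, (hx.2.trans (min_le_left _ _)).trans hs⟩
  rw [this, measureReal_def, Real.volume_Ioc, sub_zero]
  exact ENNReal.toReal_ofReal (le_min s.2 t.2)

/-- The isometry for linear combinations of values of a Brownian motion. -/
lemma integral_sq_sum_of_isPreBrownianReal {B : ℝ≥0 → Ω → ℝ} (hB : IsPreBrownianReal B P)
    {T : ℝ} {ι : Type*} (J : Finset ι) (c : ι → ℝ) (x : ι → ℝ≥0) (hx : ∀ k ∈ J, (x k : ℝ) ≤ T) :
    ∫ ω, (∑ k ∈ J, c k * B (x k) ω) ^ 2 ∂P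
      = ∫ r in Icc 0 T, (∑ k ∈ J, c k * (Ioc (0 : ℝ) (x k)).indicator 1 r) ^ 2 := by
  have h1 : ∀ ω, (∑ k ∈ J, c k * B (x k) ω) ^ 2
      = ∑ k ∈ J, ∑ l ∈ J, c k * c l * (B (x k) ω * B (x l) ω) := fun ω => by
    rw [sq, Finset.sum_mul_sum]
    exact Finset.sum_congr rfl fun k _ => Finset.sum_congr rfl fun l _ => by ring
  have h2 : ∀ r : ℝ, (∑ k ∈ J, c k * (Ioc (0 : ℝ) (x k)).indicator (1 : ℝ → ℝ) r) ^ 2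
      = ∑ k ∈ J, ∑ l ∈ J, c k * c l * ((Ioc (0 : ℝ) (x k)).indicator 1 r
        * (Ioc (0 : ℝ) (x l)).indicator 1 r) := fun r => by
    rw [sq, Finset.sum_mul_sum]
    exact Finset.sum_congr rfl fun k _ => Finset.sum_congr rfl fun l _ => by ring
  have m1 : ∀ k, MemLp ((Ioc (0 : ℝ) (x k)).indicator (1 : ℝ → ℝ)) 2
      (volume.restrict (Icc 0 T)) := fun k =>
    memLp_indicator_const 2 measurableSet_Ioc 1 (Or.inr (measure_ne_top _ _))
  have i1 : ∀ k l, Integrable (fun ω => c k * c l * (B (x k) ω * B (x l) ω)) P := fun k l =>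
    ((memLp_two_of_isPreBrownianReal hB _).integrable_mul
      (memLp_two_of_isPreBrownianReal hB _)).const_mul _
  have i2 : ∀ k l, Integrable (fun r => c k * c l * ((Ioc (0 : ℝ) (x k)).indicator 1 r
        * (Ioc (0 : ℝ) (x l)).indicator 1 r)) (volume.restrict (Icc 0 T)) := fun k l =>
    ((m1 k).integrable_mul (m1 l)).const_mul _
  simp_rw [h1, h2]
  rw [integral_finsetSum _ fun k _ => integrable_finsetSum _ fun l _ => i1 k l,
    integral_finsetSum _ fun k _ => integrable_finsetSum _ fun l _ => i2 k l]
  refine Finset.sum_congr rfl fun k hk => ?_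
  rw [integral_finsetSum _ fun l _ => i1 k l, integral_finsetSum _ fun l _ => i2 k l]
  refine Finset.sum_congr rfl fun l _ => ?_
  rw [integral_const_mul, integral_const_mul, integral_mul_of_isPreBrownianReal hB,
    integral_indicator_mul_indicator (hx k hk), NNReal.coe_min]

lemma eLpNorm_sum_of_isPreBrownianReal {B : ℝ≥0 → Ω → ℝ} (hB : IsPreBrownianReal B P)
    {T : ℝ} {ι : Type*} (J : Finset ι) (c : ι → ℝ) (x : ι → ℝ≥0) (hx : ∀ k ∈ J, (x k : ℝ) ≤ T) :
    eLpNorm (fun ω => ∑ k ∈ J, c k * B (x k) ω) 2 P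
      = eLpNorm (fun r => ∑ k ∈ J, c k * (Ioc (0 : ℝ) (x k)).indicator 1 r) 2
        (volume.restrict (Icc 0 T)) := by
  rw [eLpNorm_two_eq_sqrt, eLpNorm_two_eq_sqrt]
  · simp only [Real.norm_eq_abs, sq_abs]
    rw [integral_sq_sum_of_isPreBrownianReal hB J c x hx]
  · exact memLp_finsetSum _ fun k _ => MemLp.const_mul
      (memLp_indicator_const 2 measurableSet_Ioc (1 : ℝ) (Or.inr (measure_ne_top _ _))) _
  · exact memLp_finsetSum _ fun k _ => (memLp_two_of_isPreBrownianReal hB _).const_mul _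

end Brownian

section Wiener

variable {n : ℕ} {Ω : Type*} [MeasurableSpace Ω] {P : Measure Ω} {W : ℝ≥0 → Ω → Fin n → ℝ}

lemma StepFn.val_apply (φ : StepFn n) (s : ℝ) (i j : Fin n) :
    φ.val s i j = ∑ k ∈ Finset.range φ.K,
      φ.c k i j * (Ioc (φ.τ k : ℝ) (φ.τ (k + 1))).indicator 1 s := by
  simp only [StepFn.val, Matrix.sum_apply]
  refine Finset.sum_congr rfl fun k _ => ?_
  by_cases h : s ∈ Ioc (φ.τ k : ℝ) (φ.τ (k + 1)) <;> simp [h]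

omit [MeasurableSpace Ω] in
lemma StepFn.integral_apply (φ : StepFn n) (t : ℝ) (ω : Ω) (i : Fin n) :
    φ.integral W t ω i = ∑ j, ∑ k ∈ Finset.range φ.K, φ.c k i j *
      (W (min (φ.τ (k + 1)) t.toNNReal) ω j - W (min (φ.τ k) t.toNNReal) ω j) := by
  simp only [StepFn.integral, Finset.sum_apply, Matrix.mulVec, dotProduct, Pi.sub_apply]
  exact Finset.sum_comm

omit [MeasurableSpace Ω] in
-- The truncation `t.toNNReal` is `0` for negative `t`, so `W 0` is read even then; this is why the
-- bound is `max t 0`.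
lemma StepFn.measurable_integral (φ : StepFn n) {m : MeasurableSpace Ω} {t : ℝ}
    (hW : ∀ s : ℝ≥0, (s : ℝ) ≤ max t 0 → Measurable[m] (W s)) :
    Measurable[m] (φ.integral W t) := by
  refine measurable_pi_lambda _ fun i => ?_
  simp only [StepFn.integral_apply]
  have h : ∀ s : ℝ≥0, ∀ j, Measurable[m] fun ω => W (min s t.toNNReal) ω j := fun s j =>
    (measurable_pi_apply j).comp (hW _
    ((NNReal.coe_le_coe.2 (min_le_right _ _)).trans (by rw [Real.coe_toNNReal'])))
  exact Finset.measurable_fun_sum _ fun j _ => Finset.measurable_fun_sum _ fun k _ =>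
    ((h _ j).sub (h _ j)).const_mul _

lemma indicator_Ioc_min {a b t s : ℝ} (hab : a ≤ b) (ha : 0 ≤ a) (hs : s ≤ t) :
    (Ioc (0 : ℝ) (min b t)).indicator (1 : ℝ → ℝ) s - (Ioc (0 : ℝ) (min a t)).indicator 1 s
      = (Ioc a b).indicator 1 s := by
  simp only [indicator_apply, mem_Ioc, le_min_iff, hs, and_true, Pi.one_apply]
  split_ifs <;> grind

lemma indicator_Ioc_min_of_lt {a t s : ℝ} (hs : t < s) :
    (Ioc (0 : ℝ) (min a t)).indicator (1 : ℝ → ℝ) s = 0 :=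
  indicator_of_notMem (fun h => absurd (h.2.trans (min_le_right _ _)) (not_le.2 hs)) _

/-- Each entry `(i, j)` contributes a linear combination of values of one Brownian motion, to which
the scalar isometry applies. The entries are put together by the triangle inequality, which costs
only a constant. -/
lemma eLpNorm_integral_sub_le [IsProbabilityMeasure P] (hW : IsStdWiener P W) (φ ψ : StepFn n)
    {T t : ℝ} (ht : t ∈ Icc 0 T) :
    eLpNorm (fun ω => φ.integral W t ω - ψ.integral W t ω) 2 P ≤
      ∑ i, ∑ j, eLpNorm (fun s => φ.val s i j - ψ.val s i j) 2 (volume.restrict (Icc 0 T)) := by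
  have hm : ∀ φ : StepFn n, AEStronglyMeasurable (φ.integral W t) P := fun φ =>
    (φ.measurable_integral fun s _ => hW.measurable s).aestronglyMeasurable
  refine (eLpNorm_pi_le_sum ((hm φ).sub (hm ψ))).trans (Finset.sum_le_sum fun i _ => ?_)
  have hWm : ∀ s j, Measurable fun ω => W s ω j := fun s j =>
    (measurable_pi_apply j).comp (hW.measurable s)
  set X : StepFn n → Fin n → Ω → ℝ := fun φ j ω => ∑ k ∈ Finset.range φ.K, φ.c k i j *
      (W (min (φ.τ (k + 1)) t.toNNReal) ω j - W (min (φ.τ k) t.toNNReal) ω j) with hX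
  have hXm : ∀ φ j, Measurable (X φ j) := fun φ j =>
    Finset.measurable_fun_sum _ fun k _ => ((hWm _ j).sub (hWm _ j)).const_mul _
  have e1 : (fun ω => (φ.integral W t ω - ψ.integral W t ω) i) = ∑ j, (X φ j - X ψ j) := by
    ext ω
    simp [StepFn.integral_apply, hX, Finset.sum_sub_distrib]
  change eLpNorm (fun ω => (φ.integral W t ω - ψ.integral W t ω) i) 2 P ≤ _
  rw [e1]
  refine (eLpNorm_sum_le (fun j _ => ((hXm φ j).sub (hXm ψ j)).aestronglyMeasurable)
    (by norm_num)).trans (Finset.sum_le_sum fun j _ => ?_)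
  have hB := (hW.brownian j).toIsPreBrownianReal
  -- Four families of evaluation times: right and left endpoints of the steps of `φ`, then of `ψ`,
  -- with the signs recorded in `c`.
  let J : Finset ((ℕ ⊕ ℕ) ⊕ (ℕ ⊕ ℕ)) :=
    ((Finset.range φ.K).disjSum (Finset.range φ.K)).disjSum
      ((Finset.range ψ.K).disjSum (Finset.range ψ.K))
  let c : (ℕ ⊕ ℕ) ⊕ (ℕ ⊕ ℕ) → ℝ :=
    Sum.elim (Sum.elim (fun k => φ.c k i j) fun k => -φ.c k i j)
      (Sum.elim (fun k => -ψ.c k i j) fun k => ψ.c k i j)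
  let x : (ℕ ⊕ ℕ) ⊕ (ℕ ⊕ ℕ) → ℝ≥0 :=
    Sum.elim
      (Sum.elim (fun k => min (φ.τ (k + 1)) t.toNNReal) fun k => min (φ.τ k) t.toNNReal)
      (Sum.elim (fun k => min (ψ.τ (k + 1)) t.toNNReal) fun k => min (ψ.τ k) t.toNNReal)
  have hxt : ∀ p, (x p : ℝ) ≤ T := by
    intro p
    refine le_trans ?_ ht.2
    rcases p with (k | k) | (k | k) <;> simp [x, ht.1]
  have e2 : X φ j - X ψ j = fun ω => ∑ p ∈ J, c p * W (x p) ω j := by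
    ext ω
    simp only [J, c, x, hX, Finset.sum_disjSum, Sum.elim_inl, Sum.elim_inr, Pi.sub_apply, mul_sub,
      Finset.sum_sub_distrib, neg_mul, Finset.sum_neg_distrib]
    ring
  rw [e2, eLpNorm_sum_of_isPreBrownianReal hB J c x (fun p _ => hxt p)]
  refine eLpNorm_mono_ae ?_
  filter_upwards with s
  have e3 : ∑ p ∈ J, c p * (Ioc (0 : ℝ) (x p)).indicator (1 : ℝ → ℝ) s
      = ∑ k ∈ Finset.range φ.K, φ.c k i j *
          ((Ioc (0 : ℝ) (min (φ.τ (k + 1) : ℝ) t)).indicator 1 s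
            - (Ioc (0 : ℝ) (min (φ.τ k : ℝ) t)).indicator 1 s)
        - ∑ k ∈ Finset.range ψ.K, ψ.c k i j *
          ((Ioc (0 : ℝ) (min (ψ.τ (k + 1) : ℝ) t)).indicator 1 s
            - (Ioc (0 : ℝ) (min (ψ.τ k : ℝ) t)).indicator 1 s) := by
    simp only [J, c, x, Finset.sum_disjSum, Sum.elim_inl, Sum.elim_inr, mul_sub,
      Finset.sum_sub_distrib, neg_mul, Finset.sum_neg_distrib, NNReal.coe_min,
      Real.coe_toNNReal t ht.1]
    ring
  rw [e3]
  -- Up to time `t` the combination of indicators equals `φ - ψ`; after `t` it vanishes because all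
  -- endpoints are truncated at `t`.
  rcases le_or_gt s t with hs | hs
  · rw [StepFn.val_apply, StepFn.val_apply]
    refine le_of_eq ?_
    congr 2
    · exact Finset.sum_congr rfl fun k _ => by
        rw [indicator_Ioc_min (NNReal.coe_le_coe.2 (φ.mono k.le_succ)) (φ.τ k).2 hs]
    · exact Finset.sum_congr rfl fun k _ => by
        rw [indicator_Ioc_min (NNReal.coe_le_coe.2 (ψ.mono k.le_succ)) (ψ.τ k).2 hs]
  · simp [indicator_Ioc_min_of_lt hs]

lemma StepFn.measurable_val (φ : StepFn n) (i j : Fin n) : Measurable fun s => φ.val s i j := by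
  simp only [StepFn.val_apply]
  exact Finset.measurable_fun_sum _ fun k _ =>
    (measurable_one.indicator measurableSet_Ioc).const_mul _

lemma measurable_limsup_apply {Ω : Type*} {m : MeasurableSpace Ω} {f : ℕ → Ω → Fin n → ℝ}
    (hf : ∀ k, Measurable (f k)) : Measurable fun ω i => limsup (fun k => f k ω i) atTop :=
  measurable_pi_lambda _ fun i => Measurable.limsup fun k => (measurable_pi_apply i).comp (hf k)

/-- The coordinatewise `limsup` is an `m`-measurable version of the limit; the exceptional null set
need not belong to `m`. -/
lemma aestronglyMeasurable_of_tendsto {Ω : Type*} {m : MeasurableSpace Ω} [MeasurableSpace Ω]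
    {P : Measure Ω} {f : ℕ → Ω → Fin n → ℝ}
    {g : Ω → Fin n → ℝ} (hf : ∀ k, Measurable[m] (f k))
    (h : ∀ᵐ ω ∂P, Tendsto (fun k => f k ω) atTop (𝓝 (g ω))) : AEStronglyMeasurable[m] g P := by
  refine ⟨fun ω i => limsup (fun k => f k ω i) atTop, ?_, ?_⟩
  · exact (measurable_limsup_apply hf).stronglyMeasurable
  · filter_upwards [h] with ω hω
    ext i
    exact ((tendsto_pi_nhds.1 hω i).limsup_eq).symm

variable {T : ℝ} {σ : ℝ → Matrix (Fin n) (Fin n) ℝ} {I I' : ℝ → Ω → Fin n → ℝ}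

/-- The definition allows each integral its own approximating sequence. Both sequences converge to
`σ`, so by the isometry their elementary integrals merge. -/
lemma IsWienerIntegral.ae_eq_at [IsProbabilityMeasure P] (hW : IsStdWiener P W)
    (hσ : ∀ i j, MemLp (fun t => σ t i j) 2 (volume.restrict (Icc 0 T)))
    (hI : IsWienerIntegral P T σ W I) (hI' : IsWienerIntegral P T σ W I') {t : ℝ}
    (ht : t ∈ Icc 0 T) : I t =ᵐ[P] I' t := by
  obtain ⟨φ, hφ, hφI⟩ := hI.approx
  obtain ⟨ψ, hψ, hψI⟩ := hI'.approx
  have hm : ∀ φ : StepFn n, AEStronglyMeasurable (φ.integral W t) P := fun φ =>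
    (φ.measurable_integral fun s _ => hW.measurable s).aestronglyMeasurable
  have hIm := (hI.memLp t ht).1
  have hIm' := (hI'.memLp t ht).1
  have hv : ∀ (φ : StepFn n) i j, AEStronglyMeasurable (fun s => φ.val s i j - σ s i j)
      (volume.restrict (Icc 0 T)) := fun φ i j =>
    (φ.measurable_val i j).aestronglyMeasurable.sub (hσ i j).1
  have hle : ∀ k, eLpNorm (fun ω => I t ω - I' t ω) 2 P ≤
      eLpNorm (fun ω => (φ k).integral W t ω - I t ω) 2 P +
      (∑ i, ∑ j, (eLpNorm (fun s => (φ k).val s i j - σ s i j) 2 (volume.restrict (Icc 0 T))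
        + eLpNorm (fun s => (ψ k).val s i j - σ s i j) 2 (volume.restrict (Icc 0 T)))) +
      eLpNorm (fun ω => (ψ k).integral W t ω - I' t ω) 2 P := by
    intro k
    have e : (fun ω => I t ω - I' t ω) =
        ((fun ω => (φ k).integral W t ω - (ψ k).integral W t ω)
          - fun ω => (φ k).integral W t ω - I t ω)
        + fun ω => (ψ k).integral W t ω - I' t ω := by
      ext ω; simp
    rw [e]
    refine (eLpNorm_add_le (((hm _).sub (hm _)).sub ((hm _).sub hIm)) ((hm _).sub hIm')
      (by norm_num)).trans (add_le_add ?_ le_rfl)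
    refine (eLpNorm_sub_le ((hm _).sub (hm _)) ((hm _).sub hIm) (by norm_num)).trans ?_
    rw [add_comm]
    refine add_le_add le_rfl ((eLpNorm_integral_sub_le hW (φ k) (ψ k) ht).trans ?_)
    refine Finset.sum_le_sum fun i _ => Finset.sum_le_sum fun j _ => ?_
    have e : (fun s => (φ k).val s i j - (ψ k).val s i j)
        = (fun s => (φ k).val s i j - σ s i j) - fun s => (ψ k).val s i j - σ s i j := by
      ext s; simp
    rw [e]
    exact eLpNorm_sub_le (hv _ i j) (hv _ i j) (by norm_num)
  have hlim := ((hφI t ht).add (tendsto_finsetSum Finset.univ fun i _ =>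
    tendsto_finsetSum Finset.univ fun j _ => (hφ i j).add (hψ i j))).add (hψI t ht)
  simp only [add_zero, Finset.sum_const_zero] at hlim
  have h0 : eLpNorm (fun ω => I t ω - I' t ω) 2 P = 0 := le_zero_iff.1 (ge_of_tendsto' hlim hle)
  have h1 := (eLpNorm_eq_zero_iff (hIm.sub hIm') two_ne_zero).1 h0
  filter_upwards [h1] with ω hω
  exact sub_eq_zero.1 hω

/-- Equality holds simultaneously at the countably many rational times, and continuity of the paths
extends it to all times. -/
lemma ae_forall_eq_of_continuousOn {X Y : ℝ → Ω → Fin n → ℝ} (hT : 0 < T)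
    (hX : ∀ᵐ ω ∂P, ContinuousOn (fun t => X t ω) (Icc 0 T))
    (hY : ∀ᵐ ω ∂P, ContinuousOn (fun t => Y t ω) (Icc 0 T))
    (h : ∀ t ∈ Icc 0 T, X t =ᵐ[P] Y t) : ∀ᵐ ω ∂P, ∀ t ∈ Icc 0 T, X t ω = Y t ω := by
  have hq : ∀ᵐ ω ∂P, ∀ q : ℚ, (q : ℝ) ∈ Icc 0 T → X q ω = Y q ω :=
    ae_all_iff.2 fun q => by
      by_cases hq : (q : ℝ) ∈ Icc 0 T
      · filter_upwards [h q hq] with ω hω _ using hω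
      · exact Eventually.of_forall fun ω h => absurd h hq
  filter_upwards [hX, hY, hq] with ω h1 h2 h3
  have hd : Icc 0 T ⊆ closure (Ioo 0 T ∩ range ((↑) : ℚ → ℝ)) := by
    rw [← closure_Ioo hT.ne]
    exact closure_minimal (Dense.open_subset_closure_inter (s := range ((↑) : ℚ → ℝ))
      Rat.denseRange_cast isOpen_Ioo) isClosed_closure
  refine fun t ht => ?_
  have hs : Ioo 0 T ∩ range ((↑) : ℚ → ℝ) ⊆ Icc 0 T := fun x hx => Ioo_subset_Icc_self hx.1
  refine Set.EqOn.of_subset_closure (s := Ioo 0 T ∩ range ((↑) : ℚ → ℝ)) ?_ h1 h2 hs hd ht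
  rintro _ ⟨hx, q, rfl⟩
  exact h3 q (Ioo_subset_Icc_self hx)

lemma IsWienerIntegral.ae_forall_eq [IsProbabilityMeasure P] (hT : 0 < T) (hW : IsStdWiener P W)
    (hσ : ∀ i j, MemLp (fun t => σ t i j) 2 (volume.restrict (Icc 0 T)))
    (hI : IsWienerIntegral P T σ W I) (hI' : IsWienerIntegral P T σ W I') :
    ∀ᵐ ω ∂P, ∀ t ∈ Icc 0 T, I t ω = I' t ω :=
  ae_forall_eq_of_continuousOn hT hI.continuousOn hI'.continuousOn
    fun _ ht => hI.ae_eq_at hW hσ hI' ht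

lemma IsWienerIntegral.eLpNorm_le [IsProbabilityMeasure P] (hW : IsStdWiener P W)
    (hσ : ∀ i j, MemLp (fun t => σ t i j) 2 (volume.restrict (Icc 0 T)))
    (hI : IsWienerIntegral P T σ W I) {t : ℝ} (ht : t ∈ Icc 0 T) :
    eLpNorm (I t) 2 P ≤ ∑ i, ∑ j, eLpNorm (fun s => σ s i j) 2 (volume.restrict (Icc 0 T)) := by
  obtain ⟨φ, hφ, hφI⟩ := hI.approx
  have hm : ∀ φ : StepFn n, AEStronglyMeasurable (φ.integral W t) P := fun φ =>
    (φ.measurable_integral fun s _ => hW.measurable s).aestronglyMeasurable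
  have hIm := (hI.memLp t ht).1
  -- Comparing with the zero step function turns the estimate for differences into a bound for a
  -- single integral.
  let ψ : StepFn n := ⟨0, fun _ => 0, monotone_const, fun _ => 0⟩
  have hψ : ∀ ω, ψ.integral W t ω = 0 := fun ω => by simp [ψ, StepFn.integral]
  have hψv : ∀ s i j, ψ.val s i j = 0 := fun s i j => by simp [ψ, StepFn.val]
  have hle : ∀ k, eLpNorm (I t) 2 P ≤
      (∑ i, ∑ j, (eLpNorm (fun s => (φ k).val s i j - σ s i j) 2 (volume.restrict (Icc 0 T))
        + eLpNorm (fun s => σ s i j) 2 (volume.restrict (Icc 0 T)))) +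
      eLpNorm (fun ω => (φ k).integral W t ω - I t ω) 2 P := by
    intro k
    have e : I t = (fun ω => (φ k).integral W t ω - ψ.integral W t ω)
          - fun ω => (φ k).integral W t ω - I t ω := by
      ext ω; simp [hψ]
    nth_rw 1 [e]
    refine (eLpNorm_sub_le ((hm _).sub (hm _)) ((hm _).sub hIm) (by norm_num)).trans
      (add_le_add ((eLpNorm_integral_sub_le hW (φ k) ψ ht).trans ?_) le_rfl)
    refine Finset.sum_le_sum fun i _ => Finset.sum_le_sum fun j _ => ?_
    have e : (fun s => (φ k).val s i j - ψ.val s i j)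
        = (fun s => (φ k).val s i j - σ s i j) + fun s => σ s i j := by
      ext s; simp [hψv]
    rw [e]
    exact eLpNorm_add_le (((φ k).measurable_val i j).aestronglyMeasurable.sub (hσ i j).1)
      (hσ i j).1 (by norm_num)
  have hlim := (tendsto_finsetSum Finset.univ fun i _ =>
    tendsto_finsetSum Finset.univ fun j _ => (hφ i j).add (tendsto_const_nhds
      (x := eLpNorm (fun s => σ s i j) 2 (volume.restrict (Icc 0 T))))).add (hφI t ht)
  simp only [add_zero, zero_add] at hlim
  exact ge_of_tendsto' hlim hle

/-- Along a subsequence the elementary integrals converge almost surely, and those up to time `t`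
read the path only up to `t`. -/
lemma IsWienerIntegral.aestronglyMeasurable {Ω : Type*} {m : MeasurableSpace Ω}
    [MeasurableSpace Ω] {P : Measure Ω} {W : ℝ≥0 → Ω → Fin n → ℝ} {I : ℝ → Ω → Fin n → ℝ} (hI : IsWienerIntegral P T σ W I)
    (hW : ∀ s, Measurable (W s)) {t : ℝ} (ht : t ∈ Icc 0 T)
    (hm : ∀ s : ℝ≥0, (s : ℝ) ≤ t → Measurable[m] (W s)) : AEStronglyMeasurable[m] (I t) P := by
  obtain ⟨φ, -, hφI⟩ := hI.approx
  have h1 : TendstoInMeasure P (fun k => (φ k).integral W t) atTop (I t) :=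
    tendstoInMeasure_of_tendsto_eLpNorm two_ne_zero
      (fun k => ((φ k).measurable_integral fun s _ => hW s).aestronglyMeasurable)
      (hI.memLp t ht).1 (hφI t ht)
  obtain ⟨ns, -, hns⟩ := h1.exists_seq_tendsto_ae
  refine aestronglyMeasurable_of_tendsto (f := fun k => (φ (ns k)).integral W t) (fun k => ?_) hns
  exact (φ (ns k)).measurable_integral fun s hs => hm s (by rwa [max_eq_left ht.1] at hs)

end Wiener

/-! ### Quantitative square integrability -/

/-- `f` has `L²(μ)`-norm at most `c`. -/
structure L2Bd {α E : Type*} [MeasurableSpace α] [NormedAddCommGroup E] (μ : Measure α)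
    (f : α → E) (c : ℝ) : Prop where
  aesm : AEStronglyMeasurable f μ
  nonneg : 0 ≤ c
  le : eLpNorm f 2 μ ≤ ENNReal.ofReal c

namespace L2Bd

variable {α E : Type*} [MeasurableSpace α] [NormedAddCommGroup E] {μ : Measure α}
  {f g : α → E} {a b c : ℝ}

lemma memLp (hf : L2Bd μ f c) : MemLp f 2 μ := ⟨hf.aesm, hf.le.trans_lt ENNReal.ofReal_lt_top⟩

lemma of_memLp (hf : MemLp f 2 μ) : L2Bd μ f (eLpNorm f 2 μ).toReal :=
  ⟨hf.1, ENNReal.toReal_nonneg, by rw [ENNReal.ofReal_toReal hf.2.ne]⟩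

lemma mono (hf : L2Bd μ f a) (h : a ≤ b) : L2Bd μ f b :=
  ⟨hf.aesm, hf.nonneg.trans h, hf.le.trans (ENNReal.ofReal_le_ofReal h)⟩

lemma add (hf : L2Bd μ f a) (hg : L2Bd μ g b) : L2Bd μ (fun x => f x + g x) (a + b) :=
  ⟨hf.aesm.add hg.aesm, add_nonneg hf.nonneg hg.nonneg, by
    rw [ENNReal.ofReal_add hf.nonneg hg.nonneg]
    exact (eLpNorm_add_le hf.aesm hg.aesm (by norm_num)).trans (add_le_add hf.le hg.le)⟩

lemma sub (hf : L2Bd μ f a) (hg : L2Bd μ g b) : L2Bd μ (fun x => f x - g x) (a + b) :=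
  ⟨hf.aesm.sub hg.aesm, add_nonneg hf.nonneg hg.nonneg, by
    rw [ENNReal.ofReal_add hf.nonneg hg.nonneg]
    exact (eLpNorm_sub_le hf.aesm hg.aesm (by norm_num)).trans (add_le_add hf.le hg.le)⟩

lemma of_le {F : Type*} [NormedAddCommGroup F] {g : α → F} {h : α → ℝ} (hh : L2Bd μ h c)
    (hg : AEStronglyMeasurable g μ) (hle : ∀ᵐ x ∂μ, ‖g x‖ ≤ h x) : L2Bd μ g c :=
  ⟨hg, hh.nonneg, (eLpNorm_mono_ae_real hle).trans hh.le⟩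

lemma norm (hf : L2Bd μ f c) : L2Bd μ (fun x => ‖f x‖) c :=
  ⟨hf.aesm.norm, hf.nonneg, by rw [eLpNorm_norm]; exact hf.le⟩

lemma const_mul {f : α → ℝ} (hf : L2Bd μ f c) (K : ℝ) : L2Bd μ (fun x => K * f x) (|K| * c) :=
  ⟨hf.aesm.const_mul K, mul_nonneg (abs_nonneg _) hf.nonneg, by
    have h : eLpNorm (fun x => K * f x) 2 μ = ‖K‖ₑ * eLpNorm f 2 μ := eLpNorm_const_smul K f 2 μ
    rw [h, ENNReal.ofReal_mul (abs_nonneg _), ← Real.enorm_eq_ofReal_abs]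
    gcongr
    exact hf.le⟩

lemma of_norm_le {F : Type*} [NormedAddCommGroup F] {g : α → F} {K : ℝ} (hf : L2Bd μ f c)
    (hK : 0 ≤ K) (hg : AEStronglyMeasurable g μ) (hle : ∀ᵐ x ∂μ, ‖g x‖ ≤ K * ‖f x‖) :
    L2Bd μ g (K * c) :=
  (hf.norm.const_mul K |>.mono (by rw [abs_of_nonneg hK])).of_le hg hle

lemma finsetSum {ι : Type*} (s : Finset ι) {f : ι → α → E} {c : ι → ℝ}
    (hf : ∀ i ∈ s, L2Bd μ (f i) (c i)) : L2Bd μ (fun x => ∑ i ∈ s, f i x) (∑ i ∈ s, c i) := by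
  classical
  induction s using Finset.induction_on with
  | empty => exact ⟨by simpa using aestronglyMeasurable_const, by simp, by simp⟩
  | insert i s hi ih =>
    simp only [Finset.sum_insert hi]
    exact (hf i (Finset.mem_insert_self i s)).add
      (ih fun j hj => hf j (Finset.mem_insert_of_mem hj))

lemma congr (hf : L2Bd μ f c) (h : f =ᵐ[μ] g) : L2Bd μ g c :=
  ⟨hf.aesm.congr h, hf.nonneg, by rw [← eLpNorm_congr_ae h]; exact hf.le⟩

lemma of_apply {k : ℕ} {f : α → Fin k → ℝ} (hc : 0 ≤ c) (hf : ∀ i, L2Bd μ (fun x => f x i) c) :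
    L2Bd μ f (k * c) := by
  have hm : AEStronglyMeasurable f μ :=
    (aemeasurable_pi_lambda _ fun i => (hf i).aesm.aemeasurable).aestronglyMeasurable
  refine ⟨hm, by positivity, (eLpNorm_pi_le_sum hm).trans ?_⟩
  calc ∑ i, eLpNorm (fun a => f a i) 2 μ ≤ ∑ _i : Fin k, ENNReal.ofReal c :=
        Finset.sum_le_sum fun i _ => (hf i).le
    _ = ENNReal.ofReal (k * c) := by
        rw [Finset.sum_const, Finset.card_univ, Fintype.card_fin, nsmul_eq_mul,
          ENNReal.ofReal_mul (Nat.cast_nonneg k), ENNReal.ofReal_natCast]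

lemma integral_sq_le (hf : L2Bd μ f c) : ∫ x, ‖f x‖ ^ 2 ∂μ ≤ c ^ 2 := by
  have h := hf.le
  rw [eLpNorm_two_eq_sqrt hf.memLp, ENNReal.ofReal_le_ofReal_iff hf.nonneg] at h
  exact Real.sqrt_le_iff.1 h |>.2

lemma of_integral_sq_le (hf : MemLp f 2 μ) (hc : 0 ≤ c) (h : ∫ x, ‖f x‖ ^ 2 ∂μ ≤ c ^ 2) :
    L2Bd μ f c := by
  refine ⟨hf.1, hc, ?_⟩
  rw [eLpNorm_two_eq_sqrt hf]
  exact ENNReal.ofReal_le_ofReal (Real.sqrt_le_iff.2 ⟨hc, h⟩)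

lemma apply {k : ℕ} {f : α → Fin k → ℝ} (hf : L2Bd μ f c) (i : Fin k) :
    L2Bd μ (fun x => f x i) c :=
  hf.norm.of_le (aemeasurable_pi_iff.1 hf.aesm.aemeasurable i).aestronglyMeasurable
    (Eventually.of_forall fun x => norm_le_pi_norm (f x) i)

lemma const [IsProbabilityMeasure μ] (x : E) : L2Bd μ (fun _ => x) ‖x‖ :=
  ⟨aestronglyMeasurable_const, norm_nonneg _, by
    rw [eLpNorm_const _ two_ne_zero (IsProbabilityMeasure.ne_zero μ)]
    simp [ofReal_norm]⟩

end L2Bd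

/-! ### Square integrability and measurability on the product of time and sample space -/

section Product

variable {Ω : Type*} [MeasurableSpace Ω] {P : Measure Ω} [IsProbabilityMeasure P]
  {E : Type*} [NormedAddCommGroup E] {τ : Measure ℝ} [IsFiniteMeasure τ]

lemma eLpNorm_two_eq_lintegral {α : Type*} [MeasurableSpace α] {μ : Measure α} (f : α → E) :
    eLpNorm f 2 μ = (∫⁻ x, ‖f x‖ₑ ^ 2 ∂μ) ^ (1 / 2 : ℝ) := by
  rw [eLpNorm_eq_lintegral_rpow_enorm_toReal two_ne_zero ENNReal.ofNat_ne_top]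
  simp

lemma lintegral_sq_eq {α : Type*} [MeasurableSpace α] {μ : Measure α} (f : α → E) :
    ∫⁻ x, ‖f x‖ₑ ^ 2 ∂μ = eLpNorm f 2 μ ^ 2 := by
  rw [eLpNorm_two_eq_lintegral, ← ENNReal.rpow_natCast, ← ENNReal.rpow_mul]
  simp

lemma L2Bd.le_of_lintegral {α : Type*} [MeasurableSpace α] {μ : Measure α} {f : α → E} {c : ℝ}
    (hf : AEStronglyMeasurable f μ) (hc : 0 ≤ c)
    (h : ∫⁻ x, ‖f x‖ₑ ^ 2 ∂μ ≤ ENNReal.ofReal c ^ 2) : L2Bd μ f c := by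
  refine ⟨hf, hc, ?_⟩
  rw [lintegral_sq_eq] at h
  exact (ENNReal.pow_le_pow_left_iff two_ne_zero).1 h

lemma L2Bd.lintegral_le {α : Type*} [MeasurableSpace α] {μ : Measure α} {f : α → E} {c : ℝ}
    (hf : L2Bd μ f c) : ∫⁻ x, ‖f x‖ₑ ^ 2 ∂μ ≤ ENNReal.ofReal c ^ 2 := by
  rw [lintegral_sq_eq]
  exact pow_le_pow_left' hf.le 2

lemma L2Bd.prod {f : ℝ → Ω → E} {c : ℝ} (hc : 0 ≤ c)
    (hf : AEStronglyMeasurable (fun p : ℝ × Ω => f p.1 p.2) (τ.prod P))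
    (h : ∀ᵐ t ∂τ, L2Bd P (f t) c) :
    L2Bd (τ.prod P) (fun p : ℝ × Ω => f p.1 p.2) (Real.sqrt (τ.real univ) * c) := by
  refine L2Bd.le_of_lintegral hf (by positivity) ?_
  rw [lintegral_prod _ (hf.enorm.pow_const 2)]
  calc ∫⁻ t, ∫⁻ ω, ‖f t ω‖ₑ ^ 2 ∂P ∂τ ≤ ∫⁻ _t, ENNReal.ofReal c ^ 2 ∂τ :=
        lintegral_mono_ae (h.mono fun t ht => ht.lintegral_le)
    _ = ENNReal.ofReal c ^ 2 * τ univ := by rw [lintegral_const]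
    _ = ENNReal.ofReal (Real.sqrt (τ.real univ) * c) ^ 2 := by
        rw [ENNReal.ofReal_mul (Real.sqrt_nonneg _), mul_pow,
          ← ENNReal.ofReal_pow (Real.sqrt_nonneg _), Real.sq_sqrt measureReal_nonneg,
          ofReal_measureReal, mul_comm]

lemma ae_memLp_section {f : ℝ → Ω → E}
    (hf : MemLp (fun p : ℝ × Ω => f p.1 p.2) 2 (τ.prod P)) :
    ∀ᵐ ω ∂P, MemLp (fun t => f t ω) 2 τ := by
  have h1 : ∫⁻ p : ℝ × Ω, ‖f p.1 p.2‖ₑ ^ 2 ∂(τ.prod P) ≠ ∞ := by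
    rw [lintegral_sq_eq]
    exact ENNReal.pow_ne_top hf.2.ne
  rw [lintegral_prod_symm _ (hf.1.enorm.pow_const 2)] at h1
  have h2 := ae_lt_top' (hf.1.enorm.pow_const 2).lintegral_prod_left' h1
  filter_upwards [h2, hf.1.prod_swap.prodMk_left] with ω h3 h4
  refine ⟨h4, ?_⟩
  rw [eLpNorm_two_eq_lintegral]
  exact ENNReal.rpow_lt_top_of_nonneg (by norm_num) h3.ne

omit [IsFiniteMeasure τ] in
lemma ae_memLp_section_left {f : ℝ → Ω → E}
    (hf : MemLp (fun p : ℝ × Ω => f p.1 p.2) 2 (τ.prod P)) :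
    ∀ᵐ t ∂τ, MemLp (f t) 2 P := by
  have h1 : ∫⁻ p : ℝ × Ω, ‖f p.1 p.2‖ₑ ^ 2 ∂(τ.prod P) ≠ ∞ := by
    rw [lintegral_sq_eq]
    exact ENNReal.pow_ne_top hf.2.ne
  rw [lintegral_prod _ (hf.1.enorm.pow_const 2)] at h1
  have h2 := ae_lt_top' (hf.1.enorm.pow_const 2).lintegral_prod_right' h1
  filter_upwards [h2, hf.1.prodMk_left] with t h3 h4
  refine ⟨h4, ?_⟩
  rw [eLpNorm_two_eq_lintegral]
  exact ENNReal.rpow_lt_top_of_nonneg (by norm_num) h3.ne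

/-- Cauchy–Schwarz in time for almost every path, then Tonelli. -/
lemma L2Bd.integral_norm {f : ℝ → Ω → E} {c : ℝ}
    (hf : L2Bd (τ.prod P) (fun p : ℝ × Ω => f p.1 p.2) c) :
    L2Bd P (fun ω => ∫ t, ‖f t ω‖ ∂τ) (Real.sqrt (τ.real univ) * c) := by
  have hc := hf.nonneg
  refine L2Bd.le_of_lintegral hf.aesm.norm.prod_swap.integral_prod_right' (by positivity) ?_
  have h1 : ∀ᵐ ω ∂P, ‖∫ t, ‖f t ω‖ ∂τ‖ₑ ^ 2 ≤ (∫⁻ t, ‖f t ω‖ₑ ^ 2 ∂τ) * τ univ := by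
    filter_upwards [ae_memLp_section hf.memLp] with ω hω
    have h2 := eLpNorm_le_eLpNorm_mul_rpow_measure_univ (p := 1) (q := 2) (by norm_num) hω.1
    have h3 : ‖∫ t, ‖f t ω‖ ∂τ‖ₑ ≤ eLpNorm (fun t => f t ω) 1 τ := by
      refine (enorm_integral_le_lintegral_enorm _).trans (le_of_eq ?_)
      rw [eLpNorm_one_eq_lintegral_enorm]
      simp
    refine (pow_le_pow_left' (h3.trans h2) 2).trans (le_of_eq ?_)
    rw [mul_pow, lintegral_sq_eq, ← ENNReal.rpow_natCast (_ ^ _) 2, ← ENNReal.rpow_mul]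
    congr 1
    norm_num
  refine (lintegral_mono_ae h1).trans ?_
  have hm : AEMeasurable (fun ω => ∫⁻ t, ‖f t ω‖ₑ ^ 2 ∂τ) P :=
    (hf.aesm.enorm.pow_const 2).lintegral_prod_left'
  rw [lintegral_mul_const'' _ hm, ← lintegral_prod_symm _ (hf.aesm.enorm.pow_const 2),
    ENNReal.ofReal_mul (Real.sqrt_nonneg _), mul_pow, ← ENNReal.ofReal_pow (Real.sqrt_nonneg _),
    Real.sq_sqrt measureReal_nonneg, ofReal_measureReal, mul_comm]
  gcongr
  exact hf.lintegral_le

lemma L2Bd.integral_norm_le {f : ℝ → Ω → E} {c : ℝ} (hc : 0 ≤ c)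
    (hf : AEStronglyMeasurable (fun p : ℝ × Ω => f p.1 p.2) (τ.prod P))
    (h : ∀ᵐ t ∂τ, L2Bd P (f t) c) :
    L2Bd P (fun ω => ∫ t, ‖f t ω‖ ∂τ) (τ.real univ * c) := by
  refine (L2Bd.prod hc hf h).integral_norm.mono (le_of_eq ?_)
  rw [← mul_assoc, Real.mul_self_sqrt measureReal_nonneg]

omit [IsProbabilityMeasure P] [IsFiniteMeasure τ] in
/-- A process with almost surely continuous paths is jointly measurable. -/
lemma aestronglyMeasurable_prod_of_continuousOn {X : ℝ → Ω → E} {T : ℝ} (hT : 0 ≤ T)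
    (hX : ∀ t ∈ Icc 0 T, AEStronglyMeasurable (X t) P)
    (hc : ∀ᵐ ω ∂P, ContinuousOn (fun t => X t ω) (Icc 0 T)) (hτ : ∀ᵐ t ∂τ, t ∈ Icc 0 T) :
    AEStronglyMeasurable (fun p : ℝ × Ω => X p.1 p.2) (τ.prod P) := by
  let pr : ℝ → ℝ := fun t => projIcc 0 T hT t
  have hpr : ∀ t, pr t ∈ Icc 0 T := fun t => (projIcc 0 T hT t).2
  have hprc : Continuous pr := continuous_subtype_val.comp continuous_projIcc
  -- Measurable versions are chosen at rational times only, so that a single null set `N` collects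
  -- all failures, including discontinuity of the path.
  have hgood : ∀ᵐ ω ∂P, ContinuousOn (fun t => X t ω) (Icc 0 T) ∧
      ∀ q : ℚ, X (pr q) ω = (hX (pr q) (hpr q)).mk _ ω :=
    hc.and (ae_all_iff.2 fun q => (hX (pr q) (hpr q)).ae_eq_mk)
  obtain ⟨N, hN, hNm, hN0⟩ := exists_measurable_superset_of_null (ae_iff.1 hgood)
  have hN' : ∀ ω ∉ N, ContinuousOn (fun t => X t ω) (Icc 0 T) ∧
      ∀ q : ℚ, X (pr q) ω = (hX (pr q) (hpr q)).mk _ ω := fun ω hω => by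
    by_contra h
    exact hω (hN h)
  -- Freezing time outside `[0, T]` and setting the process to zero on `N` makes every path
  -- continuous on the whole line; measurability at all times then follows by rational
  -- approximation.
  let Y : ℝ → Ω → E := fun t => Nᶜ.indicator (X (pr t))
  have hYc : ∀ ω, Continuous fun t => Y t ω := by
    intro ω
    by_cases hω : ω ∈ N
    · simpa [Y, hω] using continuous_const
    · simp only [Y, indicator_of_mem (mem_compl hω)]
      exact (hN' ω hω).1.comp_continuous hprc hpr
  have hYq : ∀ q : ℚ, StronglyMeasurable (Y q) := by
    intro q
    have : Y q = Nᶜ.indicator ((hX (pr q) (hpr q)).mk _) := by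
      ext ω
      by_cases hω : ω ∈ N
      · simp [Y, hω]
      · simp only [Y, indicator_of_mem (mem_compl hω)]
        exact (hN' ω hω).2 q
    rw [this]
    exact ((hX (pr q) (hpr q)).stronglyMeasurable_mk).indicator hNm.compl
  have hYm : ∀ t, StronglyMeasurable (Y t) := by
    intro t
    obtain ⟨u, hu, hut⟩ := mem_closure_iff_seq_limit.1 (Rat.denseRange_cast (𝕜 := ℝ) t)
    choose q hq using hu
    refine stronglyMeasurable_of_tendsto atTop (fun k => hYq (q k)) ?_
    refine tendsto_pi_nhds.2 fun ω => ?_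
    simp only [hq]
    exact ((hYc ω).tendsto t).comp hut
  have hY := stronglyMeasurable_uncurry_of_continuous_of_stronglyMeasurable hYc hYm
  refine ⟨_, hY, ?_⟩
  have h1 : ∀ᵐ p ∂(τ.prod P), p.1 ∈ Icc 0 T := Measure.quasiMeasurePreserving_fst.ae hτ
  have h2 : ∀ᵐ p ∂(τ.prod P), p.2 ∉ N := Measure.quasiMeasurePreserving_snd.ae
    (measure_eq_zero_iff_ae_notMem.1 hN0)
  filter_upwards [h1, h2] with p hp1 hp2
  simp only [Function.uncurry, Y, indicator_of_mem (mem_compl hp2), pr, projIcc_of_mem hT hp1]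

end Product

/-! ### Conditioning and independence -/

section Conditioning

variable {Ω : Type*} {m m₁ m₂ 𝓕 H : MeasurableSpace Ω} [mΩ : MeasurableSpace Ω] {P : Measure Ω}
  [IsProbabilityMeasure P]

lemma integral_mul_eq_zero_of_condExp_eq_zero (hm : m ≤ mΩ) {g w : Ω → ℝ} (hg : MemLp g 2 P)
    (hw : MemLp w 2 P) (hwm : AEStronglyMeasurable[m] w P) (h : P[g|m] =ᵐ[P] 0) :
    ∫ ω, g ω * w ω ∂P = 0 := by
  have hi : Integrable (g * w) P := hg.integrable_mul hw
  have h1 := condExp_mul_of_aestronglyMeasurable_right hwm hi (hg.integrable (by norm_num))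
  calc ∫ ω, g ω * w ω ∂P = ∫ ω, P[g * w|m] ω ∂P := (integral_condExp hm).symm
    _ = ∫ _ω, (0 : ℝ) ∂P := by
        refine integral_congr_ae ?_
        filter_upwards [h1, h] with ω h2 h3
        rw [h2, Pi.mul_apply, h3]
        simp
    _ = 0 := by simp

/-- A time integral of random variables that are measurable with respect to `m` modulo null sets
is so as well. -/
lemma aestronglyMeasurable_integral_of_sub {τ : Measure ℝ} [IsFiniteMeasure τ] (hm : m ≤ mΩ)
    {f : ℝ → Ω → ℝ} (hf : MemLp (fun p : ℝ × Ω => f p.1 p.2) 2 (τ.prod P))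
    (hfm : ∀ᵐ t ∂τ, AEStronglyMeasurable[m] (f t) P) :
    AEStronglyMeasurable[m] (fun ω => ∫ t, f t ω ∂τ) P := by
  set X : Ω → ℝ := fun ω => ∫ t, f t ω ∂τ with hX
  have hX2 : MemLp X 2 P :=
    ((L2Bd.of_memLp hf).integral_norm.of_le hf.1.prod_swap.integral_prod_right'
      (Eventually.of_forall fun ω => norm_integral_le_integral_norm _)).memLp
  -- `Y` is orthogonal to every square-integrable `m`-measurable variable: to `P[X|m]` directly, and
  -- to `X` by Fubini, since it is orthogonal to almost every `f t`. Hence `E[Y²] = 0`. This avoids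
  -- choosing the `m`-measurable versions of `f t` jointly measurably in `t`.
  set Y : Ω → ℝ := X - P[X|m] with hY
  have hZ2 : MemLp P[X|m] 2 P := hX2.condExp (by norm_num)
  have hY2 : MemLp Y 2 P := hX2.sub hZ2
  have hY0 : P[Y|m] =ᵐ[P] 0 := by
    have h1 := condExp_sub (hX2.integrable (by norm_num)) (integrable_condExp (m := m) (f := X)
      (μ := P)) m
    have h2 := condExp_of_stronglyMeasurable hm (stronglyMeasurable_condExp (f := X) (μ := P)
      (m := m)) integrable_condExp
    filter_upwards [h1] with ω h3
    rw [hY, h3, h2]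
    simp
  have e1 : ∫ ω, Y ω * X ω ∂P = 0 := by
    have hint : Integrable (fun p : ℝ × Ω => Y p.2 * f p.1 p.2) (τ.prod P) :=
      MemLp.integrable_mul (p := 2) (q := 2) (hY2.comp_snd τ) hf
    calc ∫ ω, Y ω * X ω ∂P = ∫ ω, ∫ t, Y ω * f t ω ∂τ ∂P := by
          simp only [hX, integral_const_mul]
      _ = ∫ p, Y p.2 * f p.1 p.2 ∂(τ.prod P) := (integral_prod_symm _ hint).symm
      _ = ∫ t, ∫ ω, Y ω * f t ω ∂P ∂τ := integral_prod _ hint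
      _ = ∫ _t, (0 : ℝ) ∂τ := by
          refine integral_congr_ae ?_
          filter_upwards [hfm, ae_memLp_section_left hf] with t h1 h2
          exact integral_mul_eq_zero_of_condExp_eq_zero hm hY2 h2 h1 hY0
      _ = 0 := by simp
  have e2 : ∫ ω, Y ω * P[X|m] ω ∂P = 0 :=
    integral_mul_eq_zero_of_condExp_eq_zero hm hY2 hZ2
      stronglyMeasurable_condExp.aestronglyMeasurable hY0
  have e3 : ∫ ω, Y ω ^ 2 ∂P = 0 := by
    have : ∀ ω, Y ω ^ 2 = Y ω * X ω - Y ω * P[X|m] ω := fun ω => by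
      simp only [hY, Pi.sub_apply]; ring
    simp only [this]
    have h1 : Integrable (fun ω => Y ω * X ω) P := hY2.integrable_mul hX2
    have h2 : Integrable (fun ω => Y ω * P[X|m] ω) P := hY2.integrable_mul hZ2
    rw [integral_sub h1 h2, e1, e2, sub_zero]
  have e4 := (integral_eq_zero_iff_of_nonneg (fun ω => sq_nonneg (Y ω)) hY2.integrable_sq).1 e3
  refine ⟨P[X|m], stronglyMeasurable_condExp, ?_⟩
  filter_upwards [e4] with ω hω
  have : Y ω = 0 := by simpa using hω
  simpa [hY, sub_eq_zero] using this

omit [IsProbabilityMeasure P] in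
/-- The measurable sets on which the integral of `g` vanishes form a Dynkin system. -/
lemma setIntegral_eq_zero_of_generateFrom (hH : H ≤ mΩ) {C : Set (Set Ω)}
    (hC : H = MeasurableSpace.generateFrom C) (hpi : IsPiSystem C) {g : Ω → ℝ}
    (hg : Integrable g P) (huniv : ∫ ω, g ω ∂P = 0) (h : ∀ F ∈ C, ∫ ω in F, g ω ∂P = 0) :
    ∀ F, MeasurableSet[H] F → ∫ ω in F, g ω ∂P = 0 := by
  intro F hF
  induction F, hF using MeasurableSpace.induction_on_inter hC hpi with
  | empty => simp
  | basic F hF => exact h F hF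
  | compl F hF ih =>
    have := integral_add_compl (hH F hF) hg
    rw [ih, zero_add, huniv] at this
    exact this
  | iUnion f hd hf ih =>
    rw [integral_iUnion (fun i => hH _ (hf i)) hd hg.integrableOn]
    simp [ih]

omit [IsProbabilityMeasure P] in
-- On an intersection `F₁ ∩ F₂` with `F₁` in `𝓕` and `F₂` in `m₂`, independence factors the integral
-- of `g` as the integral over `F₁`, which is zero, times `P(F₂)`. These intersections form a
-- π-system generating `𝓕 ⊔ m₂`. Here `g` may be measurable for a larger σ-algebra `m₁` than the one
-- it is tested on, as a gradient that depends on the player's future requires.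
lemma setIntegral_eq_zero_of_indep (h₁ : m₁ ≤ mΩ) (h₂ : m₂ ≤ mΩ)
    (hind : Indep m₁ m₂ P) (h𝓕 : 𝓕 ≤ m₁) (hH : H ≤ 𝓕 ⊔ m₂) {g : Ω → ℝ} (hg : Integrable g P)
    (hgm : AEStronglyMeasurable[m₁] g P)
    (h : ∀ F, MeasurableSet[𝓕] F → ∫ ω in F, g ω ∂P = 0) :
    ∀ F, MeasurableSet[H] F → ∫ ω in F, g ω ∂P = 0 := by
  set C : Set (Set Ω) := {F | ∃ F₁ F₂, MeasurableSet[𝓕] F₁ ∧ MeasurableSet[m₂] F₂ ∧ F = F₁ ∩ F₂}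
    with hCdef
  have hC : 𝓕 ⊔ m₂ = MeasurableSpace.generateFrom C := by
    refine le_antisymm (sup_le (fun F hF => ?_) fun F hF => ?_)
      (MeasurableSpace.generateFrom_le ?_)
    · exact MeasurableSpace.measurableSet_generateFrom
        ⟨F, univ, hF, @MeasurableSet.univ _ m₂, (inter_univ F).symm⟩
    · exact MeasurableSpace.measurableSet_generateFrom
        ⟨univ, F, @MeasurableSet.univ _ 𝓕, hF, (univ_inter F).symm⟩
    · rintro _ ⟨F₁, F₂, hF₁, hF₂, rfl⟩
      exact @MeasurableSet.inter _ (𝓕 ⊔ m₂) _ _ (le_sup_left (a := 𝓕) _ hF₁)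
        (le_sup_right (a := 𝓕) _ hF₂)
  have hpi : IsPiSystem C := by
    rintro _ ⟨F₁, F₂, hF₁, hF₂, rfl⟩ _ ⟨E₁, E₂, hE₁, hE₂, rfl⟩ -
    exact ⟨F₁ ∩ E₁, F₂ ∩ E₂, @MeasurableSet.inter _ 𝓕 _ _ hF₁ hE₁,
      @MeasurableSet.inter _ m₂ _ _ hF₂ hE₂, inter_inter_inter_comm _ _ _ _⟩
  have key : ∀ F ∈ C, ∫ ω in F, g ω ∂P = 0 := by
    rintro _ ⟨F₁, F₂, hF₁, hF₂, rfl⟩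
    have hF₁' := h𝓕 _ hF₁
    obtain ⟨g', hg', hgg'⟩ := hgm
    have hi : IndepFun (F₁.indicator g') (F₂.indicator fun _ => (1 : ℝ)) P := by
      refine indep_of_indep_of_le_left (indep_of_indep_of_le_right hind ?_) ?_
      · exact Measurable.comap_le (measurable_const.indicator hF₂)
      · exact Measurable.comap_le (hg'.measurable.indicator hF₁')
    have h3 := hi.integral_mul_eq_mul_integral
      ((hg'.indicator hF₁').mono h₁).aestronglyMeasurable
      ((stronglyMeasurable_const.indicator hF₂).mono h₂).aestronglyMeasurable
    have e1 : ∫ ω, F₁.indicator g' ω ∂P = 0 := by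
      rw [integral_indicator (h₁ _ hF₁'), ← h F₁ hF₁]
      exact setIntegral_congr_ae (h₁ _ hF₁') (hgg'.mono fun ω hω _ => hω.symm)
    rw [e1, zero_mul] at h3
    rw [← h3, ← integral_indicator ((h₁ _ hF₁').inter (h₂ _ hF₂))]
    refine integral_congr_ae ?_
    filter_upwards [hgg'] with ω hω
    by_cases a1 : ω ∈ F₁ <;> by_cases a2 : ω ∈ F₂ <;> simp [a1, a2, hω]
  have huniv : ∫ ω, g ω ∂P = 0 := by
    rw [← setIntegral_univ]
    exact h univ (@MeasurableSet.univ _ 𝓕)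
  intro F hF
  exact setIntegral_eq_zero_of_generateFrom (sup_le (h𝓕.trans h₁) h₂) hC hpi hg huniv key F
    (hH F hF)

lemma integral_mul_eq_zero_of_setIntegral (hH : H ≤ mΩ) {g w : Ω → ℝ}
    (hg : MemLp g 2 P) (hw : MemLp w 2 P) (hwm : AEStronglyMeasurable[H] w P)
    (h : ∀ F, MeasurableSet[H] F → ∫ ω in F, g ω ∂P = 0) : ∫ ω, g ω * w ω ∂P = 0 := by
  refine integral_mul_eq_zero_of_condExp_eq_zero hH hg hw hwm ?_
  refine (ae_eq_condExp_of_forall_setIntegral_eq hH (hg.integrable (by norm_num)) (g := 0)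
    (fun _ _ _ => integrableOn_zero) (fun F hF _ => ?_) ?_).symm
  · rw [h F hF]; simp
  · exact stronglyMeasurable_zero.aestronglyMeasurable

end Conditioning

/-! ### Independence of the players and countable generation of their information -/

section Information

variable {n N : ℕ} {Ω : Type*} [mΩ : MeasurableSpace Ω] {P : Measure Ω}

lemma comap_comp_le {α β γ : Type*} [MeasurableSpace β] [MeasurableSpace γ] {h : β → γ}
    (hh : Measurable h) (g : α → β) :
    MeasurableSpace.comap (fun a => h (g a)) inferInstance
      ≤ MeasurableSpace.comap g inferInstance := by
  rintro _ ⟨F, hF, rfl⟩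
  exact ⟨h ⁻¹' F, hh hF, rfl⟩

lemma comap_prodMk_pi_le {α β γ ι : Type*} [MeasurableSpace β] [MeasurableSpace γ]
    {m : MeasurableSpace α} {f : α → β} {g : ι → α → γ} (hf : Measurable f)
    (hg : ∀ i, Measurable (g i)) :
    MeasurableSpace.comap (fun a => (f a, fun i => g i a)) inferInstance ≤ m :=
  (hf.prodMk (measurable_pi_lambda _ hg)).comap_le

omit mΩ in
lemma comap_path_eq_iSup (W : ℝ≥0 → Ω → Fin n → ℝ) :
    MeasurableSpace.comap (fun ω (t : ℝ≥0) => W t ω) inferInstance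
      = ⨆ t, MeasurableSpace.comap (W t) inferInstance := by
  simp only [MeasurableSpace.pi, MeasurableSpace.comap_iSup, MeasurableSpace.comap_comp]
  rfl

omit mΩ in
lemma playerInfo_le_sup (x₀ : Ω → Fin n → ℝ) (W : ℝ≥0 → Ω → Fin n → ℝ) (t : ℝ) :
    playerInfo x₀ W t ≤ MeasurableSpace.comap x₀ inferInstance ⊔
      MeasurableSpace.comap (fun ω (t : ℝ≥0) => W t ω) inferInstance := by
  rw [comap_path_eq_iSup]
  exact sup_le_sup le_rfl (iSup_mono fun s => iSup_le fun _ => le_rfl)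

omit mΩ in
lemma playerInfo_mono (x₀ : Ω → Fin n → ℝ) (W : ℝ≥0 → Ω → Fin n → ℝ) {s t : ℝ} (h : s ≤ t) :
    playerInfo x₀ W s ≤ playerInfo x₀ W t :=
  sup_le_sup le_rfl (iSup_mono fun _ => iSup_le fun hr => le_iSup_of_le (hr.trans h) le_rfl)

lemma playerInfo_le {x₀ : Ω → Fin n → ℝ} {W : ℝ≥0 → Ω → Fin n → ℝ} (hx : Measurable x₀)
    (hW : ∀ t, Measurable (W t)) (t : ℝ) : playerInfo x₀ W t ≤ mΩ :=
  sup_le hx.comap_le (iSup_le fun s => iSup_le fun _ => (hW s).comap_le)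

/-- The three separate independence assumptions combine into joint independence of all `2N`
σ-algebras, which allows grouping them by player. -/
lemma iIndep_init_path {ν : Measure (Fin n → ℝ)} {x₀ : Fin N → Ω → Fin n → ℝ}
    {W : Fin N → ℝ≥0 → Ω → Fin n → ℝ} (h : IsRandomData P ν x₀ W) :
    iIndep (Sum.elim (fun j => MeasurableSpace.comap (x₀ j) inferInstance)
      fun j => MeasurableSpace.comap (fun ω (t : ℝ≥0) => W j t ω) inferInstance) P := by
  rw [iIndep_iff]
  intro s f hf
  have e : ⋂ i ∈ s, f i = (⋂ j ∈ s.toLeft, f (Sum.inl j)) ∩ ⋂ j ∈ s.toRight, f (Sum.inr j) := by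
    ext ω
    simp only [mem_iInter, mem_inter_iff, Finset.mem_toLeft, Finset.mem_toRight, Sum.forall]
  have hl : ∀ j ∈ s.toLeft, MeasurableSet[MeasurableSpace.comap (x₀ j) inferInstance]
      (f (Sum.inl j)) := fun j hj => hf _ (Finset.mem_toLeft.1 hj)
  have hr : ∀ j ∈ s.toRight, MeasurableSet[MeasurableSpace.comap
      (fun ω (t : ℝ≥0) => W j t ω) inferInstance] (f (Sum.inr j)) :=
    fun j hj => hf _ (Finset.mem_toRight.1 hj)
  have h1 := (iIndep_iff _ P).1 h.indep_init s.toLeft (f := fun j => f (Sum.inl j)) hl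
  have h2 := (iIndep_iff _ P).1 h.indep_wiener s.toRight (f := fun j => f (Sum.inr j)) hr
  have h3 : P ((⋂ j ∈ s.toLeft, f (Sum.inl j)) ∩ ⋂ j ∈ s.toRight, f (Sum.inr j))
      = P (⋂ j ∈ s.toLeft, f (Sum.inl j)) * P (⋂ j ∈ s.toRight, f (Sum.inr j)) := by
    refine (Indep_iff _ _ _).1 h.indep_init_wiener _ _ ?_ ?_
    · refine Finset.measurableSet_biInter _ fun j hj => ?_
      have hle : MeasurableSpace.comap (x₀ j) inferInstance
          ≤ MeasurableSpace.comap (fun ω i => x₀ i ω) inferInstance :=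
        comap_comp_le (measurable_pi_apply j) fun ω i => x₀ i ω
      exact hle _ (hl j hj)
    · refine Finset.measurableSet_biInter _ fun j hj => ?_
      have hle : MeasurableSpace.comap (fun ω (t : ℝ≥0) => W j t ω) inferInstance
          ≤ MeasurableSpace.comap (fun ω i (t : ℝ≥0) => W i t ω) inferInstance :=
        comap_comp_le (measurable_pi_apply j) fun ω i (t : ℝ≥0) => W i t ω
      exact hle _ (hr j hj)
  rw [e, h3, h1, h2, Finset.prod_sum_eq_prod_toLeft_mul_prod_toRight]

lemma indep_playerInfo_iSup {ν : Measure (Fin n → ℝ)} {x₀ : Fin N → Ω → Fin n → ℝ}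
    {W : Fin N → ℝ≥0 → Ω → Fin n → ℝ} (h : IsRandomData P ν x₀ W) (i : Fin N) (t : ℝ) :
    Indep (playerInfo (x₀ i) (W i) t) (⨆ j, ⨆ _ : j ≠ i, playerInfo (x₀ j) (W j) t) P := by
  have hle : ∀ k : Fin N ⊕ Fin N, Sum.elim
      (fun j => MeasurableSpace.comap (x₀ j) inferInstance)
      (fun j => MeasurableSpace.comap (fun ω (t : ℝ≥0) => W j t ω) inferInstance) k ≤ mΩ := by
    rintro (j | j)
    · exact (h.measurable_init j).comap_le
    · exact (measurable_pi_lambda _ fun t => (h.wiener j).measurable t).comap_le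
  have hd : Disjoint {Sum.inl i, Sum.inr i} {k : Fin N ⊕ Fin N | k ≠ Sum.inl i ∧ k ≠ Sum.inr i} := by
    rw [Set.disjoint_left]
    rintro k (rfl | rfl) ⟨h1, h2⟩
    · exact h1 rfl
    · exact h2 rfl
  refine indep_of_indep_of_le_left (indep_of_indep_of_le_right
    (indep_iSup_of_disjoint hle (iIndep_init_path h) hd) ?_) ?_
  · refine iSup_le fun j => iSup_le fun hj => (playerInfo_le_sup _ _ t).trans (sup_le ?_ ?_)
    · exact le_iSup₂_of_le (Sum.inl j) (by simp [hj]) le_rfl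
    · exact le_iSup₂_of_le (Sum.inr j) (by simp [hj]) le_rfl
  · refine (playerInfo_le_sup _ _ t).trans (sup_le ?_ ?_)
    · exact le_iSup₂_of_le (Sum.inl i) (by simp) le_rfl
    · exact le_iSup₂_of_le (Sum.inr i) (by simp) le_rfl

omit mΩ in
-- The other players' information may be enlarged to the later time `t`, since only its independence
-- from player `i` matters; the information of player `i` must stay at time `s`.
lemma gameInfo_le_sup (x₀ : Fin N → Ω → Fin n → ℝ) (W : Fin N → ℝ≥0 → Ω → Fin n → ℝ) (i : Fin N)
    {s t : ℝ} (hst : s ≤ t) :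
    gameInfo x₀ W s ≤ playerInfo (x₀ i) (W i) s ⊔
      ⨆ j, ⨆ _ : j ≠ i, playerInfo (x₀ j) (W j) t := by
  refine iSup_le fun j => ?_
  by_cases hj : j = i
  · subst hj; exact le_sup_left
  · exact le_sup_of_le_right (le_iSup₂_of_le j hj (playerInfo_mono _ _ hst))

/-- The information carried by the initial state and the values of the path at the rational times
up to `q`. -/
abbrev rationalInfo (x₀ : Ω → Fin n → ℝ) (W : ℝ≥0 → Ω → Fin n → ℝ) (q : ℚ≥0) :
    MeasurableSpace Ω :=
  MeasurableSpace.comap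
    (fun ω => (x₀ ω, fun p : {p : ℚ≥0 // p ≤ q} => W ((p : ℚ≥0) : ℝ≥0) ω)) inferInstance

omit mΩ in
-- Countability is the point: the exceptional set of times depends on the information set tested,
-- and only countably many null sets can be discarded.
lemma exists_countable_isPiSystem_rationalInfo (x₀ : Ω → Fin n → ℝ) (W : ℝ≥0 → Ω → Fin n → ℝ)
    (q : ℚ≥0) : ∃ C : Set (Set Ω), C.Countable ∧ IsPiSystem C ∧
      rationalInfo x₀ W q = MeasurableSpace.generateFrom C := by
  have hcg : @MeasurableSpace.CountablyGenerated Ω (rationalInfo x₀ W q) :=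
    MeasurableSpace.CountablyGenerated.comap _
  obtain ⟨b, hb, hbe⟩ := hcg.isCountablyGenerated
  refine ⟨generateSetAlgebra b, countable_generateSetAlgebra hb, ?_, ?_⟩
  · intro s hs t ht _
    exact isSetAlgebra_generateSetAlgebra.inter_mem hs ht
  · rw [generateFrom_generateSetAlgebra_eq, hbe]

omit mΩ in
lemma rationalInfo_mono (x₀ : Ω → Fin n → ℝ) (W : ℝ≥0 → Ω → Fin n → ℝ) {p q : ℚ≥0} (h : p ≤ q) :
    rationalInfo x₀ W p ≤ rationalInfo x₀ W q := by
  have h1 : Measurable fun x : (Fin n → ℝ) × ({r : ℚ≥0 // r ≤ q} → Fin n → ℝ) =>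
      (x.1, fun r : {r : ℚ≥0 // r ≤ p} => x.2 ⟨r.1, r.2.trans h⟩) :=
    measurable_fst.prodMk (measurable_pi_lambda _ fun r =>
      (measurable_pi_apply _).comp measurable_snd)
  exact comap_comp_le h1
    fun ω => (x₀ ω, fun p : {p : ℚ≥0 // p ≤ q} => W ((p : ℚ≥0) : ℝ≥0) ω)

omit mΩ in
lemma rationalInfo_le (x₀ : Ω → Fin n → ℝ) (W : ℝ≥0 → Ω → Fin n → ℝ) (q : ℚ≥0) :
    rationalInfo x₀ W q ≤ playerInfo x₀ W ((q : ℝ≥0) : ℝ) := by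
  refine comap_prodMk_pi_le (measurable_iff_comap_le.2 le_sup_left) fun r => ?_
  refine measurable_iff_comap_le.2 (le_sup_of_le_right ?_)
  refine le_iSup₂_of_le (((r : ℚ≥0) : ℝ≥0)) ?_ le_rfl
  exact_mod_cast r.2

/-- The approximating times lie strictly before `s` even when `r = s`, which is possible because `s`
is positive. -/
lemma exists_nnrat_seq {s : ℝ} (hs : 0 < s) {r : ℝ≥0} (hr : (r : ℝ) ≤ s) :
    ∃ q : ℕ → ℚ≥0, (∀ k, (((q k : ℚ≥0) : ℝ≥0) : ℝ) < s) ∧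
      Tendsto (fun k => ((q k : ℚ≥0) : ℝ≥0)) atTop (𝓝 r) := by
  have h : ∀ k : ℕ, ∃ q : ℚ≥0, ((q : ℝ≥0) : ℝ) < s ∧ |((q : ℝ≥0) : ℝ) - r| < 1 / (k + 1) := by
    intro k
    have hk : (0 : ℝ) < 1 / (k + 1) := by positivity
    have h1 : max 0 (r - 1 / (k + 1) : ℝ) < min s (r + 1 / (k + 1)) := by
      simp only [max_lt_iff, lt_min_iff]
      refine ⟨⟨hs, by have := r.2; linarith⟩, by linarith, by linarith⟩
    obtain ⟨q, hq1, hq2⟩ := exists_rat_btwn h1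
    have hq0 : 0 ≤ q := by exact_mod_cast (le_max_left _ _).trans hq1.le
    lift q to ℚ≥0 using hq0
    have e : ((q : ℝ≥0) : ℝ) = ((q : ℚ) : ℝ) := by norm_cast
    refine ⟨q, ?_, ?_⟩
    · rw [e]; exact hq2.trans_le (min_le_left _ _)
    · rw [e, abs_lt]
      have a1 := (le_max_right _ _).trans_lt hq1
      have a2 := hq2.trans_le (min_le_right _ _)
      constructor <;> linarith
  choose q hq1 hq2 using h
  refine ⟨q, hq1, ?_⟩
  rw [← NNReal.tendsto_coe, tendsto_iff_norm_sub_tendsto_zero]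
  exact squeeze_zero (fun _ => norm_nonneg _) (fun k => (hq2 k).le)
    tendsto_one_div_add_atTop_nhds_zero_nat

/-- Up to null sets, the information of a player at time `s > 0` is generated by the information
at rational times before `s`. -/
lemma playerInfo_le_eventuallyMeasurableSpace {x₀ : Ω → Fin n → ℝ} {W : ℝ≥0 → Ω → Fin n → ℝ}
    (hW : ∀ᵐ ω ∂P, Continuous fun t => W t ω) {s : ℝ} (hs : 0 < s) :
    playerInfo x₀ W s ≤ eventuallyMeasurableSpace
      (⨆ q : {q : ℚ≥0 // ((q : ℝ≥0) : ℝ) < s}, rationalInfo x₀ W q) (ae P) := by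
  set H := ⨆ q : {q : ℚ≥0 // ((q : ℝ≥0) : ℝ) < s}, rationalInfo x₀ W q with hH
  have hx : Measurable[H] x₀ := by
    have h1 : Measurable[rationalInfo x₀ W 0] x₀ := measurable_iff_comap_le.2
      (comap_comp_le measurable_fst
        fun ω => (x₀ ω, fun p : {p : ℚ≥0 // p ≤ 0} => W ((p : ℚ≥0) : ℝ≥0) ω))
    exact h1.mono (le_iSup_of_le (⟨0, by simpa using hs⟩ : {q : ℚ≥0 // ((q : ℝ≥0) : ℝ) < s})
      le_rfl) le_rfl
  have hWq : ∀ q : ℚ≥0, ((q : ℝ≥0) : ℝ) < s → Measurable[H] (W (q : ℝ≥0)) := by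
    intro q hq
    have h1 : Measurable[rationalInfo x₀ W q] (W (q : ℝ≥0)) := measurable_iff_comap_le.2
      (comap_comp_le
        ((measurable_pi_apply (⟨q, le_rfl⟩ : {p : ℚ≥0 // p ≤ q})).comp measurable_snd)
        fun ω => (x₀ ω, fun p : {p : ℚ≥0 // p ≤ q} => W ((p : ℚ≥0) : ℝ≥0) ω))
    exact h1.mono (le_iSup_of_le (⟨q, hq⟩ : {q : ℚ≥0 // ((q : ℝ≥0) : ℝ) < s}) le_rfl) le_rfl
  refine sup_le ?_ (iSup_le fun r => iSup_le fun hr => ?_)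
  · exact hx.comap_le.trans le_eventuallyMeasurableSpace
  -- Path continuity makes `W r` an almost sure limit of values at rational times before `s`.
  -- Replacing it by its measurable version changes preimages only by null sets.
  · obtain ⟨q, hq1, hq2⟩ := exists_nnrat_seq hs hr
    have h1 : AEStronglyMeasurable[H] (W r) P :=
      @aestronglyMeasurable_of_tendsto n Ω H mΩ P _ _ (fun k => hWq (q k) (hq1 k))
        (hW.mono fun ω hω => (hω.tendsto r).comp hq2)
    obtain ⟨g, hg, hgW⟩ := h1
    rintro _ ⟨F, hF, rfl⟩
    refine ⟨g ⁻¹' F, hg.measurable hF, ?_⟩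
    filter_upwards [hgW] with ω hω
    simp only [eq_iff_iff]
    change W r ω ∈ F ↔ g ω ∈ F
    rw [hω]

/-- If, for each information set `F` available at time `r`, the integral of `g s` over `F`
vanishes for almost every later time `s`, then for almost every time `s` the integral of `g s`
vanishes over all sets in the information at time `s`. -/
lemma ae_setIntegral_eq_zero_of_forall {x₀ : Ω → Fin n → ℝ} {W : ℝ≥0 → Ω → Fin n → ℝ}
    (hx : Measurable x₀) (hWm : ∀ t, Measurable (W t))
    (hW : ∀ᵐ ω ∂P, Continuous fun t => W t ω) {T : ℝ} {g : ℝ → Ω → ℝ}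
    (hg : ∀ᵐ s ∂(volume.restrict (Icc 0 T)), Integrable (g s) P)
    (h : ∀ r : ℝ, 0 ≤ r → ∀ F, MeasurableSet[playerInfo x₀ W r] F →
      ∀ᵐ s ∂(volume.restrict (Icc 0 T)), r ≤ s → ∫ ω in F, g s ω ∂P = 0) :
    ∀ᵐ s ∂(volume.restrict (Icc 0 T)),
      ∀ F, MeasurableSet[playerInfo x₀ W s] F → ∫ ω in F, g s ω ∂P = 0 := by
  choose C hCc hCpi hC using exists_countable_isPiSystem_rationalInfo x₀ W
  -- One null set of times serves all rational `q` and all sets of the countable π-systems `C q`.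
  have h1 : ∀ᵐ s ∂(volume.restrict (Icc 0 T)), ∀ q : ℚ≥0, ((q : ℝ≥0) : ℝ) ≤ s →
      ∫ ω, g s ω ∂P = 0 ∧ ∀ F ∈ C q, ∫ ω in F, g s ω ∂P = 0 := by
    refine ae_all_iff.2 fun q => ?_
    have h2 := h (q : ℝ≥0) (NNReal.coe_nonneg _) univ (@MeasurableSet.univ _ (playerInfo x₀ W _))
    have h3 : ∀ᵐ s ∂(volume.restrict (Icc 0 T)), ∀ F ∈ C q, ((q : ℝ≥0) : ℝ) ≤ s →
        ∫ ω in F, g s ω ∂P = 0 := by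
      refine (ae_ball_iff (hCc q)).2 fun F hF => h (q : ℝ≥0) (NNReal.coe_nonneg _) F ?_
      refine rationalInfo_le x₀ W q _ ?_
      rw [hC q]
      exact MeasurableSpace.measurableSet_generateFrom hF
    filter_upwards [h2, h3] with s h4 h5 hqs
    refine ⟨?_, fun F hF => h5 F hF hqs⟩
    rw [← setIntegral_univ]
    exact h4 hqs
  -- Time `0` has no rational time strictly before it; it is discarded as a null set.
  have hpos : ∀ᵐ s ∂(volume.restrict (Icc 0 T)), 0 < s := by
    have h2 : ∀ᵐ s : ℝ ∂(volume.restrict (Icc 0 T)), s ≠ 0 := Measure.ae_ne _ 0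
    filter_upwards [h2, ae_restrict_mem measurableSet_Icc] with s h3 h4
    exact lt_of_le_of_ne h4.1 (Ne.symm h3)
  filter_upwards [hg, h1, hpos] with s hgs hs hs0
  have hle : ∀ q, rationalInfo x₀ W q ≤ mΩ := fun q =>
    (rationalInfo_le x₀ W q).trans (playerInfo_le hx hWm _)
  have h2 : ∀ q : ℚ≥0, ((q : ℝ≥0) : ℝ) < s → ∀ F, MeasurableSet[rationalInfo x₀ W q] F →
      ∫ ω in F, g s ω ∂P = 0 := fun q hq =>
    setIntegral_eq_zero_of_generateFrom (hle q) (hC q) (hCpi q) hgs (hs q hq.le).1 (hs q hq.le).2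
  have huniv : ∫ ω, g s ω ∂P = 0 := (hs 0 (by simpa using hs0.le)).1
  have h3 : ∀ F, MeasurableSet[⨆ q : {q : ℚ≥0 // ((q : ℝ≥0) : ℝ) < s}, rationalInfo x₀ W q] F →
      ∫ ω in F, g s ω ∂P = 0 := by
    refine setIntegral_eq_zero_of_generateFrom
      (H := ⨆ q : {q : ℚ≥0 // ((q : ℝ≥0) : ℝ) < s}, rationalInfo x₀ W q) (iSup_le fun q => hle q)
      (MeasurableSpace.measurableSpace_iSup_eq
        fun q : {q : ℚ≥0 // ((q : ℝ≥0) : ℝ) < s} => rationalInfo x₀ W q) ?_ hgs huniv ?_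
    -- The σ-algebras increase with `q`, so two sets always lie in a common one and the union is a
    -- π-system.
    · rintro A ⟨p, hp⟩ B ⟨q, hq⟩ -
      rcases le_total p q with hpq | hpq
      · exact ⟨q, @MeasurableSet.inter _ (rationalInfo x₀ W q) _ _
          (rationalInfo_mono x₀ W hpq _ hp) hq⟩
      · exact ⟨p, @MeasurableSet.inter _ (rationalInfo x₀ W p) _ _ hp
          (rationalInfo_mono x₀ W hpq _ hq)⟩
    · rintro F ⟨q, hq⟩
      exact h2 q q.2 F hq
  intro F hF
  obtain ⟨F', hF', hFF'⟩ := playerInfo_le_eventuallyMeasurableSpace hW hs0 F hF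
  rw [setIntegral_congr_set hFF']
  exact h3 F' hF'

end Information

/-! ### Processes on a time horizon -/

/-- Lebesgue measure on `[0, T]`. -/
abbrev horizon (T : ℝ) : Measure ℝ := volume.restrict (Icc 0 T)

/-- Lebesgue measure on `[0, T]` with an additional unit mass at the terminal time. -/
abbrev horizonEnd (T : ℝ) : Measure ℝ := horizon T + Measure.dirac T

lemma ae_horizon_mem (T : ℝ) : ∀ᵐ t ∂(horizon T), t ∈ Icc 0 T :=
  ae_restrict_mem measurableSet_Icc

lemma ae_horizonEnd_mem {T : ℝ} (hT : 0 ≤ T) : ∀ᵐ t ∂(horizonEnd T), t ∈ Icc 0 T := by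
  rw [ae_add_measure_iff]
  refine ⟨ae_horizon_mem T, ?_⟩
  exact (ae_dirac_iff (p := fun t => t ∈ Icc 0 T) measurableSet_Icc).2 (right_mem_Icc.2 hT)

lemma aemeasurable_horizonEnd {T : ℝ} {f : ℝ → ℝ} (hf : AEMeasurable f (horizon T)) :
    AEMeasurable f (horizonEnd T) :=
  hf.add_measure aemeasurable_dirac

lemma intervalIntegral_eq_indicator {E : Type*} [NormedAddCommGroup E] [NormedSpace ℝ E] {T t : ℝ}
    (ht : t ∈ Icc 0 T) (f : ℝ → E) :
    ∫ s in (0 : ℝ)..t, f s = ∫ s, (Iic t).indicator f s ∂(horizon T) := by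
  rw [integral_indicator measurableSet_Iic, Measure.restrict_restrict measurableSet_Iic,
    intervalIntegral.integral_of_le ht.1, ← integral_Icc_eq_integral_Ioc]
  congr 2
  ext s
  simp only [mem_Icc, mem_inter_iff, mem_Iic]
  exact ⟨fun h => ⟨h.2, h.1, h.2.trans ht.2⟩, fun h => ⟨h.2.1, h.1⟩⟩

lemma intervalIntegral_eq_horizon {E : Type*} [NormedAddCommGroup E] [NormedSpace ℝ E] {T : ℝ}
    (hT : 0 ≤ T) (f : ℝ → E) : ∫ s in (0 : ℝ)..T, f s = ∫ s, f s ∂(horizon T) := by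
  rw [intervalIntegral.integral_of_le hT, ← integral_Icc_eq_integral_Ioc]

lemma intervalIntegrable_of_memLp {E : Type*} [NormedAddCommGroup E] {T : ℝ} (hT : 0 ≤ T)
    {f : ℝ → E} (hf : MemLp f 2 (horizon T)) : IntervalIntegrable f volume 0 T := by
  rw [intervalIntegrable_iff_integrableOn_Icc_of_le hT]
  exact hf.integrable (by norm_num)

section Processes

variable {Ω : Type*} {m : MeasurableSpace Ω} [mΩ : MeasurableSpace Ω] {P : Measure Ω}
  [IsProbabilityMeasure P]

omit [IsProbabilityMeasure P] in
lemma aestronglyMeasurable_of_apply {k : ℕ} {f : Ω → Fin k → ℝ}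
    (h : ∀ i, AEStronglyMeasurable[m] (fun ω => f ω i) P) : AEStronglyMeasurable[m] f P := by
  choose g hg hfg using h
  refine ⟨fun ω i => g i ω, ?_, ?_⟩
  · have h1 : Measurable[m] fun ω i => g i ω :=
      @measurable_pi_lambda _ _ _ m _ _ fun i => (hg i).measurable
    exact h1.stronglyMeasurable
  · filter_upwards [ae_all_iff.2 hfg] with ω hω
    ext i
    exact hω i

omit [IsProbabilityMeasure P] in
lemma aestronglyMeasurable_apply {k : ℕ} {f : Ω → Fin k → ℝ}
    (h : AEStronglyMeasurable[m] f P) (i : Fin k) : AEStronglyMeasurable[m] (fun ω => f ω i) P :=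
  (continuous_apply i).comp_aestronglyMeasurable h

omit [IsProbabilityMeasure P] in
lemma aestronglyMeasurable_const_mulVec {k l : ℕ} (M : Matrix (Fin k) (Fin l) ℝ)
    {f : Ω → Fin l → ℝ} (h : AEStronglyMeasurable[m] f P) :
    AEStronglyMeasurable[m] (fun ω => M *ᵥ f ω) P :=
  (by fun_prop : Continuous fun x : Fin l → ℝ => M *ᵥ x).comp_aestronglyMeasurable h

lemma aestronglyMeasurable_primitive (hm : m ≤ mΩ) {k : ℕ} {T : ℝ} {f : ℝ → Ω → Fin k → ℝ}
    (hf : MemLp (fun p : ℝ × Ω => f p.1 p.2) 2 ((horizon T).prod P))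
    (hfm : ∀ᵐ s ∂(horizon T), AEStronglyMeasurable[m] (f s) P) {t : ℝ} (ht : t ∈ Icc 0 T) :
    AEStronglyMeasurable[m] (fun ω => ∫ s in (0 : ℝ)..t, f s ω) P := by
  refine aestronglyMeasurable_of_apply fun i => ?_
  have hT : 0 ≤ T := ht.1.trans ht.2
  have h1 : AEStronglyMeasurable[m]
      (fun ω => ∫ s, (Iic t).indicator (fun s => f s ω i) s ∂(horizon T)) P := by
    refine aestronglyMeasurable_integral_of_sub
      (f := fun s ω => (Iic t).indicator (fun s => f s ω i) s) hm ?_ ?_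
    · have h2 : MemLp (fun p : ℝ × Ω => f p.1 p.2 i) 2 ((horizon T).prod P) :=
        ((L2Bd.of_memLp hf).apply i).memLp
      have h3 := h2.indicator (s := Prod.fst ⁻¹' Iic t) (measurable_fst measurableSet_Iic)
      exact h3
    · filter_upwards [hfm] with s hs
      by_cases hst : s ∈ Iic t
      · simpa only [indicator_of_mem hst] using aestronglyMeasurable_apply hs i
      · simp only [indicator_of_notMem hst]
        exact stronglyMeasurable_const.aestronglyMeasurable
  refine h1.congr ?_
  filter_upwards [ae_memLp_section hf] with ω hω
  have hi : IntervalIntegrable (fun s => f s ω) volume 0 t :=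
    (intervalIntegrable_of_memLp hT hω).mono_set (by
      rw [uIcc_of_le ht.1, uIcc_of_le hT]; exact Icc_subset_Icc_right ht.2)
  rw [intervalIntegral_apply hi, intervalIntegral_eq_indicator ht]

lemma norm_primitive_le {k : ℕ} {T t : ℝ} (ht : t ∈ Icc 0 T) {f : ℝ → Fin k → ℝ}
    (hf : IntervalIntegrable f volume 0 T) :
    ‖∫ s in (0 : ℝ)..t, f s‖ ≤ ∫ s, ‖f s‖ ∂(horizon T) := by
  have hT : 0 ≤ T := ht.1.trans ht.2
  rw [← intervalIntegral_eq_horizon hT]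
  calc ‖∫ s in (0 : ℝ)..t, f s‖ ≤ ∫ s in (0 : ℝ)..t, ‖f s‖ :=
        intervalIntegral.norm_integral_le_integral_norm ht.1
    _ ≤ ∫ s in (0 : ℝ)..T, ‖f s‖ :=
        intervalIntegral.integral_mono_interval le_rfl ht.1 ht.2
          (Eventually.of_forall fun s => norm_nonneg _) hf.norm

lemma L2Bd.primitive {k : ℕ} {T : ℝ} {f : ℝ → Ω → Fin k → ℝ} {K : ℝ}
    (hf : L2Bd ((horizon T).prod P) (fun p : ℝ × Ω => f p.1 p.2) K) {t : ℝ} (ht : t ∈ Icc 0 T) :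
    L2Bd P (fun ω => ∫ s in (0 : ℝ)..t, f s ω) (Real.sqrt ((horizon T).real univ) * K) := by
  have hT : 0 ≤ T := ht.1.trans ht.2
  refine hf.integral_norm.of_le
    (aestronglyMeasurable_primitive le_rfl hf.memLp hf.aesm.prodMk_left ht) ?_
  filter_upwards [ae_memLp_section hf.memLp] with ω hω
  exact norm_primitive_le ht (intervalIntegrable_of_memLp hT hω)

omit [IsProbabilityMeasure P] in
lemma L2Bd.mulVec {k l : ℕ} {T : ℝ} {τ : Measure ℝ} [IsFiniteMeasure τ]
    (hτ : ∀ᵐ t ∂τ, t ∈ Icc 0 T) {M : ℝ → Matrix (Fin k) (Fin l) ℝ}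
    (hM : ∀ i j, AEMeasurable (fun t => M t i j) τ) {L : ℝ} (hL : 0 ≤ L)
    (hLM : ∀ t ∈ Icc 0 T, ∀ x, ‖M t *ᵥ x‖ ≤ L * ‖x‖) {f : ℝ → Ω → Fin l → ℝ} {K : ℝ}
    (hf : L2Bd (τ.prod P) (fun p : ℝ × Ω => f p.1 p.2) K) :
    L2Bd (τ.prod P) (fun p : ℝ × Ω => M p.1 *ᵥ f p.1 p.2) (L * K) := by
  refine hf.of_norm_le hL (aestronglyMeasurable_mulVec (M := fun p : ℝ × Ω => M p.1)
    (fun i j => (hM i j).comp_quasiMeasurePreserving Measure.quasiMeasurePreserving_fst)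
    hf.aesm) ?_
  have h1 : ∀ᵐ p ∂(τ.prod P), p.1 ∈ Icc 0 T := Measure.quasiMeasurePreserving_fst.ae hτ
  filter_upwards [h1] with p hp using hLM p.1 hp _

variable {n : ℕ} {T : ℝ} {A : ℝ → Matrix (Fin n) (Fin n) ℝ}

/-- The flow is bounded on `L²`, and preserves measurability with respect to a fixed σ-algebra. -/
lemma FundSol.exists_L2Bd_flow (F : FundSol T A) : ∃ c : ℝ, 0 ≤ c ∧
    ∀ {Ω : Type*} [MeasurableSpace Ω] {P : Measure Ω} [IsProbabilityMeasure P]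
      {f : ℝ → Ω → Fin n → ℝ} {K : ℝ},
      L2Bd ((horizon T).prod P) (fun p : ℝ × Ω => f p.1 p.2) K → ∀ t ∈ Icc 0 T,
        L2Bd P (fun ω => F.flow (fun s => f s ω) t) (c * K) := by
  obtain ⟨L₁, h₁, H₁⟩ := F.isBddMeas_Φ.norm_mulVec_le
  obtain ⟨L₂, h₂, H₂⟩ := F.isBddMeas_Ψ.norm_mulVec_le
  refine ⟨L₁ * (Real.sqrt ((horizon T).real univ) * L₂), by positivity, ?_⟩
  intro Ω _ P _ f K hf t ht
  have h3 := L2Bd.primitive (f := fun s ω => F.Ψ s *ᵥ f s ω) (hf.mulVec (ae_horizon_mem T) F.isBddMeas_Ψ.1 h₂ H₂) ht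
  refine (h3.of_norm_le h₁ (aestronglyMeasurable_const_mulVec (F.Φ t) h3.aesm)
    (Eventually.of_forall fun ω => H₁ t ht _)).mono (le_of_eq (by ring))

lemma FundSol.aestronglyMeasurable_flow (F : FundSol T A) (hm : m ≤ mΩ) {f : ℝ → Ω → Fin n → ℝ}
    (hf : MemLp (fun p : ℝ × Ω => f p.1 p.2) 2 ((horizon T).prod P))
    (hfm : ∀ᵐ s ∂(horizon T), AEStronglyMeasurable[m] (f s) P) {t : ℝ} (ht : t ∈ Icc 0 T) :
    AEStronglyMeasurable[m] (fun ω => F.flow (fun s => f s ω) t) P := by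
  obtain ⟨L₂, h₂, H₂⟩ := F.isBddMeas_Ψ.norm_mulVec_le
  refine aestronglyMeasurable_const_mulVec (F.Φ t) (aestronglyMeasurable_primitive hm
    (f := fun s ω => F.Ψ s *ᵥ f s ω)
    ((L2Bd.of_memLp hf).mulVec (ae_horizon_mem T) F.isBddMeas_Ψ.1 h₂ H₂).memLp ?_ ht)
  exact hfm.mono fun s hs => aestronglyMeasurable_const_mulVec _ hs

end Processes

/-! ### States of the linear dynamics -/

section Paths

variable {Ω : Type*} [MeasurableSpace Ω] {P : Measure Ω} [IsProbabilityMeasure P]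

lemma L2Bd.prod_of_continuousOn {E : Type*} [NormedAddCommGroup E] {τ : Measure ℝ}
    [IsFiniteMeasure τ] {T : ℝ} (hT : 0 ≤ T) (hτ : ∀ᵐ t ∂τ, t ∈ Icc 0 T) {X : ℝ → Ω → E} {K : ℝ}
    (hX : ∀ t ∈ Icc 0 T, L2Bd P (X t) K)
    (hc : ∀ᵐ ω ∂P, ContinuousOn (fun t => X t ω) (Icc 0 T)) :
    L2Bd (τ.prod P) (fun p : ℝ × Ω => X p.1 p.2) (Real.sqrt (τ.real univ) * K) :=
  L2Bd.prod (hX 0 (left_mem_Icc.2 hT)).nonneg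
    (aestronglyMeasurable_prod_of_continuousOn hT (fun t ht => (hX t ht).aesm) hc hτ)
    (hτ.mono fun t ht => hX t ht)

lemma exists_L2Bd_deterministic {k : ℕ} {T : ℝ} (hT : 0 ≤ T) {z : ℝ → Fin k → ℝ}
    (hz : ContinuousOn z (Icc 0 T)) : ∃ Z : ℝ, 0 ≤ Z ∧ (∀ t ∈ Icc 0 T, ‖z t‖ ≤ Z) ∧
    ∀ {Ω : Type*} [MeasurableSpace Ω] {P : Measure Ω} [IsProbabilityMeasure P],
      ∀ t ∈ Icc 0 T, L2Bd P (fun _ : Ω => z t) Z := by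
  obtain ⟨Z, hZ⟩ := isCompact_Icc.exists_bound_of_continuousOn hz
  exact ⟨Z, (norm_nonneg _).trans (hZ 0 (left_mem_Icc.2 hT)), hZ,
    fun t ht => (L2Bd.const (z t)).mono (hZ t ht)⟩

end Paths

namespace Game

variable {n m : ℕ} (G : Game n m)

/-- The fundamental solution of `x' = A x`. -/
def fund : FundSol G.T G.A := (nonempty_fundSol G.T_pos.le G.A_bdd).some

/-- The change of the state that results from adding `w` to the control. -/
def resp {Ω : Type*} (w : ℝ → Ω → Fin m → ℝ) (t : ℝ) (ω : Ω) : Fin n → ℝ :=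
  G.fund.flow (fun s => G.B s *ᵥ w s ω) t

lemma resp_smul {Ω : Type*} (ε : ℝ) (w : ℝ → Ω → Fin m → ℝ) (t : ℝ) (ω : Ω) :
    G.resp (fun t ω => ε • w t ω) t ω = ε • G.resp w t ω := by
  simp only [resp, FundSol.flow, Matrix.mulVec_smul, intervalIntegral.integral_smul]

lemma zero_mem : (0 : ℝ) ∈ Icc 0 G.T := left_mem_Icc.2 G.T_pos.le

lemma end_mem : G.T ∈ Icc 0 G.T := right_mem_Icc.2 G.T_pos.le

lemma uIcc_subset {t : ℝ} (ht : t ∈ Icc 0 G.T) : uIcc 0 t ⊆ uIcc 0 G.T := by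
  rw [uIcc_of_le ht.1, uIcc_of_le G.T_pos.le]; exact Icc_subset_Icc_right ht.2

lemma exists_L2Bd_resp : ∃ c : ℝ, 0 ≤ c ∧
    ∀ {Ω : Type*} [MeasurableSpace Ω] {P : Measure Ω} [IsProbabilityMeasure P]
      {w : ℝ → Ω → Fin m → ℝ} {K : ℝ},
      L2Bd ((horizon G.T).prod P) (fun p : ℝ × Ω => w p.1 p.2) K → ∀ t ∈ Icc 0 G.T,
        L2Bd P (G.resp w t) (c * K) := by
  obtain ⟨c, hc, H⟩ := G.fund.exists_L2Bd_flow
  obtain ⟨L, hL, hLB⟩ := G.B_bdd.norm_mulVec_le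
  refine ⟨c * L, by positivity, ?_⟩
  intro Ω _ P _ w K hw t ht
  have h := H (f := fun s ω => G.B s *ᵥ w s ω) (hw.mulVec (ae_horizon_mem _) G.B_bdd.1 hL hLB) t ht
  rw [← mul_assoc] at h
  exact h

variable {Ω : Type*} {m' : MeasurableSpace Ω} [mΩ : MeasurableSpace Ω] {P : Measure Ω} [IsProbabilityMeasure P]

lemma ae_intervalIntegrable_control {w : ℝ → Ω → Fin m → ℝ}
    (hw : MemLp (fun p : ℝ × Ω => w p.1 p.2) 2 ((horizon G.T).prod P)) :
    ∀ᵐ ω ∂P, IntervalIntegrable (fun s => G.B s *ᵥ w s ω) volume 0 G.T := by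
  filter_upwards [ae_memLp_section hw] with ω hω
  exact G.B_bdd.intervalIntegrable_mulVec G.T_pos.le (intervalIntegrable_of_memLp G.T_pos.le hω)

lemma ae_continuousOn_resp {w : ℝ → Ω → Fin m → ℝ}
    (hw : MemLp (fun p : ℝ × Ω => w p.1 p.2) 2 ((horizon G.T).prod P)) :
    ∀ᵐ ω ∂P, ContinuousOn (fun t => G.resp w t ω) (Icc 0 G.T) := by
  filter_upwards [G.ae_intervalIntegrable_control hw] with ω hω
  exact G.fund.continuousOn_flow G.T_pos.le hω

variable {G} {x₀ : Ω → Fin n → ℝ} {W : ℝ≥0 → Ω → Fin n → ℝ} {v w : ℝ → Ω → Fin m → ℝ}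
  {μ y : ℝ → Ω → Fin n → ℝ}

/-- The noise is additive, so a change of control moves the state by a pathwise linear response.
States for all competing controls thus come from one given state, without solving a stochastic
equation, and `w` need not be adapted. -/
lemma IsState.add_resp (hy : G.IsState P x₀ W v μ y)
    (hw : MemLp (fun p : ℝ × Ω => w p.1 p.2) 2 ((horizon G.T).prod P)) :
    G.IsState P x₀ W (fun t ω => v t ω + w t ω) μ (fun t ω => y t ω + G.resp w t ω) := by
  have hT := G.T_pos.le
  have e : ∀ s ω, G.A s *ᵥ (y s ω + G.resp w s ω) + G.B s *ᵥ (v s ω + w s ω)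
        + G.Abar s *ᵥ μ s ω = (G.A s *ᵥ y s ω + G.B s *ᵥ v s ω + G.Abar s *ᵥ μ s ω)
        + (G.A s *ᵥ G.resp w s ω + G.B s *ᵥ w s ω) := fun s ω => by
    rw [Matrix.mulVec_add, Matrix.mulVec_add]; abel
  have hd : ∀ᵐ ω ∂P, IntervalIntegrable
      (fun s => G.A s *ᵥ G.resp w s ω + G.B s *ᵥ w s ω) volume 0 G.T := by
    filter_upwards [G.ae_continuousOn_resp hw, G.ae_intervalIntegrable_control hw] with ω h1 h2
    exact (G.A_bdd.intervalIntegrable_mulVec hT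
      (ContinuousOn.intervalIntegrable (by rwa [uIcc_of_le hT]))).add h2
  refine ⟨fun t ht => ?_, ?_, ?_, ?_⟩
  · obtain ⟨c, -, H⟩ := G.exists_L2Bd_resp
    exact (hy.aestronglyMeasurable t ht).add (H (L2Bd.of_memLp hw) t ht).aesm
  · filter_upwards [hy.continuousOn, G.ae_continuousOn_resp hw] with ω h1 h2 using h1.add h2
  · filter_upwards [hy.integrable_drift, hd] with ω h1 h2
    simp only [e]
    exact h1.add h2
  · obtain ⟨I, hI, hIy⟩ := hy.eq
    refine ⟨I, hI, ?_⟩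
    filter_upwards [hIy, hy.integrable_drift, hd, G.ae_intervalIntegrable_control hw]
      with ω h1 h2 h3 h4 t ht
    simp only [e]
    rw [intervalIntegral.integral_add (h2.mono_set (G.uIcc_subset ht))
      (h3.mono_set (G.uIcc_subset ht)), h1 t ht]
    have h5 : G.resp w t ω = ∫ s in (0 : ℝ)..t, (G.A s *ᵥ G.resp w s ω + G.B s *ᵥ w s ω) :=
      G.fund.flow_eq hT G.A_bdd h4 t ht
    rw [← h5]
    abel

/-- The explicit solution of the linear dynamics in a deterministic mean field. -/
lemma IsState.exists_residual {z : ℝ → Fin n → ℝ} (hz : ContinuousOn z (Icc 0 G.T))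
    (hv : MemLp (fun p : ℝ × Ω => v p.1 p.2) 2 ((horizon G.T).prod P))
    (hy : G.IsState P x₀ W v (fun t _ => z t) y) :
    ∃ I, IsWienerIntegral P G.T G.σ W I ∧
    ∃ r : ℝ → Ω → Fin n → ℝ,
      (r = fun t ω => x₀ ω + (∫ s in (0 : ℝ)..t, (G.B s *ᵥ v s ω + G.Abar s *ᵥ z s)) + I t ω) ∧
      (∀ᵐ ω ∂P, ContinuousOn (fun t => r t ω) (Icc 0 G.T)) ∧
      ∀ᵐ ω ∂P, ∀ t ∈ Icc 0 G.T,
        y t ω = r t ω + G.fund.flow (fun s => G.A s *ᵥ r s ω) t := by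
  have hT := G.T_pos.le
  obtain ⟨I, hI, hIy⟩ := hy.eq
  have hzi : IntervalIntegrable (fun s => G.Abar s *ᵥ z s) volume 0 G.T :=
    G.Abar_bdd.intervalIntegrable_mulVec hT
      (ContinuousOn.intervalIntegrable (by rwa [uIcc_of_le hT]))
  have hrc : ∀ᵐ ω ∂P, ContinuousOn (fun t => x₀ ω
      + (∫ s in (0 : ℝ)..t, (G.B s *ᵥ v s ω + G.Abar s *ᵥ z s)) + I t ω) (Icc 0 G.T) := by
    filter_upwards [G.ae_intervalIntegrable_control hv, hI.continuousOn] with ω h1 h2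
    have h3 := intervalIntegral.continuousOn_primitive_interval' (h1.add hzi) left_mem_uIcc
    rw [uIcc_of_le hT] at h3
    exact (continuousOn_const.add h3).add h2
  refine ⟨I, hI, _, rfl, hrc, ?_⟩
  filter_upwards [hrc, hy.continuousOn, hIy, G.ae_intervalIntegrable_control hv]
    with ω h1 h2 h3 h4
  refine G.fund.eq_add_flow hT G.A_bdd h2 h1 fun t ht => ?_
  have hAy : IntervalIntegrable (fun s => G.A s *ᵥ y s ω) volume 0 G.T :=
    G.A_bdd.intervalIntegrable_mulVec hT
      (ContinuousOn.intervalIntegrable (by rwa [uIcc_of_le hT]))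
  rw [h3 t ht]
  simp only [add_assoc]
  rw [intervalIntegral.integral_add (hAy.mono_set (G.uIcc_subset ht))
    ((h4.add hzi).mono_set (G.uIcc_subset ht))]
  abel

lemma L2Bd_drift_input {z : ℝ → Fin n → ℝ} {Z LB LA K : ℝ} (hLB : 0 ≤ LB) (hLA : 0 ≤ LA)
    (hB : ∀ t ∈ Icc 0 G.T, ∀ x, ‖G.B t *ᵥ x‖ ≤ LB * ‖x‖)
    (hA : ∀ t ∈ Icc 0 G.T, ∀ x, ‖G.Abar t *ᵥ x‖ ≤ LA * ‖x‖) (hz : ContinuousOn z (Icc 0 G.T))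
    (hZ : ∀ t ∈ Icc 0 G.T, L2Bd P (fun _ : Ω => z t) Z)
    (hv : L2Bd ((horizon G.T).prod P) (fun p : ℝ × Ω => v p.1 p.2) K) :
    L2Bd ((horizon G.T).prod P) (fun p : ℝ × Ω => G.B p.1 *ᵥ v p.1 p.2 + G.Abar p.1 *ᵥ z p.1)
      (LB * K + LA * (Real.sqrt ((horizon G.T).real univ) * Z)) :=
  (hv.mulVec (ae_horizon_mem _) G.B_bdd.1 hLB hB).add
    (L2Bd.mulVec (f := fun t (_ : Ω) => z t) (ae_horizon_mem _) G.Abar_bdd.1 hLA hA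
      (L2Bd.prod_of_continuousOn G.T_pos.le (ae_horizon_mem _) hZ (Eventually.of_forall fun _ => hz)))

/-- A bound for the second moments of the Wiener integral. -/
def noise (G : Game n m) : ℝ :=
  (∑ i, ∑ j, eLpNorm (fun s => G.σ s i j) 2 (volume.restrict (Icc 0 G.T))).toReal

lemma L2Bd_wienerIntegral (hW : IsStdWiener P W) {I : ℝ → Ω → Fin n → ℝ}
    (hI : IsWienerIntegral P G.T G.σ W I) {t : ℝ} (ht : t ∈ Icc 0 G.T) :
    L2Bd P (I t) G.noise := by
  refine ⟨(hI.memLp t ht).1, ENNReal.toReal_nonneg, ?_⟩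
  rw [noise, ENNReal.ofReal_toReal]
  · exact hI.eLpNorm_le hW G.σ_sq ht
  · exact (ENNReal.sum_lt_top.2 fun i _ => ENNReal.sum_lt_top.2 fun j _ => (G.σ_sq i j).2).ne

lemma L2Bd_residual {z : ℝ → Fin n → ℝ} (hW : IsStdWiener P W) {κ K : ℝ} (hx₀ : L2Bd P x₀ κ)
    (hK : L2Bd ((horizon G.T).prod P)
      (fun p : ℝ × Ω => G.B p.1 *ᵥ v p.1 p.2 + G.Abar p.1 *ᵥ z p.1) K)
    {I : ℝ → Ω → Fin n → ℝ} (hI : IsWienerIntegral P G.T G.σ W I) {t : ℝ} (ht : t ∈ Icc 0 G.T) :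
    L2Bd P (fun ω => x₀ ω + (∫ s in (0 : ℝ)..t, (G.B s *ᵥ v s ω + G.Abar s *ᵥ z s)) + I t ω)
      (κ + Real.sqrt ((horizon G.T).real univ) * K + G.noise) :=
  (hx₀.add (L2Bd.primitive (f := fun s ω => G.B s *ᵥ v s ω + G.Abar s *ᵥ z s) hK ht)).add
    (L2Bd_wienerIntegral hW hI ht)

/-- The state is a deterministic linear functional of the residual, built from initial value,
control and noise. Measurability in the information at the terminal time suffices for its uses:
independence between players, and the gradient. -/
lemma IsState.aestronglyMeasurable_info {z : ℝ → Fin n → ℝ}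
    (hz : ContinuousOn z (Icc 0 G.T)) (hm : m' ≤ mΩ) (hW : IsStdWiener P W)
    (hv : MemLp (fun p : ℝ × Ω => v p.1 p.2) 2 ((horizon G.T).prod P))
    (hvm : ∀ᵐ s ∂(horizon G.T), AEStronglyMeasurable[m'] (v s) P)
    (hinfo : playerInfo x₀ W G.T ≤ m') (hx₀ : MemLp x₀ 2 P)
    (hy : G.IsState P x₀ W v (fun t _ => z t) y) {t : ℝ} (ht : t ∈ Icc 0 G.T) :
    AEStronglyMeasurable[m'] (y t) P := by
  have hT := G.T_pos.le
  obtain ⟨LA, hLA, hA⟩ := G.A_bdd.norm_mulVec_le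
  obtain ⟨LB, hLB, hB⟩ := G.B_bdd.norm_mulVec_le
  obtain ⟨LC, hLC, hC⟩ := G.Abar_bdd.norm_mulVec_le
  obtain ⟨Z, hZ0, -, hZ⟩ := exists_L2Bd_deterministic hT hz
  obtain ⟨I, hI, r, hr, hrc, hyr⟩ := hy.exists_residual hz hv
  have hf := L2Bd_drift_input hLB hLC hB hC hz hZ (L2Bd.of_memLp hv)
  have hrL : ∀ t ∈ Icc 0 G.T, L2Bd P (r t) _ := fun t ht => by
    rw [hr]; exact L2Bd_residual hW (L2Bd.of_memLp hx₀) hf hI ht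
  have hrm : ∀ t ∈ Icc 0 G.T, AEStronglyMeasurable[m'] (r t) P := by
    intro t ht
    have h1 : AEStronglyMeasurable[m'] x₀ P := by
      have h2 : Measurable[m'] x₀ := measurable_iff_comap_le.2 (le_sup_left.trans hinfo)
      exact h2.stronglyMeasurable.aestronglyMeasurable
    have h2 := aestronglyMeasurable_primitive hm (f := fun s ω => G.B s *ᵥ v s ω + G.Abar s *ᵥ z s)
      hf.memLp (hvm.mono fun s hs => (aestronglyMeasurable_const_mulVec (G.B s) hs).add
        stronglyMeasurable_const.aestronglyMeasurable) ht
    have h3 : AEStronglyMeasurable[m'] (I t) P :=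
      hI.aestronglyMeasurable hW.measurable ht fun s hs => measurable_iff_comap_le.2
        (le_trans (le_sup_of_le_right (le_iSup₂_of_le s (hs.trans ht.2) le_rfl)) hinfo)
    rw [hr]
    exact (h1.add h2).add h3
  have hAr := (L2Bd.prod_of_continuousOn hT (ae_horizon_mem _) hrL hrc).mulVec (ae_horizon_mem _)
    G.A_bdd.1 hLA hA
  have h4 := G.fund.aestronglyMeasurable_flow hm (f := fun s ω => G.A s *ᵥ r s ω) hAr.memLp
    ((ae_horizon_mem _).mono fun s hs => aestronglyMeasurable_const_mulVec _ (hrm s hs)) ht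
  refine ((hrm t ht).add h4).congr ?_
  filter_upwards [hyr] with ω hω
  exact (hω t ht).symm

omit [IsProbabilityMeasure P] in
lemma L2Bd_of_hasLaw {ν : Measure (Fin n → ℝ)} (hν : MemLp id 2 ν) (hx : HasLaw x₀ ν P) :
    L2Bd P x₀ (eLpNorm (id : (Fin n → ℝ) → Fin n → ℝ) 2 ν).toReal := by
  refine ⟨hx.aemeasurable.aestronglyMeasurable, ENNReal.toReal_nonneg, ?_⟩
  rw [ENNReal.ofReal_toReal hν.2.ne]
  have h := eLpNorm_map_measure (p := 2) (μ := P) (f := x₀) (g := (id : (Fin n → ℝ) → Fin n → ℝ))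
    aestronglyMeasurable_id hx.aemeasurable
  rw [hx.map_eq] at h
  rw [h]
  rfl

/-- Only `G`, `ν` and `z` enter the constant, so it serves every player, every `N` and every
probability space; the control enters through its norm `K` alone. -/
theorem exists_L2Bd_state (G : Game n m) {ν : Measure (Fin n → ℝ)} (hν : MemLp id 2 ν)
    {z : ℝ → Fin n → ℝ} (hz : ContinuousOn z (Icc 0 G.T)) : ∃ c : ℝ, 0 ≤ c ∧
    ∀ {Ω : Type*} [MeasurableSpace Ω] {P : Measure Ω} [IsProbabilityMeasure P]
      {x₀ : Ω → Fin n → ℝ} {W : ℝ≥0 → Ω → Fin n → ℝ} {v : ℝ → Ω → Fin m → ℝ}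
      {y : ℝ → Ω → Fin n → ℝ} {K : ℝ}, HasLaw x₀ ν P → IsStdWiener P W →
      L2Bd ((horizon G.T).prod P) (fun p : ℝ × Ω => v p.1 p.2) K →
      G.IsState P x₀ W v (fun t _ => z t) y →
      ∀ t ∈ Icc 0 G.T, L2Bd P (y t) (c * (1 + K)) := by
  have hT := G.T_pos.le
  obtain ⟨LA, hLA, hA⟩ := G.A_bdd.norm_mulVec_le
  obtain ⟨LB, hLB, hB⟩ := G.B_bdd.norm_mulVec_le
  obtain ⟨LC, hLC, hC⟩ := G.Abar_bdd.norm_mulVec_le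
  obtain ⟨Z, hZ0, -, hZ⟩ := exists_L2Bd_deterministic hT hz
  obtain ⟨cF, hcF, hF⟩ := G.fund.exists_L2Bd_flow
  set q : ℝ := Real.sqrt ((horizon G.T).real univ) with hq
  have hq0 : 0 ≤ q := Real.sqrt_nonneg _
  set κ : ℝ := (eLpNorm (id : (Fin n → ℝ) → Fin n → ℝ) 2 ν).toReal
  have hκ : 0 ≤ κ := ENNReal.toReal_nonneg
  have hN : 0 ≤ G.noise := ENNReal.toReal_nonneg
  refine ⟨(1 + cF * LA * q) * (κ + q * (LC * (q * Z)) + G.noise + q * LB), by positivity, ?_⟩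
  intro Ω _ P _ x₀ W v y K hx hW hv hy t ht
  have hK := hv.nonneg
  obtain ⟨I, hI, r, hr, hrc, hyr⟩ := hy.exists_residual hz hv.memLp
  have hf := L2Bd_drift_input hLB hLC hB hC hz hZ hv
  have hrL : ∀ t ∈ Icc 0 G.T, L2Bd P (r t)
      ((κ + q * (LC * (q * Z)) + G.noise + q * LB) * (1 + K)) := fun t ht => by
    rw [hr]
    refine (L2Bd_residual hW (L2Bd_of_hasLaw hν hx) hf hI ht).mono ?_
    have h1 : 0 ≤ (κ + q * (LC * (q * Z)) + G.noise) * K := by positivity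
    have h2 : 0 ≤ q * LB := by positivity
    simp only [← hq]
    nlinarith
  have hAr := (L2Bd.prod_of_continuousOn hT (ae_horizon_mem _) hrL hrc).mulVec (ae_horizon_mem _)
    G.A_bdd.1 hLA hA
  have h4 := hF (f := fun s ω => G.A s *ᵥ r s ω) hAr t ht
  refine (((hrL t ht).add h4).mono (le_of_eq ?_)).congr ?_
  · simp only [← hq]; ring
  · filter_upwards [hyr] with ω hω
    exact (hω t ht).symm

end Game

/-! ### The cost as a quadratic form on `L²` -/

section Form

variable {Ω : Type*} [MeasurableSpace Ω] {P : Measure Ω} [IsProbabilityMeasure P]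

lemma integrable_dotProduct {α : Type*} [MeasurableSpace α] {κ : Measure α} {k : ℕ}
    {f g : α → Fin k → ℝ} (hf : MemLp f 2 κ) (hg : MemLp g 2 κ) :
    Integrable (fun a => f a ⬝ᵥ g a) κ := by
  simp only [dotProduct]
  exact integrable_finsetSum _ fun i _ =>
    ((L2Bd.of_memLp hf).apply i).memLp.integrable_mul ((L2Bd.of_memLp hg).apply i).memLp

/-- The bilinear form `∫ x* M x'` of two processes. -/
def bil {k : ℕ} (κ : Measure (ℝ × Ω)) (M : ℝ → Matrix (Fin k) (Fin k) ℝ)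
    (x x' : ℝ → Ω → Fin k → ℝ) : ℝ :=
  ∫ p, x p.1 p.2 ⬝ᵥ (M p.1 *ᵥ x' p.1 p.2) ∂κ

variable {k : ℕ} {T : ℝ} {τ : Measure ℝ} [IsFiniteMeasure τ]
  {M : ℝ → Matrix (Fin k) (Fin k) ℝ} {x x' : ℝ → Ω → Fin k → ℝ}

omit [IsProbabilityMeasure P] in
lemma integrable_bil (hτ : ∀ᵐ t ∂τ, t ∈ Icc 0 T) (hM : IsBddMeas T M)
    (hMm : ∀ i j, AEMeasurable (fun t => M t i j) τ)
    (hx : MemLp (fun p : ℝ × Ω => x p.1 p.2) 2 (τ.prod P))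
    (hx' : MemLp (fun p : ℝ × Ω => x' p.1 p.2) 2 (τ.prod P)) :
    Integrable (fun p : ℝ × Ω => x p.1 p.2 ⬝ᵥ (M p.1 *ᵥ x' p.1 p.2)) (τ.prod P) := by
  obtain ⟨L, hL, hLM⟩ := hM.norm_mulVec_le
  exact integrable_dotProduct hx ((L2Bd.of_memLp hx').mulVec hτ hMm hL hLM).memLp

omit [IsProbabilityMeasure P] in
lemma bil_add_smul (hτ : ∀ᵐ t ∂τ, t ∈ Icc 0 T) (hM : IsBddMeas T M)
    (hMm : ∀ i j, AEMeasurable (fun t => M t i j) τ) (hs : ∀ t ∈ Icc 0 T, (M t)ᵀ = M t)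
    (hx : MemLp (fun p : ℝ × Ω => x p.1 p.2) 2 (τ.prod P))
    (hx' : MemLp (fun p : ℝ × Ω => x' p.1 p.2) 2 (τ.prod P)) (ε : ℝ) :
    bil (τ.prod P) M (fun t ω => x t ω + ε • x' t ω) (fun t ω => x t ω + ε • x' t ω)
      = bil (τ.prod P) M x x + 2 * ε * bil (τ.prod P) M x x'
        + ε ^ 2 * bil (τ.prod P) M x' x' := by
  have i1 := integrable_bil hτ hM hMm hx hx
  have i2 := integrable_bil hτ hM hMm hx hx'
  have i3 := integrable_bil hτ hM hMm hx' hx'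
  have i4 : Integrable (fun p : ℝ × Ω => x p.1 p.2 ⬝ᵥ (M p.1 *ᵥ x p.1 p.2)
      + 2 * ε * (x p.1 p.2 ⬝ᵥ (M p.1 *ᵥ x' p.1 p.2))) (τ.prod P) := i1.add (i2.const_mul _)
  simp only [bil]
  rw [← integral_const_mul, ← integral_const_mul, ← integral_add i1 (i2.const_mul _),
    ← integral_add i4 (i3.const_mul _)]
  refine integral_congr_ae ?_
  have h1 : ∀ᵐ p ∂(τ.prod P), p.1 ∈ Icc 0 T := Measure.quasiMeasurePreserving_fst.ae hτ
  filter_upwards [h1] with p hp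
  have h2 : x' p.1 p.2 ⬝ᵥ (M p.1 *ᵥ x p.1 p.2) = x p.1 p.2 ⬝ᵥ (M p.1 *ᵥ x' p.1 p.2) := by
    rw [dotProduct_comm, Matrix.dotProduct_mulVec, ← Matrix.mulVec_transpose, hs p.1 hp,
      dotProduct_comm, dotProduct_comm]
  simp only [Matrix.mulVec_add, Matrix.mulVec_smul, dotProduct_add, add_dotProduct, dotProduct_smul,
    smul_dotProduct, smul_eq_mul, h2]
  ring

omit [IsProbabilityMeasure P] [IsFiniteMeasure τ] in
lemma bil_self_nonneg (hτ : ∀ᵐ t ∂τ, t ∈ Icc 0 T) (hM : ∀ t ∈ Icc 0 T, (M t).PosSemidef) :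
    0 ≤ bil (τ.prod P) M x x := by
  refine integral_nonneg_of_ae ?_
  have h1 : ∀ᵐ p ∂(τ.prod P), p.1 ∈ Icc 0 T := Measure.quasiMeasurePreserving_fst.ae hτ
  filter_upwards [h1] with p hp
  simpa using (hM p.1 hp).dotProduct_mulVec_nonneg (x p.1 p.2)

omit [IsProbabilityMeasure P] in
lemma bil_self_le (hτ : ∀ᵐ t ∂τ, t ∈ Icc 0 T) (hM : IsBddMeas T M)
    (hMm : ∀ i j, AEMeasurable (fun t => M t i j) τ) {L : ℝ} (hL : 0 ≤ L)
    (hLM : ∀ t ∈ Icc 0 T, ∀ x, ‖M t *ᵥ x‖ ≤ L * ‖x‖) {K : ℝ}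
    (hx : L2Bd (τ.prod P) (fun p : ℝ × Ω => x p.1 p.2) K) :
    bil (τ.prod P) M x x ≤ k * L * K ^ 2 := by
  have h1 : ∀ᵐ p ∂(τ.prod P), p.1 ∈ Icc 0 T := Measure.quasiMeasurePreserving_fst.ae hτ
  have h2 : Integrable (fun p : ℝ × Ω => ‖x p.1 p.2‖ ^ 2) (τ.prod P) :=
    hx.norm.memLp.integrable_sq
  calc bil (τ.prod P) M x x ≤ ∫ p, k * L * ‖x p.1 p.2‖ ^ 2 ∂(τ.prod P) := by
        refine integral_mono_ae (integrable_bil hτ hM hMm hx.memLp hx.memLp)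
          (h2.const_mul _) ?_
        filter_upwards [h1] with p hp
        calc x p.1 p.2 ⬝ᵥ (M p.1 *ᵥ x p.1 p.2)
            ≤ k * (‖x p.1 p.2‖ * ‖M p.1 *ᵥ x p.1 p.2‖) :=
              (le_abs_self _).trans (norm_dotProduct_le _ _)
          _ ≤ k * (‖x p.1 p.2‖ * (L * ‖x p.1 p.2‖)) := by gcongr; exact hLM _ hp _
          _ = k * L * ‖x p.1 p.2‖ ^ 2 := by ring
    _ = k * L * ∫ p, ‖x p.1 p.2‖ ^ 2 ∂(τ.prod P) := integral_const_mul _ _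
    _ ≤ k * L * K ^ 2 := by gcongr; exact hx.integral_sq_le

lemma integral_prod_horizonEnd {f : ℝ → Ω → ℝ}
    (hf : Integrable (fun p : ℝ × Ω => f p.1 p.2) ((horizonEnd T).prod P)) :
    Integrable (fun p : ℝ × Ω => f p.1 p.2) ((horizon T).prod P) ∧ Integrable (f T) P ∧
    ∫ p, f p.1 p.2 ∂((horizonEnd T).prod P)
      = ∫ p, f p.1 p.2 ∂((horizon T).prod P) + ∫ ω, f T ω ∂P := by
  rw [Measure.add_prod, Measure.dirac_prod] at hf ⊢
  have h1 := hf.left_of_add_measure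
  have h2 := hf.right_of_add_measure
  have hm : AEMeasurable (Prod.mk T : Ω → ℝ × Ω) P := measurable_prodMk_left.aemeasurable
  refine ⟨h1, (integrable_map_measure h2.1 hm).1 h2, ?_⟩
  rw [integral_add_measure h1 h2, integral_map hm h2.1]

lemma integral_running_add_terminal (hT : 0 ≤ T) {a r b : ℝ → Ω → ℝ}
    (ha : Integrable (fun p : ℝ × Ω => a p.1 p.2) ((horizonEnd T).prod P))
    (hr : Integrable (fun p : ℝ × Ω => r p.1 p.2) ((horizon T).prod P))
    (hb : Integrable (fun p : ℝ × Ω => b p.1 p.2) ((horizonEnd T).prod P)) :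
    ∫ ω, ((1 / 2) * (∫ t in (0 : ℝ)..T, (a t ω + r t ω + b t ω)) + (1 / 2) * a T ω
      + (1 / 2) * b T ω) ∂P
      = 1 / 2 * (∫ p, a p.1 p.2 ∂((horizonEnd T).prod P) + ∫ p, b p.1 p.2 ∂((horizonEnd T).prod P)
        + ∫ p, r p.1 p.2 ∂((horizon T).prod P)) := by
  obtain ⟨i1, j1, e1⟩ := integral_prod_horizonEnd ha
  obtain ⟨i2, j2, e2⟩ := integral_prod_horizonEnd hb
  have i13 : Integrable (fun p : ℝ × Ω => a p.1 p.2 + r p.1 p.2) ((horizon T).prod P) := i1.add hr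
  have i123 : Integrable (fun p : ℝ × Ω => a p.1 p.2 + r p.1 p.2 + b p.1 p.2)
    ((horizon T).prod P) := i13.add i2
  have k1 : Integrable (fun ω => (1 / 2) * (∫ t in (0 : ℝ)..T, (a t ω + r t ω + b t ω))) P := by
    simp only [intervalIntegral_eq_horizon hT]
    exact i123.integral_prod_right.const_mul _
  have k2 : Integrable (fun ω => (1 / 2) * a T ω) P := j1.const_mul _
  have k3 : Integrable (fun ω => (1 / 2) * b T ω) P := j2.const_mul _
  have k12 : Integrable (fun ω => (1 / 2) * (∫ t in (0 : ℝ)..T, (a t ω + r t ω + b t ω))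
      + (1 / 2) * a T ω) P := k1.add k2
  rw [integral_add k12 k3, integral_add k1 k2, integral_const_mul, integral_const_mul,
    integral_const_mul, e1, e2]
  simp only [intervalIntegral_eq_horizon hT]
  have s0 := integral_prod_symm _ i123
  rw [integral_add i13 i2, integral_add i1 hr] at s0
  rw [← s0]
  ring

/-- Minkowski's inequality for a semidefinite form, stated for the three numbers that occur:
nonnegativity of the quadratic in `ε` gives Cauchy–Schwarz through its discriminant. -/
lemma sqrt_add_le_of_forall {a b c : ℝ} (ha : 0 ≤ a) (hc : 0 ≤ c)
    (h : ∀ ε : ℝ, 0 ≤ a + 2 * ε * b + ε ^ 2 * c) :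
    Real.sqrt (a + 2 * b + c) ≤ Real.sqrt a + Real.sqrt c := by
  have hb : b ≤ Real.sqrt a * Real.sqrt c := by
    rw [← Real.sqrt_mul ha]
    refine Real.le_sqrt_of_sq_le ?_
    have h1 : discrim c (2 * b) a ≤ 0 := discrim_le_zero fun ε => by linarith [h ε, sq ε]
    rw [discrim] at h1
    nlinarith
  refine Real.sqrt_le_iff.2 ⟨by positivity, ?_⟩
  nlinarith [Real.sq_sqrt ha, Real.sq_sqrt hc]

end Form

/-- Triples `(v, p, x)` of a control, a deviation from the tracked process, and a state. -/
abbrev Triple (n m : ℕ) (Ω : Type*) : Type _ :=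
  (ℝ → Ω → Fin m → ℝ) × (ℝ → Ω → Fin n → ℝ) × (ℝ → Ω → Fin n → ℝ)

/-! ### The cost as a quadratic form on triples -/

namespace Game

variable {n m : ℕ} (G : Game n m) {Ω : Type*} [MeasurableSpace Ω] (P : Measure Ω)

/-- The symmetric bilinear form of which the cost is the diagonal. -/
def form (ξ η : Triple n m Ω) : ℝ :=
  1 / 2 * (bil ((horizonEnd G.T).prod P) G.Q ξ.2.2 η.2.2
    + bil ((horizonEnd G.T).prod P) G.Qbar ξ.2.1 η.2.1
    + bil ((horizon G.T).prod P) G.R ξ.1 η.1)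

/-- The square integrability of a triple, with a common bound for the three `L²`-norms. -/
structure SqBd (ξ : Triple n m Ω) (K : ℝ) : Prop where
  control : L2Bd ((horizon G.T).prod P) (fun q : ℝ × Ω => ξ.1 q.1 q.2) K
  deviation : L2Bd ((horizonEnd G.T).prod P) (fun q : ℝ × Ω => ξ.2.1 q.1 q.2) K
  state : L2Bd ((horizonEnd G.T).prod P) (fun q : ℝ × Ω => ξ.2.2 q.1 q.2) K

variable {G P} {ξ η : Triple n m Ω} {K K' : ℝ}

lemma transpose_eq_of_posSemidef {k : ℕ} {M : Matrix (Fin k) (Fin k) ℝ} (h : M.PosSemidef) :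
    Mᵀ = M := by
  rw [← Matrix.conjTranspose_eq_transpose_of_trivial]; exact h.1.eq

lemma exists_coercive (G : Game n m) : ∃ δ : ℝ, 0 < δ ∧
    (∀ t ∈ Icc 0 G.T, (G.R t).PosSemidef) ∧
      ∀ t ∈ Icc 0 G.T, ∀ x, δ * ‖x‖ ^ 2 ≤ x ⬝ᵥ (G.R t *ᵥ x) := by
  obtain ⟨δ, hδ, h⟩ := G.R_coercive
  refine ⟨δ, hδ, fun t ht => ?_, fun t ht x => ?_⟩
  · have h1 := (h t ht).add (Matrix.PosSemidef.one.smul hδ.le)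
    rwa [sub_add_cancel] at h1
  · have h1 := (h t ht).dotProduct_mulVec_nonneg x
    simp only [star_trivial, Matrix.sub_mulVec, dotProduct_sub, Matrix.smul_mulVec,
      Matrix.one_mulVec, dotProduct_smul, smul_eq_mul] at h1
    have := mul_le_mul_of_nonneg_left (norm_sq_le_dotProduct x) hδ.le
    linarith

lemma R_nonneg (G : Game n m) : ∀ t ∈ Icc 0 G.T, (G.R t).PosSemidef :=
  G.exists_coercive.choose_spec.2.1

lemma form_self_nonneg (ξ : Triple n m Ω) [SFinite P] : 0 ≤ G.form P ξ ξ := by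
  have hE := ae_horizonEnd_mem G.T_pos.le
  have h1 := bil_self_nonneg (P := P) (x := ξ.2.2) hE G.Q_nonneg
  have h2 := bil_self_nonneg (P := P) (x := ξ.2.1) hE G.Qbar_nonneg
  have h3 := bil_self_nonneg (P := P) (x := ξ.1) (ae_horizon_mem G.T) G.R_nonneg
  simp only [form]
  positivity

lemma SqBd.add (hξ : G.SqBd P ξ K) (hη : G.SqBd P η K') : G.SqBd P (ξ + η) (K + K') :=
  ⟨hξ.control.add hη.control, hξ.deviation.add hη.deviation, hξ.state.add hη.state⟩

lemma SqBd.mono (hξ : G.SqBd P ξ K) (h : K ≤ K') : G.SqBd P ξ K' :=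
  ⟨hξ.control.mono h, hξ.deviation.mono h, hξ.state.mono h⟩

lemma form_add_smul (hξ : G.SqBd P ξ K) (hη : G.SqBd P η K') (ε : ℝ) :
    G.form P (ξ + ε • η) (ξ + ε • η)
      = G.form P ξ ξ + 2 * ε * G.form P ξ η + ε ^ 2 * G.form P η η := by
  have hE := ae_horizonEnd_mem G.T_pos.le
  have h1 := bil_add_smul hE G.Q_bdd (fun i j => aemeasurable_horizonEnd (G.Q_bdd.1 i j))
    (fun t ht => transpose_eq_of_posSemidef (G.Q_nonneg t ht)) hξ.state.memLp hη.state.memLp ε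
  have h2 := bil_add_smul hE G.Qbar_bdd (fun i j => aemeasurable_horizonEnd (G.Qbar_bdd.1 i j))
    (fun t ht => transpose_eq_of_posSemidef (G.Qbar_nonneg t ht)) hξ.deviation.memLp
    hη.deviation.memLp ε
  have h3 := bil_add_smul (ae_horizon_mem G.T) G.R_bdd (fun i j => G.R_bdd.1 i j)
    (fun t ht => transpose_eq_of_posSemidef (G.R_nonneg t ht)) hξ.control.memLp
    hη.control.memLp ε
  simp only [form]
  linear_combination 1 / 2 * (h1 + h2 + h3)

variable [IsProbabilityMeasure P]

lemma sqrt_form_add_le (hξ : G.SqBd P ξ K) (hη : G.SqBd P η K') :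
    Real.sqrt (G.form P (ξ + η) (ξ + η))
      ≤ Real.sqrt (G.form P ξ ξ) + Real.sqrt (G.form P η η) := by
  have h := form_add_smul hξ hη 1
  rw [one_smul] at h
  rw [h]
  refine le_trans (le_of_eq (by ring_nf)) (sqrt_add_le_of_forall (b := G.form P ξ η)
    (form_self_nonneg ξ) (form_self_nonneg η) fun ε => ?_)
  rw [← form_add_smul hξ hη ε]
  exact form_self_nonneg _

lemma exists_sqrt_form_le (G : Game n m) : ∃ c : ℝ, 0 ≤ c ∧
    ∀ {Ω : Type*} [MeasurableSpace Ω] {P : Measure Ω} [IsProbabilityMeasure P]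
      {ξ : Triple n m Ω} {K : ℝ}, G.SqBd P ξ K → Real.sqrt (G.form P ξ ξ) ≤ c * K := by
  have hE := ae_horizonEnd_mem G.T_pos.le
  obtain ⟨L1, hL1, h1⟩ := G.Q_bdd.norm_mulVec_le
  obtain ⟨L2, hL2, h2⟩ := G.Qbar_bdd.norm_mulVec_le
  obtain ⟨L3, hL3, h3⟩ := G.R_bdd.norm_mulVec_le
  refine ⟨Real.sqrt (n * L1 + n * L2 + m * L3), Real.sqrt_nonneg _, ?_⟩
  intro Ω _ P _ ξ K h
  have e1 := bil_self_le hE G.Q_bdd (fun i j => aemeasurable_horizonEnd (G.Q_bdd.1 i j)) hL1 h1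
    h.state
  have e2 := bil_self_le hE G.Qbar_bdd (fun i j => aemeasurable_horizonEnd (G.Qbar_bdd.1 i j))
    hL2 h2 h.deviation
  have e3 := bil_self_le (ae_horizon_mem G.T) G.R_bdd G.R_bdd.1 hL3 h3 h.control
  refine Real.sqrt_le_iff.2 ⟨mul_nonneg (Real.sqrt_nonneg _) h.control.nonneg, ?_⟩
  rw [mul_pow, Real.sq_sqrt (by positivity)]
  have : 0 ≤ (n * L1 + n * L2 + m * L3) * K ^ 2 := by positivity
  simp only [form]
  nlinarith

/-- Since `R ≥ δ I` and the other terms are nonnegative, the form controls the norm of the control;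
the `2` in the constant undoes the factor `1/2` in the cost. It is what bounds a profitable
deviation. -/
lemma exists_control_le (G : Game n m) : ∃ c : ℝ, 0 ≤ c ∧
    ∀ {Ω : Type*} [MeasurableSpace Ω] {P : Measure Ω} [IsProbabilityMeasure P]
      {ξ : Triple n m Ω} {K : ℝ}, G.SqBd P ξ K →
      L2Bd ((horizon G.T).prod P) (fun q : ℝ × Ω => ξ.1 q.1 q.2)
        (c * Real.sqrt (G.form P ξ ξ)) := by
  obtain ⟨δ, hδ, -, h⟩ := G.exists_coercive
  refine ⟨Real.sqrt (2 / δ), Real.sqrt_nonneg _, ?_⟩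
  intro Ω _ P _ ξ K hξ
  refine L2Bd.of_integral_sq_le hξ.control.memLp (by positivity) ?_
  rw [mul_pow, Real.sq_sqrt (by positivity), Real.sq_sqrt (form_self_nonneg ξ)]
  have hE := ae_horizonEnd_mem G.T_pos.le
  have h1 := bil_self_nonneg (P := P) (x := ξ.2.2) hE G.Q_nonneg
  have h2 := bil_self_nonneg (P := P) (x := ξ.2.1) hE G.Qbar_nonneg
  have h3 : δ * ∫ q, ‖ξ.1 q.1 q.2‖ ^ 2 ∂((horizon G.T).prod P)
      ≤ bil ((horizon G.T).prod P) G.R ξ.1 ξ.1 := by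
    rw [← integral_const_mul]
    refine integral_mono_ae (hξ.control.norm.memLp.integrable_sq.const_mul _)
      (integrable_bil (ae_horizon_mem G.T) G.R_bdd G.R_bdd.1 hξ.control.memLp
        hξ.control.memLp) ?_
    have hm : ∀ᵐ p ∂((horizon G.T).prod P), p.1 ∈ Icc 0 G.T :=
      Measure.quasiMeasurePreserving_fst.ae (ae_horizon_mem G.T)
    filter_upwards [hm] with p hp using h p.1 hp _
  rw [div_mul_eq_mul_div, le_div_iff₀ hδ, mul_comm]
  refine h3.trans ?_
  simp only [form]
  linarith

/-- The triple of a control `v` and a state `x` in the mean field `μ`. -/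
def triple (G : Game n m) {Ω : Type*} (v : ℝ → Ω → Fin m → ℝ) (μ x : ℝ → Ω → Fin n → ℝ) :
    Triple n m Ω :=
  (v, fun t ω => x t ω - G.S t *ᵥ μ t ω, x)

/-- The Dirac mass of `horizonEnd` produces the terminal terms. The bound `K` enters only as
integrability, needed to split the integral and to exchange time and expectation. -/
lemma cost_eq_form {v : ℝ → Ω → Fin m → ℝ} {μ x : ℝ → Ω → Fin n → ℝ}
    (h : G.SqBd P (G.triple v μ x) K) :
    G.cost P v μ x = G.form P (G.triple v μ x) (G.triple v μ x) := by
  have hE := ae_horizonEnd_mem G.T_pos.le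
  have hs : MemLp (fun p : ℝ × Ω => x p.1 p.2) 2 ((horizonEnd G.T).prod P) := h.state.memLp
  have hc : MemLp (fun p : ℝ × Ω => v p.1 p.2) 2 ((horizon G.T).prod P) := h.control.memLp
  have hd : MemLp (fun p : ℝ × Ω => x p.1 p.2 - G.S p.1 *ᵥ μ p.1 p.2) 2
    ((horizonEnd G.T).prod P) := h.deviation.memLp
  have ha := integrable_bil hE G.Q_bdd (fun i j => aemeasurable_horizonEnd (G.Q_bdd.1 i j)) hs hs
  have hr := integrable_bil (ae_horizon_mem G.T) G.R_bdd G.R_bdd.1 hc hc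
  have hb := integrable_bil (x := fun t ω => x t ω - G.S t *ᵥ μ t ω)
    (x' := fun t ω => x t ω - G.S t *ᵥ μ t ω) hE G.Qbar_bdd
    (fun i j => aemeasurable_horizonEnd (G.Qbar_bdd.1 i j)) hd hd
  have key := integral_running_add_terminal G.T_pos.le
    (a := fun t ω => x t ω ⬝ᵥ (G.Q t *ᵥ x t ω)) (r := fun t ω => v t ω ⬝ᵥ (G.R t *ᵥ v t ω))
    (b := fun t ω => (x t ω - G.S t *ᵥ μ t ω) ⬝ᵥ (G.Qbar t *ᵥ (x t ω - G.S t *ᵥ μ t ω)))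
    ha hr hb
  simp only [cost, form, bil, triple, quad]
  exact key

end Game

lemma memLp_of_prod_horizonEnd {Ω E : Type*} [MeasurableSpace Ω] [NormedAddCommGroup E]
    {P : Measure Ω} [SFinite P] {T : ℝ} {f : ℝ → Ω → E}
    (hf : MemLp (fun p : ℝ × Ω => f p.1 p.2) 2 ((horizonEnd T).prod P)) :
    MemLp (fun p : ℝ × Ω => f p.1 p.2) 2 ((horizon T).prod P) ∧ MemLp (f T) 2 P := by
  rw [Measure.add_prod, Measure.dirac_prod] at hf
  have h2 := hf.right_of_add_measure
  exact ⟨hf.left_of_add_measure,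
    (memLp_map_measure_iff h2.1 measurable_prodMk_left.aemeasurable).1 h2⟩

lemma intervalIntegrable_sum_apply {k : ℕ} {a b : ℝ} {f g : ℝ → Fin k → ℝ}
    (h : ∀ i, IntervalIntegrable (fun t => f t i * g t i) volume a b) :
    IntervalIntegrable (fun t => f t ⬝ᵥ g t) volume a b := by
  have h1 := IntervalIntegrable.sum Finset.univ fun i _ => h i
  refine h1.congr ?_
  exact fun t _ => by simp [dotProduct]

lemma dotProduct_mulVec_eq_transpose {k l : ℕ} (M : Matrix (Fin k) (Fin l) ℝ) (x : Fin k → ℝ)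
    (y : Fin l → ℝ) : x ⬝ᵥ (M *ᵥ y) = (Mᵀ *ᵥ x) ⬝ᵥ y := by
  rw [Matrix.dotProduct_mulVec, Matrix.mulVec_transpose]

namespace Game

variable {n m : ℕ} {G : Game n m}

lemma triple_add_smul {Ω : Type*} (v v' : ℝ → Ω → Fin m → ℝ) (μ x μ' x' : ℝ → Ω → Fin n → ℝ)
    (ε : ℝ) : G.triple v μ x + ε • G.triple v' μ' x' = G.triple (fun t ω => v t ω + ε • v' t ω)
      (fun t ω => μ t ω + ε • μ' t ω) (fun t ω => x t ω + ε • x' t ω) := by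
  refine Prod.ext rfl (Prod.ext ?_ rfl)
  funext t ω
  simp only [triple, Prod.smul_fst, Prod.smul_snd, Prod.fst_add, Prod.snd_add, Pi.add_apply,
    Pi.smul_apply, Matrix.mulVec_add, Matrix.mulVec_smul, smul_sub]
  abel

lemma exists_sqBd_triple (G : Game n m) : ∃ c : ℝ, 0 ≤ c ∧
    ∀ {Ω : Type*} [MeasurableSpace Ω] {P : Measure Ω} [IsProbabilityMeasure P]
      {v : ℝ → Ω → Fin m → ℝ} {μ x : ℝ → Ω → Fin n → ℝ} {K K' : ℝ},
      L2Bd ((horizon G.T).prod P) (fun p : ℝ × Ω => v p.1 p.2) K →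
      (∀ t ∈ Icc 0 G.T, L2Bd P (x t) K) →
      (∀ᵐ ω ∂P, ContinuousOn (fun t => x t ω) (Icc 0 G.T)) →
      (∀ t ∈ Icc 0 G.T, L2Bd P (μ t) K') →
      (∀ᵐ ω ∂P, ContinuousOn (fun t => μ t ω) (Icc 0 G.T)) →
      G.SqBd P (G.triple v μ x) (c * (K + K')) := by
  have hT := G.T_pos.le
  have hE := ae_horizonEnd_mem hT
  obtain ⟨L, hL, hS⟩ := G.S_bdd.norm_mulVec_le
  set q : ℝ := Real.sqrt ((horizonEnd G.T).real univ) with hq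
  have hq0 : 0 ≤ q := Real.sqrt_nonneg _
  refine ⟨1 + q * (1 + L), by positivity, ?_⟩
  intro Ω _ P _ v μ x K K' hv hx hxc hμ hμc
  have hK := hv.nonneg
  have hK' := (hμ 0 G.zero_mem).nonneg
  have h1 := L2Bd.prod_of_continuousOn hT hE hx hxc
  have h2 := (L2Bd.prod_of_continuousOn hT hE hμ hμc).mulVec hE
    (fun i j => aemeasurable_horizonEnd (G.S_bdd.1 i j)) hL hS
  have e1 : 0 ≤ q * (1 + L) * (K + K') := by positivity
  have e2 : 0 ≤ q * L * K := by positivity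
  have e3 : 0 ≤ q * K' := by positivity
  refine ⟨hv.mono (by nlinarith), (h1.sub h2).mono ?_, h1.mono ?_⟩
  · rw [← hq]; nlinarith
  · rw [← hq]; nlinarith [mul_nonneg (mul_nonneg hq0 hL) hK']

/-! ### The gradient of the cost in the control -/

section Gradient

variable {Ω : Type*} {m' : MeasurableSpace Ω} [mΩ : MeasurableSpace Ω] {P : Measure Ω}
  [IsProbabilityMeasure P]

/-- Integration by parts along a path: the sum of `e T` and the integral of `e` over `[s, T]` has
derivative `-e` and terminal value `e T`, so it moves `e` from the state response onto the control.
-/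
lemma dotProduct_integral_flow (G : Game n m) {e : ℝ → Fin n → ℝ} {w : ℝ → Fin m → ℝ}
    (he : IntervalIntegrable e volume 0 G.T)
    (hw : IntervalIntegrable (fun s => G.B s *ᵥ w s) volume 0 G.T) :
    (∫ t in (0 : ℝ)..G.T, e t ⬝ᵥ ∫ s in (0 : ℝ)..t, G.fund.Ψ s *ᵥ (G.B s *ᵥ w s))
      + e G.T ⬝ᵥ ∫ s in (0 : ℝ)..G.T, G.fund.Ψ s *ᵥ (G.B s *ᵥ w s)
      = ∫ s in (0 : ℝ)..G.T, ((G.B s)ᵀ *ᵥ ((G.fund.Ψ s)ᵀ *ᵥ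
          (e G.T + (∫ t in (0 : ℝ)..G.T, e t) - ∫ t in (0 : ℝ)..s, e t))) ⬝ᵥ w s := by
  have hT := G.T_pos.le
  set f : ℝ → Fin n → ℝ := fun s => G.fund.Ψ s *ᵥ (G.B s *ᵥ w s) with hf
  set k : ℝ → Fin n → ℝ := fun s => e G.T + (∫ t in (0 : ℝ)..G.T, e t) - ∫ t in (0 : ℝ)..s, e t
    with hk
  have hfi : IntervalIntegrable f volume 0 G.T := G.fund.isBddMeas_Ψ.intervalIntegrable_mulVec hT hw
  have hkc : ContinuousOn k (Icc 0 G.T) := by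
    have h3 := intervalIntegral.continuousOn_primitive_interval' he left_mem_uIcc
    rw [uIcc_of_le hT] at h3
    exact continuousOn_const.sub h3
  have hFc : ContinuousOn (fun t => ∫ s in (0 : ℝ)..t, f s) (Icc 0 G.T) := by
    have h3 := intervalIntegral.continuousOn_primitive_interval' hfi left_mem_uIcc
    rwa [uIcc_of_le hT] at h3
  have h1 := dotProduct_eq_integral (f := k) (g := fun t => ∫ s in (0 : ℝ)..t, f s)
    (a := fun s => -e s) (f₀ := k 0) (g₀ := 0) he.neg hfi
    (fun t ht => by simp [hk, intervalIntegral.integral_neg, sub_eq_add_neg])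
    (fun t ht => by simp) G.T G.end_mem
  have hkT : k G.T = e G.T := by simp [hk]
  have i1 : IntervalIntegrable (fun t => e t ⬝ᵥ ∫ s in (0 : ℝ)..t, f s) volume 0 G.T := by
    refine intervalIntegrable_sum_apply fun i => ?_
    refine (intervalIntegrable_apply he i).mul_continuousOn ?_
    rw [uIcc_of_le hT]
    exact (continuous_apply i).comp_continuousOn hFc
  have i2 : IntervalIntegrable (fun t => k t ⬝ᵥ f t) volume 0 G.T := by
    refine intervalIntegrable_sum_apply fun i => ?_
    refine (intervalIntegrable_apply hfi i).continuousOn_mul ?_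
    rw [uIcc_of_le hT]
    exact (continuous_apply i).comp_continuousOn hkc
  have i1n : IntervalIntegrable (fun t => -(e t ⬝ᵥ ∫ s in (0 : ℝ)..t, f s)) volume 0 G.T := i1.neg
  simp only [neg_dotProduct] at h1
  rw [intervalIntegral.integral_add i1n i2, intervalIntegral.integral_neg, hkT,
    dotProduct_zero, zero_add] at h1
  rw [h1, add_neg_cancel_left]
  refine intervalIntegral.integral_congr fun s _ => ?_
  simp only [hf, dotProduct_mulVec_eq_transpose, hk]

/-- `g = R u + Bᵀ p`, where `p = Ψᵀ k` is the pathwise adjoint state: it solves `-p' = Aᵀ p + Q y +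
Qbar (y - S z)` with terminal value `Q y + Qbar (y - S z)` at `T`. It looks into the future, so `g
s` is measurable only for the terminal information; no adapted version is needed, because only its
integrals against controls are used. -/
lemma exists_gradient (G : Game n m) (hm : m' ≤ mΩ) {u : ℝ → Ω → Fin m → ℝ}
    {y : ℝ → Ω → Fin n → ℝ} {z : ℝ → Fin n → ℝ} {K : ℝ}
    (hξ : G.SqBd P (G.triple u (fun t _ => z t) y) K)
    (hum : ∀ᵐ s ∂(horizon G.T), AEStronglyMeasurable[m'] (u s) P)
    (hym : ∀ t ∈ Icc 0 G.T, AEStronglyMeasurable[m'] (y t) P) :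
    ∃ g : ℝ → Ω → Fin m → ℝ, MemLp (fun p : ℝ × Ω => g p.1 p.2) 2 ((horizon G.T).prod P) ∧
      (∀ᵐ s ∂(horizon G.T), AEStronglyMeasurable[m'] (g s) P) ∧
      ∀ w : ℝ → Ω → Fin m → ℝ, MemLp (fun p : ℝ × Ω => w p.1 p.2) 2 ((horizon G.T).prod P) →
        G.form P (G.triple u (fun t _ => z t) y) (G.triple w (fun _ _ => 0) (G.resp w))
          = 1 / 2 * ∫ p, g p.1 p.2 ⬝ᵥ w p.1 p.2 ∂((horizon G.T).prod P) := by
  have hT := G.T_pos.le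
  have hE := ae_horizonEnd_mem hT
  have hH := ae_horizon_mem G.T
  obtain ⟨LQ, hLQ, hQ⟩ := G.Q_bdd.norm_mulVec_le
  obtain ⟨LQb, hLQb, hQb⟩ := G.Qbar_bdd.norm_mulVec_le
  obtain ⟨LR, hLR, hR⟩ := G.R_bdd.norm_mulVec_le
  obtain ⟨LF, hLF, hF⟩ := G.fund.isBddMeas_Φ.transpose.norm_mulVec_le
  obtain ⟨LG, hLG, hG⟩ := G.fund.isBddMeas_Ψ.transpose.norm_mulVec_le
  obtain ⟨LB, hLB, hB⟩ := G.B_bdd.transpose.norm_mulVec_le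
  have hy : L2Bd ((horizonEnd G.T).prod P) (fun q : ℝ × Ω => y q.1 q.2) K := hξ.state
  have hp : L2Bd ((horizonEnd G.T).prod P) (fun q : ℝ × Ω => y q.1 q.2 - G.S q.1 *ᵥ z q.1) K :=
    hξ.deviation
  have hu : L2Bd ((horizon G.T).prod P) (fun q : ℝ × Ω => u q.1 q.2) K := hξ.control
  let e : ℝ → Ω → Fin n → ℝ := fun t ω => (G.fund.Φ t)ᵀ *ᵥ
    (G.Q t *ᵥ y t ω + G.Qbar t *ᵥ (y t ω - G.S t *ᵥ z t))
  have he : MemLp (fun q : ℝ × Ω => e q.1 q.2) 2 ((horizonEnd G.T).prod P) :=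
    (L2Bd.mulVec (f := fun t ω => G.Q t *ᵥ y t ω + G.Qbar t *ᵥ (y t ω - G.S t *ᵥ z t)) hE
      (fun i j => aemeasurable_horizonEnd (G.fund.isBddMeas_Φ.transpose.1 i j)) hLF hF
      ((hy.mulVec hE (fun i j => aemeasurable_horizonEnd (G.Q_bdd.1 i j)) hLQ hQ).add
        (L2Bd.mulVec (f := fun t ω => y t ω - G.S t *ᵥ z t) hE
          (fun i j => aemeasurable_horizonEnd (G.Qbar_bdd.1 i j)) hLQb hQb hp))).memLp
  obtain ⟨heH, heT⟩ := memLp_of_prod_horizonEnd he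
  have hei : ∀ᵐ ω ∂P, IntervalIntegrable (fun t => e t ω) volume 0 G.T := by
    filter_upwards [ae_memLp_section heH] with ω hω using intervalIntegrable_of_memLp hT hω
  -- Terminal value plus the integral over `[s, T]`, written as a difference of primitives to keep
  -- the paths visibly continuous.
  let k : ℝ → Ω → Fin n → ℝ := fun s ω =>
    e G.T ω + (∫ t in (0 : ℝ)..G.T, e t ω) - ∫ t in (0 : ℝ)..s, e t ω
  have hkc : ∀ᵐ ω ∂P, ContinuousOn (fun s => k s ω) (Icc 0 G.T) := by
    filter_upwards [hei] with ω hω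
    have h3 := intervalIntegral.continuousOn_primitive_interval' hω left_mem_uIcc
    rw [uIcc_of_le hT] at h3
    exact continuousOn_const.sub h3
  have hkL : ∀ s ∈ Icc 0 G.T, L2Bd P (k s) _ := fun s hs =>
    ((L2Bd.of_memLp heT).add ((L2Bd.of_memLp heH).primitive G.end_mem)).sub
      ((L2Bd.of_memLp heH).primitive hs)
  have hg2 : L2Bd ((horizon G.T).prod P)
      (fun q : ℝ × Ω => (G.B q.1)ᵀ *ᵥ ((G.fund.Ψ q.1)ᵀ *ᵥ k q.1 q.2)) _ :=
    L2Bd.mulVec (f := fun t ω => (G.fund.Ψ t)ᵀ *ᵥ k t ω) hH G.B_bdd.transpose.1 hLB hB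
      ((L2Bd.prod_of_continuousOn hT hH hkL hkc).mulVec hH G.fund.isBddMeas_Ψ.transpose.1 hLG hG)
  have hg1 := hu.mulVec hH G.R_bdd.1 hLR hR
  refine ⟨fun s ω => G.R s *ᵥ u s ω + (G.B s)ᵀ *ᵥ ((G.fund.Ψ s)ᵀ *ᵥ k s ω),
    (hg1.add hg2).memLp, ?_, fun w hw => ?_⟩
  · have hem : ∀ t ∈ Icc 0 G.T, AEStronglyMeasurable[m'] (e t) P := fun t ht =>
      aestronglyMeasurable_const_mulVec _ ((aestronglyMeasurable_const_mulVec _ (hym t ht)).add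
        (aestronglyMeasurable_const_mulVec _ ((hym t ht).sub
          stronglyMeasurable_const.aestronglyMeasurable)))
    have hpm : ∀ t ∈ Icc 0 G.T,
        AEStronglyMeasurable[m'] (fun ω => ∫ s in (0 : ℝ)..t, e s ω) P := fun t ht =>
      aestronglyMeasurable_primitive hm heH (hH.mono fun s hs => hem s hs) ht
    filter_upwards [hum, hH] with s hs hsT
    exact (aestronglyMeasurable_const_mulVec _ hs).add
      (aestronglyMeasurable_const_mulVec _ (aestronglyMeasurable_const_mulVec _
        (((hem _ G.end_mem).add (hpm _ G.end_mem)).sub (hpm s hsT))))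
  · obtain ⟨c, -, hc⟩ := G.exists_L2Bd_resp
    have hr : MemLp (fun q : ℝ × Ω => G.resp w q.1 q.2) 2 ((horizonEnd G.T).prod P) :=
      (L2Bd.prod_of_continuousOn hT hE (hc (L2Bd.of_memLp hw)) (G.ae_continuousOn_resp hw)).memLp
    let F : ℝ → Ω → Fin n → ℝ := fun t ω => ∫ s in (0 : ℝ)..t, G.fund.Ψ s *ᵥ (G.B s *ᵥ w s ω)
    have i1 := integrable_bil hE G.Q_bdd (fun i j => aemeasurable_horizonEnd (G.Q_bdd.1 i j))
      hy.memLp hr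
    have i2 := integrable_bil (x := fun t ω => y t ω - G.S t *ᵥ z t) hE G.Qbar_bdd
      (fun i j => aemeasurable_horizonEnd (G.Qbar_bdd.1 i j)) hp.memLp hr
    have e12 : (fun q : ℝ × Ω => y q.1 q.2 ⬝ᵥ (G.Q q.1 *ᵥ G.resp w q.1 q.2)
        + (y q.1 q.2 - G.S q.1 *ᵥ z q.1) ⬝ᵥ (G.Qbar q.1 *ᵥ G.resp w q.1 q.2))
        =ᵐ[(horizonEnd G.T).prod P] fun q => e q.1 q.2 ⬝ᵥ F q.1 q.2 := by
      have h1 : ∀ᵐ p ∂((horizonEnd G.T).prod P), p.1 ∈ Icc 0 G.T :=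
        Measure.quasiMeasurePreserving_fst.ae hE
      filter_upwards [h1] with q hq
      rw [dotProduct_mulVec_eq_transpose, dotProduct_mulVec_eq_transpose (G.Qbar q.1),
        transpose_eq_of_posSemidef (G.Q_nonneg _ hq),
        transpose_eq_of_posSemidef (G.Qbar_nonneg _ hq), ← add_dotProduct]
      exact dotProduct_mulVec_eq_transpose _ _ _
    have i12 : Integrable (fun q : ℝ × Ω => e q.1 q.2 ⬝ᵥ F q.1 q.2) ((horizonEnd G.T).prod P) :=
      (i1.add i2).congr e12
    obtain ⟨j1, j2, j3⟩ := integral_prod_horizonEnd (f := fun t ω => e t ω ⬝ᵥ F t ω) i12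
    have g1 := integrable_dotProduct hg1.memLp hw
    have g2 := integrable_dotProduct hg2.memLp hw
    have key : ∫ q, e q.1 q.2 ⬝ᵥ F q.1 q.2 ∂((horizonEnd G.T).prod P)
        = ∫ q, ((G.B q.1)ᵀ *ᵥ ((G.fund.Ψ q.1)ᵀ *ᵥ k q.1 q.2)) ⬝ᵥ w q.1 q.2
          ∂((horizon G.T).prod P) := by
      rw [j3, integral_prod_symm _ j1, ← integral_add j1.integral_prod_right j2,
        integral_prod_symm _ g2]
      refine integral_congr_ae ?_
      filter_upwards [hei, G.ae_intervalIntegrable_control hw] with ω h1 h2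
      have h3 := G.dotProduct_integral_flow h1 h2
      rw [intervalIntegral_eq_horizon hT, intervalIntegral_eq_horizon hT (fun s => _ ⬝ᵥ w s ω)] at h3
      exact h3
    have hb : bil ((horizonEnd G.T).prod P) G.Q y (G.resp w)
        + bil ((horizonEnd G.T).prod P) G.Qbar (fun t ω => y t ω - G.S t *ᵥ z t) (G.resp w)
        = ∫ q, e q.1 q.2 ⬝ᵥ F q.1 q.2 ∂((horizonEnd G.T).prod P) := by
      rw [← integral_congr_ae e12]
      exact (integral_add i1 i2).symm
    have hb3 : bil ((horizon G.T).prod P) G.R u w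
        = ∫ q, (G.R q.1 *ᵥ u q.1 q.2) ⬝ᵥ w q.1 q.2 ∂((horizon G.T).prod P) := by
      refine integral_congr_ae ?_
      have h1 : ∀ᵐ p ∂((horizon G.T).prod P), p.1 ∈ Icc 0 G.T :=
        Measure.quasiMeasurePreserving_fst.ae hH
      filter_upwards [h1] with q hq
      rw [dotProduct_mulVec_eq_transpose, transpose_eq_of_posSemidef (G.R_nonneg _ hq)]
    have hzr : (fun t ω => G.resp w t ω - G.S t *ᵥ (0 : Fin n → ℝ)) = G.resp w := by
      funext t ω; simp
    simp only [form, triple, hzr, hb, hb3, key, add_dotProduct]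
    rw [integral_add g1 g2]
    ring

end Gradient

end Game

/-! ### Optimality among controls with more information -/

/-- First-order condition at a minimum: the discriminant `4 b²` is nonpositive. -/
lemma eq_zero_of_forall_quadratic {b c : ℝ} (h : ∀ ε : ℝ, 0 ≤ 2 * ε * b + ε ^ 2 * c) : b = 0 := by
  have h1 : discrim c (2 * b) 0 ≤ 0 := discrim_le_zero fun ε => by linarith [h ε, sq ε]
  rw [discrim] at h1
  nlinarith [sq_nonneg b]

lemma IsStdWiener.ae_continuous {n : ℕ} {Ω : Type*} [MeasurableSpace Ω] {P : Measure Ω}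
    {W : ℝ≥0 → Ω → Fin n → ℝ} (hW : IsStdWiener P W) :
    ∀ᵐ ω ∂P, Continuous fun t => W t ω := by
  have h : ∀ᵐ ω ∂P, ∀ k, Continuous fun t => W t ω k :=
    ae_all_iff.2 fun k => (hW.brownian k).cont
  filter_upwards [h] with ω hω using continuous_pi hω

section Test

variable {n m : ℕ} {Ω : Type*} [mΩ : MeasurableSpace Ω] {P : Measure Ω} [IsProbabilityMeasure P]
  {T : ℝ}

/-- The test controls are a basis vector times the indicator of `(D ∩ [r, ∞)) × F`. They are adapted
because `F` is known at time `r` and the information grows; varying `D` isolates almost every time.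
-/
lemma ae_setIntegral_eq_zero_of_forall_isAdmissible {H : ℝ → MeasurableSpace Ω}
    (hH : ∀ t, H t ≤ mΩ) (hmono : Monotone H) {g : ℝ → Ω → Fin m → ℝ}
    (hg : MemLp (fun p : ℝ × Ω => g p.1 p.2) 2 ((horizon T).prod P))
    (h : ∀ w, IsAdmissible P T H w → ∫ p, g p.1 p.2 ⬝ᵥ w p.1 p.2 ∂((horizon T).prod P) = 0)
    (k : Fin m) {r : ℝ} {F : Set Ω} (hF : MeasurableSet[H r] F) :
    ∀ᵐ s ∂(horizon T), r ≤ s → ∫ ω in F, g s ω k ∂P = 0 := by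
  have hFm : MeasurableSet F := hH r F hF
  have hgk : Integrable (fun p : ℝ × Ω => g p.1 p.2 k) ((horizon T).prod P) :=
    ((L2Bd.of_memLp hg).apply k).memLp.integrable (by norm_num)
  have hgi : Integrable (fun s => ∫ ω in F, g s ω k ∂P) (horizon T) := by
    have h1 : Integrable (fun p : ℝ × Ω => g p.1 p.2 k) ((horizon T).prod (P.restrict F)) := by
      refine hgk.mono_measure ?_
      exact Measure.prod_mono le_rfl Measure.restrict_le_self
    exact h1.integral_prod_left
  have key : (fun s => (Ici r).indicator (fun s => ∫ ω in F, g s ω k ∂P) s) =ᵐ[horizon T] 0 := by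
    refine Integrable.ae_eq_zero_of_forall_setIntegral_eq_zero
      (hgi.indicator measurableSet_Ici) fun D hD _ => ?_
    rw [setIntegral_indicator measurableSet_Ici,
      ← setIntegral_prod (fun p : ℝ × Ω => g p.1 p.2 k) hgk.integrableOn,
      ← integral_indicator ((hD.inter measurableSet_Ici).prod hFm)]
    have hw := h (fun s ω => ((D ∩ Ici r) ×ˢ F).indicator (fun _ => Pi.single k 1) (s, ω)) ?_
    · rw [← hw]
      refine integral_congr_ae (Eventually.of_forall fun p => ?_)
      by_cases hp : p ∈ (D ∩ Ici r) ×ˢ F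
      · simp [indicator_of_mem hp]
      · simp [indicator_of_notMem hp]
    · refine ⟨?_, Eventually.of_forall fun s => ?_⟩
      · exact (memLp_const (Pi.single k 1 : Fin m → ℝ)).indicator ((hD.inter measurableSet_Ici).prod hFm)
      · by_cases hs : s ∈ D ∩ Ici r
        · have e : (fun ω => ((D ∩ Ici r) ×ˢ F).indicator
              (fun _ => (Pi.single k 1 : Fin m → ℝ)) (s, ω))
              = F.indicator fun _ => Pi.single k 1 := by
            funext ω
            by_cases hω : ω ∈ F
            · rw [indicator_of_mem hω, indicator_of_mem (mk_mem_prod hs hω)]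
            · rw [indicator_of_notMem hω, indicator_of_notMem fun hh => hω hh.2]
          rw [e]
          exact (stronglyMeasurable_const.indicator
            (hmono hs.2 F hF)).aestronglyMeasurable
        · have e : (fun ω => ((D ∩ Ici r) ×ˢ F).indicator
              (fun _ => (Pi.single k 1 : Fin m → ℝ)) (s, ω)) = fun _ => 0 := by
            funext ω
            exact indicator_of_notMem (fun hh => hs hh.1) _
          rw [e]
          exact stronglyMeasurable_const.aestronglyMeasurable
  filter_upwards [key] with s hs hr
  rwa [indicator_of_mem (mem_Ici.2 hr)] at hs

/-- A process that is orthogonal to the controls of one player is orthogonal to the controls with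
the information of all players. -/
theorem integral_dotProduct_eq_zero_of_isRandomData {N : ℕ} {ν : Measure (Fin n → ℝ)}
    {x₀ : Fin N → Ω → Fin n → ℝ} {W : Fin N → ℝ≥0 → Ω → Fin n → ℝ} (hd : IsRandomData P ν x₀ W)
    (i : Fin N) {g : ℝ → Ω → Fin m → ℝ}
    (hg : MemLp (fun p : ℝ × Ω => g p.1 p.2) 2 ((horizon T).prod P))
    (hgm : ∀ᵐ s ∂(horizon T), AEStronglyMeasurable[playerInfo (x₀ i) (W i) T] (g s) P)
    (h : ∀ w, IsAdmissible P T (playerInfo (x₀ i) (W i)) w →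
      ∫ p, g p.1 p.2 ⬝ᵥ w p.1 p.2 ∂((horizon T).prod P) = 0)
    {w : ℝ → Ω → Fin m → ℝ} (hw : IsAdmissible P T (gameInfo x₀ W) w) :
    ∫ p, g p.1 p.2 ⬝ᵥ w p.1 p.2 ∂((horizon T).prod P) = 0 := by
  have hpl : ∀ j t, playerInfo (x₀ j) (W j) t ≤ mΩ := fun j t =>
    playerInfo_le (hd.measurable_init j) (hd.wiener j).measurable t
  have h1 : ∀ᵐ s ∂(horizon T), ∀ k : Fin m, ∀ F, MeasurableSet[playerInfo (x₀ i) (W i) s] F →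
      ∫ ω in F, g s ω k ∂P = 0 := by
    refine ae_all_iff.2 fun k => ?_
    refine ae_setIntegral_eq_zero_of_forall (hd.measurable_init i) (hd.wiener i).measurable
      (hd.wiener i).ae_continuous (g := fun s ω => g s ω k) ?_ fun r _ F hF =>
        ae_setIntegral_eq_zero_of_forall_isAdmissible (hpl i)
          (fun s t hst => playerInfo_mono _ _ hst) hg h k hF
    filter_upwards [ae_memLp_section_left hg] with s hs
    exact ((L2Bd.of_memLp hs).apply k).memLp.integrable (by norm_num)
  rw [integral_prod _ (integrable_dotProduct hg hw.memLp)]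
  refine integral_eq_zero_of_ae ?_
  filter_upwards [h1, hgm, hw.adapted, ae_memLp_section_left hg, ae_memLp_section_left hw.memLp,
    ae_horizon_mem T] with s h2 h3 h4 h5 h6 h7
  simp only [dotProduct, Pi.zero_apply]
  have h5k : ∀ k, MemLp (fun ω => g s ω k) 2 P := fun k => ((L2Bd.of_memLp h5).apply k).memLp
  have h6k : ∀ k, MemLp (fun ω => w s ω k) 2 P := fun k => ((L2Bd.of_memLp h6).apply k).memLp
  have h8 : ∀ k, Integrable (fun ω => g s ω k * w s ω k) P := fun k => (h5k k).integrable_mul (h6k k)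
  rw [integral_finsetSum _ fun k _ => h8 k]
  refine Finset.sum_eq_zero fun k _ => ?_
  refine integral_mul_eq_zero_of_setIntegral (iSup_le fun j => hpl j s) (h5k k) (h6k k)
    (aestronglyMeasurable_apply h4 k) ?_
  -- Here `g s` is only measurable at time `T`, so independence is used between the full-horizon
  -- data of player `i` and of the others, while `g s` is tested on his information at time `s`.
  exact setIntegral_eq_zero_of_indep (hpl i T) (iSup₂_le fun j _ => hpl j T)
    (indep_playerInfo_iSup hd i T) (playerInfo_mono _ _ h7.2) (gameInfo_le_sup x₀ W i h7.2)
    ((h5k k).integrable (by norm_num)) (aestronglyMeasurable_apply h3 k) (h2 k)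

end Test

namespace Game

variable {n m : ℕ} {G : Game n m} {Ω : Type*} [mΩ : MeasurableSpace Ω] {P : Measure Ω}
  [IsProbabilityMeasure P]

lemma exists_sqBd_state (G : Game n m) {ν : Measure (Fin n → ℝ)} (hν : MemLp id 2 ν)
    {z : ℝ → Fin n → ℝ} (hz : ContinuousOn z (Icc 0 G.T)) : ∃ c : ℝ, 0 ≤ c ∧
    ∀ {Ω : Type*} [MeasurableSpace Ω] {P : Measure Ω} [IsProbabilityMeasure P]
      {x₀ : Ω → Fin n → ℝ} {W : ℝ≥0 → Ω → Fin n → ℝ} {v : ℝ → Ω → Fin m → ℝ}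
      {y : ℝ → Ω → Fin n → ℝ} {K : ℝ}, HasLaw x₀ ν P → IsStdWiener P W →
      L2Bd ((horizon G.T).prod P) (fun p : ℝ × Ω => v p.1 p.2) K →
      G.IsState P x₀ W v (fun t _ => z t) y →
      G.SqBd P (G.triple v (fun t _ => z t) y) (c * (1 + K)) := by
  obtain ⟨c, hc, h⟩ := G.exists_L2Bd_state hν hz
  obtain ⟨c', hc', h'⟩ := G.exists_sqBd_triple
  obtain ⟨Z, hZ0, -, hZ⟩ := exists_L2Bd_deterministic G.T_pos.le hz
  refine ⟨c' * (c + 1 + Z), by positivity, ?_⟩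
  intro Ω _ P _ x₀ W v y K hx hW hv hy
  have hK := hv.nonneg
  have h1 : 0 ≤ c * K := by positivity
  have h2 : 0 ≤ Z * K := by positivity
  refine (h' (K := (c + 1) * (1 + K)) (hv.mono (by nlinarith))
    (fun t ht => (h hx hW hv hy t ht).mono (by nlinarith)) hy.continuousOn hZ
    (Eventually.of_forall fun _ => hz)).mono ?_
  rw [mul_assoc]
  exact mul_le_mul_of_nonneg_left (by nlinarith) hc'

lemma exists_sqBd_resp (G : Game n m) : ∃ c : ℝ, 0 ≤ c ∧
    ∀ {Ω : Type*} [MeasurableSpace Ω] {P : Measure Ω} [IsProbabilityMeasure P]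
      {w : ℝ → Ω → Fin m → ℝ} {K : ℝ},
      L2Bd ((horizon G.T).prod P) (fun p : ℝ × Ω => w p.1 p.2) K →
      G.SqBd P (G.triple w (fun _ _ => 0) (G.resp w)) (c * K) := by
  obtain ⟨c, hc, h⟩ := G.exists_L2Bd_resp
  obtain ⟨c', hc', h'⟩ := G.exists_sqBd_triple
  refine ⟨c' * (c + 1), by positivity, ?_⟩
  intro Ω _ P _ w K hw
  have hK := hw.nonneg
  have h0 : ∀ t ∈ Icc 0 G.T, L2Bd P (fun _ : Ω => (0 : Fin n → ℝ)) 0 := fun t _ => by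
    simpa using L2Bd.const (μ := P) (0 : Fin n → ℝ)
  have h1 : 0 ≤ c * K := by positivity
  refine (h' (K := (c + 1) * K) (hw.mono (by nlinarith))
    (fun t ht => (h hw t ht).mono (by nlinarith)) (G.ae_continuousOn_resp hw.memLp) h0
    (Eventually.of_forall fun _ => continuousOn_const)).mono (le_of_eq (by ring))

/-- An equilibrium strategy of the mean field game is optimal even among the controls with the
information of all players. -/
theorem form_le_form_of_optimal {N : ℕ} {ν : Measure (Fin n → ℝ)} (hν : MemLp id 2 ν)
    {x₀ : Fin N → Ω → Fin n → ℝ} {W : Fin N → ℝ≥0 → Ω → Fin n → ℝ} (hd : IsRandomData P ν x₀ W)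
    (i : Fin N) {z : ℝ → Fin n → ℝ} (hz : ContinuousOn z (Icc 0 G.T)) {u : ℝ → Ω → Fin m → ℝ}
    (hu : IsAdmissible P G.T (playerInfo (x₀ i) (W i)) u) {y : ℝ → Ω → Fin n → ℝ}
    (hy : G.IsState P (x₀ i) (W i) u (fun t _ => z t) y)
    (hopt : ∀ (v : ℝ → Ω → Fin m → ℝ) (x : ℝ → Ω → Fin n → ℝ),
      IsAdmissible P G.T (playerInfo (x₀ i) (W i)) v →
      G.IsState P (x₀ i) (W i) v (fun t _ => z t) x →
      G.cost P u (fun t _ => z t) y ≤ G.cost P v (fun t _ => z t) x)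
    {w : ℝ → Ω → Fin m → ℝ} (hw : IsAdmissible P G.T (gameInfo x₀ W) w) :
    G.form P (G.triple u (fun t _ => z t) y) (G.triple u (fun t _ => z t) y)
      ≤ G.form P (G.triple u (fun t _ => z t) y + G.triple w (fun _ _ => 0) (G.resp w))
        (G.triple u (fun t _ => z t) y + G.triple w (fun _ _ => 0) (G.resp w)) := by
  obtain ⟨c, hc, hst⟩ := G.exists_sqBd_state hν hz
  obtain ⟨c', hc', hrs⟩ := G.exists_sqBd_resp
  have hpl : playerInfo (x₀ i) (W i) G.T ≤ mΩ :=
    playerInfo_le (hd.measurable_init i) (hd.wiener i).measurable _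
  have hξ := hst (hd.law_init i) (hd.wiener i) (L2Bd.of_memLp hu.memLp) hy
  have hum : ∀ᵐ s ∂(horizon G.T), AEStronglyMeasurable[playerInfo (x₀ i) (W i) G.T] (u s) P := by
    filter_upwards [hu.adapted, ae_horizon_mem G.T] with s hs hsT
    exact hs.mono (playerInfo_mono _ _ hsT.2)
  obtain ⟨g, hg, hgm, hgw⟩ := G.exists_gradient hpl hξ hum fun t ht =>
    hy.aestronglyMeasurable_info hz hpl (hd.wiener i) hu.memLp hum le_rfl
      (L2Bd_of_hasLaw hν (hd.law_init i)).memLp ht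
  -- Perturbing `u` by `ε w` keeps it admissible for player `i`, so the cost, quadratic in `ε`, is
  -- minimal at `ε = 0`.
  have hown : ∀ w, IsAdmissible P G.T (playerInfo (x₀ i) (W i)) w →
      ∫ p, g p.1 p.2 ⬝ᵥ w p.1 p.2 ∂((horizon G.T).prod P) = 0 := by
    intro w hw
    have hη := hrs (L2Bd.of_memLp hw.memLp)
    have h0 : G.form P (G.triple u (fun t _ => z t) y) (G.triple w (fun _ _ => 0) (G.resp w))
        = 0 := by
      refine eq_zero_of_forall_quadratic (c := G.form P (G.triple w (fun _ _ => 0) (G.resp w))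
        (G.triple w (fun _ _ => 0) (G.resp w))) fun ε => ?_
      have hεw : MemLp (fun p : ℝ × Ω => ε • w p.1 p.2) 2 ((horizon G.T).prod P) :=
        hw.memLp.const_smul ε
      have hx := hy.add_resp (w := fun t ω => ε • w t ω) hεw
      simp only [resp_smul] at hx
      have hv : IsAdmissible P G.T (playerInfo (x₀ i) (W i)) fun t ω => u t ω + ε • w t ω := by
        refine ⟨hu.memLp.add hεw, ?_⟩
        filter_upwards [hu.adapted, hw.adapted] with s h1 h2 using h1.add (h2.const_smul ε)
      have h1 := hopt _ _ hv hx
      have h2 := hst (hd.law_init i) (hd.wiener i) (L2Bd.of_memLp hv.memLp) hx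
      rw [cost_eq_form hξ, cost_eq_form h2] at h1
      have h3 := triple_add_smul (G := G) u w (fun t _ => z t) y (fun _ _ => 0) (G.resp w) ε
      simp only [smul_zero, add_zero] at h3
      rw [← h3, form_add_smul hξ hη] at h1
      linarith
    rw [hgw w hw.memLp] at h0
    linarith
  -- With the first variation zero also for fully informed `w`, the excess cost is the second
  -- variation, a nonnegative value of the form.
  have hzero := integral_dotProduct_eq_zero_of_isRandomData hd i hg hgm hown hw
  have hη := hrs (L2Bd.of_memLp hw.memLp)
  have h1 := form_add_smul hξ hη 1
  rw [one_smul, hgw w hw.memLp, hzero] at h1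
  rw [h1]
  have := form_self_nonneg (G := G) (P := P) (G.triple w (fun _ _ => 0) (G.resp w))
  linarith

end Game

/-! ### Comparison of the game with the mean field game -/

/-- Summing over `j` closes the system: each `f k` is counted `N - 1` times with weight `1/(N - 1)`,
so the sum obeys Grönwall with rate `2L`, whatever `N` is. The bound for the sum is then inserted
into the single inequalities, where it appears divided by `N - 1`. -/
lemma exists_coupled_gronwall {T L : ℝ} (hT : 0 ≤ T) (hL : 0 ≤ L) : ∃ c : ℝ, 0 ≤ c ∧
    ∀ {N : ℕ}, 2 ≤ N → ∀ f r : Fin N → ℝ → ℝ, (∀ j, ContinuousOn (f j) (Icc 0 T)) →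
      (∀ j, ContinuousOn (r j) (Icc 0 T)) → (∀ j t, 0 ≤ f j t) → (∀ j t, 0 ≤ r j t) →
      (∀ j, ∀ t ∈ Icc 0 T, f j t ≤ ∫ s in (0 : ℝ)..t,
        L * (f j s + ((N : ℝ) - 1)⁻¹ * ∑ k ∈ Finset.univ.erase j, f k s + r j s)) →
      ∀ j, ∀ t ∈ Icc 0 T, f j t ≤ c * ((∫ s in (0 : ℝ)..T, r j s)
        + ((N : ℝ) - 1)⁻¹ * ∑ k, ∫ s in (0 : ℝ)..T, r k s) := by
  refine ⟨(L + L * T * (L * Real.exp (2 * L * T))) * Real.exp (L * T), by positivity, ?_⟩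
  intro N hN f r hf hr hf0 hr0 h j t ht
  have hN1 : (0 : ℝ) < (N : ℝ) - 1 := by
    have : (2 : ℝ) ≤ N := by exact_mod_cast hN
    linarith
  set q : ℝ := ((N : ℝ) - 1)⁻¹ with hq
  have hq0 : 0 < q := inv_pos.2 hN1
  set α : Fin N → ℝ := fun k => ∫ s in (0 : ℝ)..T, r k s with hα
  have hα0 : ∀ k, 0 ≤ α k := fun k => intervalIntegral.integral_nonneg hT fun s _ => hr0 k s
  have ii : ∀ {g : ℝ → ℝ}, ContinuousOn g (Icc 0 T) → ∀ {t}, t ∈ Icc 0 T →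
      IntervalIntegrable g volume 0 t := fun hg t ht =>
    (hg.mono (by rw [uIcc_of_le ht.1]; exact Icc_subset_Icc_right ht.2)).intervalIntegrable
  have hrα : ∀ k, ∀ t ∈ Icc 0 T, ∫ s in (0 : ℝ)..t, r k s ≤ α k := fun k t ht =>
    intervalIntegral.integral_mono_interval le_rfl ht.1 ht.2
      (Eventually.of_forall (hr0 k)) (ii (hr k) (right_mem_Icc.2 hT))
  set E : ℝ → ℝ := fun s => ∑ k, f k s with hE
  have hEc : ContinuousOn E (Icc 0 T) := continuousOn_finsetSum _ fun k _ => hf k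
  have hE0 : ∀ s, 0 ≤ E s := fun s => Finset.sum_nonneg fun k _ => hf0 k s
  have hsum : ∀ s, ∑ j, ∑ k ∈ Finset.univ.erase j, f k s = ((N : ℝ) - 1) * E s := by
    intro s
    have h1 : ∀ j, ∑ k ∈ Finset.univ.erase j, f k s = E s - f j s := fun j => by
      rw [eq_sub_iff_add_eq]; exact Finset.sum_erase_add _ _ (Finset.mem_univ j)
    simp only [h1, Finset.sum_sub_distrib, Finset.sum_const, Finset.card_univ, Fintype.card_fin,
      nsmul_eq_mul]
    simp only [hE]
    ring
  have hc : ∀ j, ContinuousOn (fun s => L * (f j s + q * ∑ k ∈ Finset.univ.erase j, f k s + r j s))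
      (Icc 0 T) := fun j => continuousOn_const.mul (((hf j).add (continuousOn_const.mul
        (continuousOn_finsetSum _ fun k _ => hf k))).add (hr j))
  have hEb : ∀ t ∈ Icc 0 T, E t ≤ L * (∑ k, α k) * Real.exp (2 * L * t) := by
    refine le_mul_exp_of_le_add_integral hEc (by positivity) fun t ht => ?_
    calc E t ≤ ∑ j, ∫ s in (0 : ℝ)..t,
          L * (f j s + q * ∑ k ∈ Finset.univ.erase j, f k s + r j s) :=
          Finset.sum_le_sum fun j _ => h j t ht
      _ = ∫ s in (0 : ℝ)..t, (2 * L * E s + L * ∑ k, r k s) := by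
          rw [← intervalIntegral.integral_finsetSum fun j _ => ii (hc j) ht]
          refine intervalIntegral.integral_congr fun s _ => ?_
          simp only [← Finset.mul_sum, Finset.sum_add_distrib, hsum]
          rw [← mul_assoc q, hq, inv_mul_cancel₀ hN1.ne']
          simp only [hE]
          ring
      _ = 2 * L * (∫ s in (0 : ℝ)..t, E s) + L * ∑ k, ∫ s in (0 : ℝ)..t, r k s := by
          have i1 := (ii hEc ht).const_mul (2 * L)
          have i2 : IntervalIntegrable (fun s => L * ∑ k, r k s) volume 0 t :=
            ii (continuousOn_const.mul (continuousOn_finsetSum _ fun k _ => hr k)) ht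
          rw [intervalIntegral.integral_add i1 i2, intervalIntegral.integral_const_mul,
            intervalIntegral.integral_const_mul,
            intervalIntegral.integral_finsetSum fun j _ => ii (hr j) ht]
      _ ≤ L * (∑ k, α k) + 2 * L * ∫ s in (0 : ℝ)..t, E s := by
          rw [add_comm]
          gcongr with k
          exact hrα k t ht
  set M : ℝ := L * (∑ k, α k) * Real.exp (2 * L * T) with hM
  have hM0 : 0 ≤ M := by
    have : 0 ≤ ∑ k, α k := Finset.sum_nonneg fun k _ => hα0 k
    positivity
  have hEM : ∀ t ∈ Icc 0 T, E t ≤ M := fun t ht => (hEb t ht).trans (by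
    have : 0 ≤ ∑ k, α k := Finset.sum_nonneg fun k _ => hα0 k
    rw [hM]
    gcongr
    exact ht.2)
  have hfin : ∀ t ∈ Icc 0 T, f j t ≤ (L * α j + L * T * (q * M)) * Real.exp (L * t) := by
    refine le_mul_exp_of_le_add_integral (hf j) hL fun t ht => ?_
    calc f j t ≤ ∫ s in (0 : ℝ)..t,
          L * (f j s + q * ∑ k ∈ Finset.univ.erase j, f k s + r j s) := h j t ht
      _ ≤ ∫ s in (0 : ℝ)..t, (L * f j s + L * (q * M) + L * r j s) := by
          refine intervalIntegral.integral_mono_on ht.1 (ii (hc j) ht) (ii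
            (((continuousOn_const.mul (hf j)).add continuousOn_const).add
              (continuousOn_const.mul (hr j))) ht) fun s hs => ?_
          have h1 : ∑ k ∈ Finset.univ.erase j, f k s ≤ M :=
            (Finset.sum_le_sum_of_subset_of_nonneg (Finset.subset_univ _)
              fun k _ _ => hf0 k s).trans (hEM s ⟨hs.1, hs.2.trans ht.2⟩)
          have h2 : L * (q * ∑ k ∈ Finset.univ.erase j, f k s) ≤ L * (q * M) := by gcongr
          linarith
      _ = L * (∫ s in (0 : ℝ)..t, f j s) + L * t * (q * M) + L * ∫ s in (0 : ℝ)..t, r j s := by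
          have i1 := (ii (hf j) ht).const_mul L
          have i2 := (ii (hr j) ht).const_mul L
          have i3 : IntervalIntegrable (fun _ : ℝ => L * (q * M)) volume 0 t :=
            intervalIntegrable_const
          rw [intervalIntegral.integral_add (i1.add i3) i2, intervalIntegral.integral_add i1 i3,
            intervalIntegral.integral_const]
          simp only [intervalIntegral.integral_const_mul, sub_zero, smul_eq_mul]
          ring
      _ ≤ L * α j + L * T * (q * M) + L * ∫ s in (0 : ℝ)..t, f j s := by
          have h1 := mul_le_mul_of_nonneg_left (hrα j t ht) hL
          have h2 : L * t * (q * M) ≤ L * T * (q * M) := by gcongr; exact ht.2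
          linarith
  have hsα : 0 ≤ ∑ k, α k := Finset.sum_nonneg fun k _ => hα0 k
  have hαj := hα0 j
  calc f j t ≤ (L * α j + L * T * (q * M)) * Real.exp (L * t) := hfin t ht
    _ ≤ (L * α j + L * T * (q * M)) * Real.exp (L * T) := by gcongr; exact ht.2
    _ ≤ (L + L * T * (L * Real.exp (2 * L * T))) * (α j + q * ∑ k, α k) * Real.exp (L * T) := by
        gcongr
        have h1 : 0 ≤ L * (q * ∑ k, α k) := by positivity
        have h2 : 0 ≤ L * T * (L * Real.exp (2 * L * T)) * α j := by positivity
        rw [hM]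
        nlinarith
    _ = _ := by ring

lemma L2Bd.othersMean {n N : ℕ} (hN : 2 ≤ N) {Ω : Type*} [MeasurableSpace Ω] {P : Measure Ω}
    {e : Fin N → ℝ → Ω → Fin n → ℝ} {t ε : ℝ} (h : ∀ k, L2Bd P (e k t) ε) (j : Fin N) :
    L2Bd P (Game.othersMean e j t) ε := by
  have hN1 : (0 : ℝ) < (N : ℝ) - 1 := by
    have : (2 : ℝ) ≤ N := by exact_mod_cast hN
    linarith
  have h1 := L2Bd.finsetSum (Finset.univ.erase j) fun k _ => h k
  refine (h1.of_norm_le (g := Game.othersMean e j t) (inv_pos.2 hN1).le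
    (h1.aesm.const_smul (((N : ℝ) - 1)⁻¹)) (Eventually.of_forall fun ω => ?_)).mono (le_of_eq ?_)
  · rw [Game.othersMean, norm_smul, Real.norm_of_nonneg (inv_pos.2 hN1).le]
  · rw [Finset.sum_const, Finset.card_erase_of_mem (Finset.mem_univ _), Finset.card_univ,
      Fintype.card_fin, nsmul_eq_mul, Nat.cast_sub (by omega), Nat.cast_one, ← mul_assoc,
      inv_mul_cancel₀ hN1.ne', one_mul]

namespace Game

variable {n m : ℕ} {G : Game n m}

lemma othersMean_sub {N : ℕ} {Ω : Type*} (X b : Fin N → ℝ → Ω → Fin n → ℝ) (j : Fin N) (t : ℝ)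
    (ω : Ω) : othersMean X j t ω - othersMean b j t ω
      = othersMean (fun k t ω => X k t ω - b k t ω) j t ω := by
  simp only [othersMean, Finset.sum_sub_distrib, smul_sub]

lemma norm_othersMean_le {N : ℕ} (hN : 2 ≤ N) {Ω : Type*} (e : Fin N → ℝ → Ω → Fin n → ℝ)
    (j : Fin N) (t : ℝ) (ω : Ω) :
    ‖othersMean e j t ω‖ ≤ ((N : ℝ) - 1)⁻¹ * ∑ k ∈ Finset.univ.erase j, ‖e k t ω‖ := by
  have hN1 : (0 : ℝ) < (N : ℝ) - 1 := by
    have : (2 : ℝ) ≤ N := by exact_mod_cast hN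
    linarith
  rw [othersMean, norm_smul, Real.norm_of_nonneg (inv_pos.2 hN1).le]
  gcongr
  exact norm_sum_le _ _

lemma continuousOn_othersMean {N : ℕ} {Ω : Type*} {e : Fin N → ℝ → Ω → Fin n → ℝ} {ω : Ω}
    {s : Set ℝ} (h : ∀ k, ContinuousOn (fun t => e k t ω) s) (j : Fin N) :
    ContinuousOn (fun t => othersMean e j t ω) s := by
  have h1 : ContinuousOn (fun t => ∑ k ∈ Finset.univ.erase j, e k t ω) s :=
    continuousOn_finsetSum _ fun k _ => h k
  exact h1.const_smul (((N : ℝ) - 1)⁻¹)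

/-- The states in the game are close to states of decoupled dynamics with the same controls if
the averages of the latter are close to the mean field. -/
theorem exists_L2Bd_sub_decoupled (G : Game n m) {z : ℝ → Fin n → ℝ}
    (hz : ContinuousOn z (Icc 0 G.T)) : ∃ c : ℝ, 0 ≤ c ∧
    ∀ {Ω : Type*} [MeasurableSpace Ω] {P : Measure Ω} [IsProbabilityMeasure P] {N : ℕ},
      2 ≤ N → ∀ {x₀ : Fin N → Ω → Fin n → ℝ} {W : Fin N → ℝ≥0 → Ω → Fin n → ℝ}
      {w : Fin N → ℝ → Ω → Fin m → ℝ} {X b : Fin N → ℝ → Ω → Fin n → ℝ} {ε : ℝ},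
      (∀ j, IsStdWiener P (W j)) → G.IsGameState P x₀ W w X →
      (∀ j, G.IsState P (x₀ j) (W j) (w j) (fun t _ => z t) (b j)) → 0 ≤ ε →
      (∀ j, ∀ t ∈ Icc 0 G.T, L2Bd P (fun ω => othersMean b j t ω - z t) ε) →
      ∀ j, ∀ t ∈ Icc 0 G.T, L2Bd P (fun ω => X j t ω - b j t ω) (c * ε) := by
  have hT := G.T_pos.le
  obtain ⟨L1, hL1, hA⟩ := G.A_bdd.norm_mulVec_le
  obtain ⟨L2, hL2, hC⟩ := G.Abar_bdd.norm_mulVec_le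
  obtain ⟨c, hc, hgr⟩ := exists_coupled_gronwall hT (add_nonneg hL1 hL2)
  refine ⟨c * (3 * (horizon G.T).real univ), by positivity, ?_⟩
  intro Ω _ P _ N hN x₀ W w X b ε hW hX hb hε hρ j t ht
  have hN1 : (1 : ℝ) ≤ (N : ℝ) - 1 := by
    have : (2 : ℝ) ≤ N := by exact_mod_cast hN
    linarith
  set q : ℝ := ((N : ℝ) - 1)⁻¹ with hq
  have hq0 : 0 < q := inv_pos.2 (by linarith)
  set τ : ℝ := (horizon G.T).real univ with hτ
  have hτ0 : 0 ≤ τ := measureReal_nonneg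
  let ρ : Fin N → ℝ → Ω → Fin n → ℝ := fun j t ω => othersMean b j t ω - z t
  have hρc : ∀ᵐ ω ∂P, ∀ j, ContinuousOn (fun t => ρ j t ω) (Icc 0 G.T) := by
    filter_upwards [ae_all_iff.2 fun j => (hb j).continuousOn] with ω hω j
    exact (continuousOn_othersMean hω j).sub hz
  -- The comparison is made path by path before taking norms, since no square integrability of the
  -- game states is known yet.
  have hpath : ∀ᵐ ω ∂P, ∀ j, ∀ t ∈ Icc 0 G.T, ‖X j t ω - b j t ω‖ ≤
      c * ((∫ s in (0 : ℝ)..G.T, ‖ρ j s ω‖) + q * ∑ k, ∫ s in (0 : ℝ)..G.T, ‖ρ k s ω‖) := by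
    have hdiff : ∀ᵐ ω ∂P, ∀ j, ∀ t ∈ Icc 0 G.T, X j t ω - b j t ω = ∫ s in (0 : ℝ)..t,
        (G.A s *ᵥ (X j s ω - b j s ω) + G.Abar s *ᵥ (othersMean X j s ω - z s)) := by
      refine ae_all_iff.2 fun j => ?_
      obtain ⟨I, hI, hXI⟩ := (hX j).eq
      obtain ⟨I', hI', hbI⟩ := (hb j).eq
      filter_upwards [hXI, hbI, (hX j).integrable_drift, (hb j).integrable_drift,
        IsWienerIntegral.ae_forall_eq G.T_pos (hW j) G.σ_sq hI hI'] with ω h1 h2 h3 h4 h5 t ht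
      -- The two Wiener integrals agree by uniqueness, so noise and initial values cancel and only
      -- the drifts remain.
      rw [h1 t ht, h2 t ht, h5 t ht, add_sub_add_right_eq_sub, add_sub_add_left_eq_sub,
        ← intervalIntegral.integral_sub (h3.mono_set (G.uIcc_subset ht))
          (h4.mono_set (G.uIcc_subset ht))]
      refine intervalIntegral.integral_congr fun s _ => ?_
      simp only [Matrix.mulVec_sub]
      abel
    filter_upwards [hdiff, hρc, ae_all_iff.2 fun j => (hX j).continuousOn,
      ae_all_iff.2 fun j => (hb j).continuousOn] with ω h1 h2 h3 h4
    refine hgr hN (fun j t => ‖X j t ω - b j t ω‖) (fun j t => ‖ρ j t ω‖)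
      (fun j => ((h3 j).sub (h4 j)).norm) (fun j => (h2 j).norm) (fun _ _ => norm_nonneg _)
      (fun _ _ => norm_nonneg _) fun j t ht => ?_
    simp only [h1 j t ht]
    have hcont : ContinuousOn (fun s => (L1 + L2) * (‖X j s ω - b j s ω‖
        + q * ∑ k ∈ Finset.univ.erase j, ‖X k s ω - b k s ω‖ + ‖ρ j s ω‖)) (Icc 0 G.T) :=
      continuousOn_const.mul ((((h3 j).sub (h4 j)).norm.add (continuousOn_const.mul
        (continuousOn_finsetSum _ fun k _ => ((h3 k).sub (h4 k)).norm))).add (h2 j).norm)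
    have hle : ∀ s ∈ Icc 0 G.T, ‖G.A s *ᵥ (X j s ω - b j s ω)
        + G.Abar s *ᵥ (othersMean X j s ω - z s)‖ ≤ (L1 + L2) * (‖X j s ω - b j s ω‖
        + q * ∑ k ∈ Finset.univ.erase j, ‖X k s ω - b k s ω‖ + ‖ρ j s ω‖) := by
      intro s hs
      have e1 : othersMean X j s ω - z s
          = othersMean (fun k t ω => X k t ω - b k t ω) j s ω + ρ j s ω := by
        rw [← othersMean_sub]; simp [ρ]
      have e2 := norm_othersMean_le hN (fun k t ω => X k t ω - b k t ω) j s ω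
      have e3 : ‖othersMean X j s ω - z s‖
          ≤ q * ∑ k ∈ Finset.univ.erase j, ‖X k s ω - b k s ω‖ + ‖ρ j s ω‖ := by
        rw [e1]; exact (norm_add_le _ _).trans (by gcongr)
      have e4 := hA s hs (X j s ω - b j s ω)
      have e5 := (hC s hs (othersMean X j s ω - z s)).trans (mul_le_mul_of_nonneg_left e3 hL2)
      have e6 : 0 ≤ q * ∑ k ∈ Finset.univ.erase j, ‖X k s ω - b k s ω‖ + ‖ρ j s ω‖ := by positivity
      have e7 : 0 ≤ L2 * ‖X j s ω - b j s ω‖ := by positivity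
      have e8 := mul_nonneg hL1 e6
      refine (norm_add_le _ _).trans ((add_le_add e4 e5).trans ?_)
      nlinarith
    have hn := intervalIntegral.norm_integral_le_of_norm_le (μ := volume) ht.1
      (Eventually.of_forall fun s hs => hle s ⟨hs.1.le, hs.2.trans ht.2⟩)
      (hcont.mono (by rw [uIcc_of_le ht.1]; exact Icc_subset_Icc_right ht.2)).intervalIntegrable
    exact hn
  have hα : ∀ k, L2Bd P (fun ω => ∫ s in (0 : ℝ)..G.T, ‖ρ k s ω‖) (τ * ε) := by
    intro k
    simp only [intervalIntegral_eq_horizon hT]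
    refine L2Bd.integral_norm_le hε ?_ ((ae_horizon_mem _).mono fun t ht => hρ k t ht)
    exact aestronglyMeasurable_prod_of_continuousOn hT (fun t ht => (hρ k t ht).aesm)
      (hρc.mono fun ω h => h k) (ae_horizon_mem _)
  have hS := (L2Bd.finsetSum Finset.univ fun k _ => hα k).const_mul q
  refine ((((hα j).add hS).const_mul c).of_le (((hX j).aestronglyMeasurable t ht).sub
    ((hb j).aestronglyMeasurable t ht)) (hpath.mono fun ω h => h j t ht)).mono ?_
  rw [Finset.sum_const, Finset.card_univ, Fintype.card_fin, nsmul_eq_mul, abs_of_nonneg hc,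
    abs_of_nonneg hq0.le]
  -- `N/(N - 1) ≤ 2`, which with the player's own term gives the factor `3` in the constant.
  have hqN : q * N ≤ 2 := by
    rw [hq, inv_mul_le_iff₀ (by linarith)]
    linarith
  have h1 : q * N * (τ * ε) ≤ 2 * (τ * ε) := mul_le_mul_of_nonneg_right hqN (by positivity)
  have h2 : τ * ε + q * (N * (τ * ε)) ≤ 3 * τ * ε := by linarith
  calc c * (τ * ε + q * (N * (τ * ε))) ≤ c * (3 * τ * ε) := by gcongr
    _ = c * (3 * τ) * ε := by ring

end Game

/-! ### The law of large numbers for the mean field trajectories -/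

section LawOfLargeNumbers

variable {Ω : Type*} [mΩ : MeasurableSpace Ω] {P : Measure Ω} [IsProbabilityMeasure P]

/-- The centred second moment is the variance, which is additive under pairwise independence. Equal
laws are not needed: equal means and a common second-moment bound suffice. -/
lemma L2Bd_average_sub {ι : Type*} {s : Finset ι} (hs : s.Nonempty) {Y : ι → Ω → ℝ} {K a : ℝ}
    (hY : ∀ k, L2Bd P (Y k) K) (hmean : ∀ k, ∫ ω, Y k ω ∂P = a)
    (hind : ∀ k l, k ≠ l → IndepFun (Y k) (Y l) P) :
    L2Bd P (fun ω => (s.card : ℝ)⁻¹ * ∑ k ∈ s, Y k ω - a) (K / Real.sqrt s.card) := by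
  have hc : (0 : ℝ) < s.card := by exact_mod_cast hs.card_pos
  have hK : 0 ≤ K := (hY hs.choose).nonneg
  have hS : MemLp (fun ω => ∑ k ∈ s, Y k ω) 2 P := (L2Bd.finsetSum s fun k _ => hY k).memLp
  have hcS : MemLp (fun ω => (s.card : ℝ)⁻¹ * ∑ k ∈ s, Y k ω) 2 P := hS.const_mul _
  have hE : ∫ ω, (s.card : ℝ)⁻¹ * ∑ k ∈ s, Y k ω ∂P = a := by
    rw [integral_const_mul, integral_finsetSum _ fun k _ => (hY k).memLp.integrable (by norm_num)]
    simp only [hmean, Finset.sum_const, nsmul_eq_mul]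
    rw [inv_mul_cancel_left₀ hc.ne']
  have hvar := variance_eq_integral (μ := P) hcS.1.aemeasurable
  rw [hE, variance_const_mul] at hvar
  have hsum : variance (fun ω => ∑ k ∈ s, Y k ω) P = ∑ k ∈ s, variance (Y k) P := by
    rw [← IndepFun.variance_sum (fun k _ => (hY k).memLp) fun k _ l _ hkl => hind k l hkl]
    congr 1
    ext ω
    simp
  refine L2Bd.of_integral_sq_le (hcS.sub (memLp_const a)) (by positivity) ?_
  simp only [Real.norm_eq_abs, sq_abs]
  rw [← hvar, hsum, div_pow, Real.sq_sqrt hc.le]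
  calc ((s.card : ℝ)⁻¹) ^ 2 * ∑ k ∈ s, variance (Y k) P
      ≤ ((s.card : ℝ)⁻¹) ^ 2 * ∑ _k ∈ s, K ^ 2 := by
        gcongr with k
        refine (variance_le_expectation_sq (hY k).aesm).trans (le_trans (le_of_eq ?_)
          (hY k).integral_sq_le)
        exact integral_congr_ae (Eventually.of_forall fun ω => by simp)
    _ = K ^ 2 / s.card := by
        rw [Finset.sum_const, nsmul_eq_mul]
        field_simp

omit [IsProbabilityMeasure P] in
lemma indepFun_of_playerInfo {n N : ℕ} {ν : Measure (Fin n → ℝ)} {x₀ : Fin N → Ω → Fin n → ℝ}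
    {W : Fin N → ℝ≥0 → Ω → Fin n → ℝ} (hd : IsRandomData P ν x₀ W) {k l : Fin N} (hkl : k ≠ l)
    {T : ℝ} {f g : Ω → ℝ} (hf : AEStronglyMeasurable[playerInfo (x₀ k) (W k) T] f P)
    (hg : AEStronglyMeasurable[playerInfo (x₀ l) (W l) T] g P) : IndepFun f g P := by
  obtain ⟨f', hf', hff⟩ := hf
  obtain ⟨g', hg', hgg⟩ := hg
  refine IndepFun.congr ?_ hff.symm hgg.symm
  rw [IndepFun_iff_Indep]
  refine indep_of_indep_of_le_left (indep_of_indep_of_le_right (indep_playerInfo_iSup hd k T) ?_)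
    (measurable_iff_comap_le.1 hf'.measurable)
  exact (measurable_iff_comap_le.1 hg'.measurable).trans
    (le_iSup₂_of_le (f := fun j (_ : j ≠ k) => playerInfo (x₀ j) (W j) T) l hkl.symm le_rfl)

lemma sqrt_le_two_mul_sqrt_sub_one {N : ℕ} (hN : 2 ≤ N) :
    Real.sqrt N ≤ 2 * Real.sqrt ((N : ℝ) - 1) := by
  have h2 : (2 : ℝ) ≤ N := by exact_mod_cast hN
  rw [Real.sqrt_le_left (by positivity), mul_pow, Real.sq_sqrt (by linarith)]
  linarith

/-- The average runs over `N - 1` players; the factor `2` pays for replacing `√(N - 1)` by `√N`, and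
the factor `n` for passing from coordinates to vectors. -/
lemma L2Bd_othersMean_sub {n N : ℕ} (hN : 2 ≤ N) {ν : Measure (Fin n → ℝ)}
    {x₀ : Fin N → Ω → Fin n → ℝ} {W : Fin N → ℝ≥0 → Ω → Fin n → ℝ} (hd : IsRandomData P ν x₀ W)
    {T t K : ℝ} {y : Fin N → ℝ → Ω → Fin n → ℝ} {a : Fin n → ℝ} (hK : ∀ k, L2Bd P (y k t) K)
    (hym : ∀ k, AEStronglyMeasurable[playerInfo (x₀ k) (W k) T] (y k t) P)
    (hmean : ∀ k, ∫ ω, y k t ω ∂P = a) (j : Fin N) :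
    L2Bd P (fun ω => Game.othersMean y j t ω - a) (n * (2 * K / Real.sqrt N)) := by
  have h2 : (2 : ℝ) ≤ N := by exact_mod_cast hN
  have hK0 := (hK j).nonneg
  have hcard : ((Finset.univ.erase j).card : ℝ) = (N : ℝ) - 1 := by
    rw [Finset.card_erase_of_mem (Finset.mem_univ _), Finset.card_univ, Fintype.card_fin,
      Nat.cast_sub (by omega), Nat.cast_one]
  have hne : (Finset.univ.erase j).Nonempty := by
    rw [← Finset.card_pos]
    have : (0 : ℝ) < ((Finset.univ.erase j).card : ℝ) := by rw [hcard]; linarith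
    exact_mod_cast this
  refine L2Bd.of_apply (by positivity) fun i => ?_
  have h := L2Bd_average_sub hne (Y := fun k ω => y k t ω i) (a := a i) (fun k => (hK k).apply i)
    (fun k => by
      rw [← hmean k]
      exact (ContinuousLinearMap.proj (R := ℝ) (φ := fun _ : Fin n => ℝ) i).integral_comp_comm
        ((hK k).memLp.integrable (by norm_num)))
    fun k l hkl => indepFun_of_playerInfo hd hkl (aestronglyMeasurable_apply (hym k) i)
      (aestronglyMeasurable_apply (hym l) i)
  rw [hcard] at h
  refine (h.mono ?_).congr (Eventually.of_forall fun ω => ?_)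
  · have h1 : 0 < Real.sqrt ((N : ℝ) - 1) := Real.sqrt_pos.2 (by linarith)
    rw [div_le_div_iff₀ h1 (Real.sqrt_pos.2 (by linarith))]
    nlinarith [sqrt_le_two_mul_sqrt_sub_one hN]
  · simp [Game.othersMean, Finset.sum_apply]

end LawOfLargeNumbers

/-! ### Bounds for equilibria and deviations, uniform in the number of players -/

namespace Game

variable {n m : ℕ} {G : Game n m} {Ω : Type*} [mΩ : MeasurableSpace Ω] {P : Measure Ω}
  [IsProbabilityMeasure P]

omit mΩ in
lemma triple_add (v v' : ℝ → Ω → Fin m → ℝ) (μ x μ' x' : ℝ → Ω → Fin n → ℝ) :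
    G.triple v μ x + G.triple v' μ' x' = G.triple (fun t ω => v t ω + v' t ω)
      (fun t ω => μ t ω + μ' t ω) (fun t ω => x t ω + x' t ω) := by
  simpa only [one_smul] using triple_add_smul (G := G) v v' μ x μ' x' 1

lemma abs_sqrt_form_sub_le {ξ η : Triple n m Ω} {K K' : ℝ} (hξ : G.SqBd P ξ K)
    (hη : G.SqBd P η K') :
    |Real.sqrt (G.form P (ξ + η) (ξ + η)) - Real.sqrt (G.form P ξ ξ)|
      ≤ Real.sqrt (G.form P η η) := by
  have hneg : G.SqBd P (-η) K' :=
    ⟨⟨hη.control.aesm.neg, hη.control.nonneg, (eLpNorm_neg _ _ _).trans_le hη.control.le⟩,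
      ⟨hη.deviation.aesm.neg, hη.deviation.nonneg, (eLpNorm_neg _ _ _).trans_le hη.deviation.le⟩,
      ⟨hη.state.aesm.neg, hη.state.nonneg, (eLpNorm_neg _ _ _).trans_le hη.state.le⟩⟩
  have hform : G.form P (-η) (-η) = G.form P η η := by
    simp [form, bil, Matrix.mulVec_neg]
  have h1 := sqrt_form_add_le hξ hη
  have h2 := sqrt_form_add_le (hξ.add hη) hneg
  rw [add_neg_cancel_right, hform] at h2
  rw [abs_le]
  constructor <;> linarith

/-- Optimality against the zero control bounds the equilibrium cost by a constant that does not
depend on the equilibrium, and coercivity turns this into a bound for the control. -/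
lemma exists_equilibrium_bound (G : Game n m) {ν : Measure (Fin n → ℝ)} (hν : MemLp id 2 ν)
    {z : ℝ → Fin n → ℝ} (hz : ContinuousOn z (Icc 0 G.T)) : ∃ M : ℝ, 0 ≤ M ∧
    ∀ {Ω : Type*} [MeasurableSpace Ω] {P : Measure Ω} [IsProbabilityMeasure P] {N : ℕ}
      {x₀ : Fin N → Ω → Fin n → ℝ} {W : Fin N → ℝ≥0 → Ω → Fin n → ℝ},
      IsRandomData P ν x₀ W → ∀ (i : Fin N) {u : ℝ → Ω → Fin m → ℝ} {y : ℝ → Ω → Fin n → ℝ},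
      IsAdmissible P G.T (playerInfo (x₀ i) (W i)) u →
      G.IsState P (x₀ i) (W i) u (fun t _ => z t) y →
      (∀ (v : ℝ → Ω → Fin m → ℝ) (x : ℝ → Ω → Fin n → ℝ),
        IsAdmissible P G.T (playerInfo (x₀ i) (W i)) v →
        G.IsState P (x₀ i) (W i) v (fun t _ => z t) x →
        G.cost P u (fun t _ => z t) y ≤ G.cost P v (fun t _ => z t) x) →
      Real.sqrt (G.form P (G.triple u (fun t _ => z t) y) (G.triple u (fun t _ => z t) y)) ≤ M ∧
      L2Bd ((horizon G.T).prod P) (fun p : ℝ × Ω => u p.1 p.2) M := by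
  obtain ⟨c, hc, hst⟩ := G.exists_sqBd_state hν hz
  obtain ⟨c2, hc2, hform⟩ := G.exists_sqrt_form_le
  obtain ⟨c3, hc3, hctl⟩ := G.exists_control_le
  refine ⟨(1 + c3) * (c2 * c), by positivity, ?_⟩
  intro Ω _ P _ N x₀ W hd i u y hu hy hopt
  have hξ := hst (hd.law_init i) (hd.wiener i) (L2Bd.of_memLp hu.memLp) hy
  have hnu : MemLp (fun p : ℝ × Ω => -u p.1 p.2) 2 ((horizon G.T).prod P) := hu.memLp.neg
  -- Subtracting `u` from itself produces a state for the zero control.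
  have hx := hy.add_resp (w := fun t ω => -u t ω) hnu
  simp only [add_neg_cancel] at hx
  have h0 : L2Bd ((horizon G.T).prod P) (fun _ : ℝ × Ω => (0 : Fin m → ℝ)) 0 :=
    ⟨aestronglyMeasurable_const, le_rfl, by simp⟩
  have hη := hst (v := fun _ _ => 0) (hd.law_init i) (hd.wiener i) h0 hx
  have hadm : IsAdmissible P G.T (playerInfo (x₀ i) (W i)) fun _ _ => (0 : Fin m → ℝ) :=
    ⟨h0.memLp, Eventually.of_forall fun s => stronglyMeasurable_const.aestronglyMeasurable⟩
  have h1 := hopt _ _ hadm hx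
  rw [cost_eq_form hξ, cost_eq_form hη] at h1
  have h2 : Real.sqrt (G.form P (G.triple u (fun t _ => z t) y) (G.triple u (fun t _ => z t) y))
      ≤ c2 * c := by
    refine (Real.sqrt_le_sqrt h1).trans ((hform hη).trans (le_of_eq ?_))
    ring
  have h3 : 0 ≤ c3 * (c2 * c) := by positivity
  have h4 : 0 ≤ c2 * c := by positivity
  refine ⟨by linarith, (hctl hξ).mono ?_⟩
  have := mul_le_mul_of_nonneg_left h2 hc3
  linarith

/-- The cost in the game is close to the cost in the mean field if all other players use the
equilibrium strategies. -/
theorem exists_abs_sqrt_form_sub_le (G : Game n m) {ν : Measure (Fin n → ℝ)} (hν : MemLp id 2 ν)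
    {z : ℝ → Fin n → ℝ} (hz : ContinuousOn z (Icc 0 G.T)) {M : ℝ} (hM : 0 ≤ M) :
    ∃ c : ℝ, 0 ≤ c ∧
    ∀ {Ω : Type*} [MeasurableSpace Ω] {P : Measure Ω} [IsProbabilityMeasure P] {N : ℕ},
      2 ≤ N → ∀ {x₀ : Fin N → Ω → Fin n → ℝ} {W : Fin N → ℝ≥0 → Ω → Fin n → ℝ},
      IsRandomData P ν x₀ W → ∀ {u : Fin N → ℝ → Ω → Fin m → ℝ} {y : Fin N → ℝ → Ω → Fin n → ℝ},
      (∀ k, IsAdmissible P G.T (playerInfo (x₀ k) (W k)) (u k)) →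
      (∀ k, L2Bd ((horizon G.T).prod P) (fun p : ℝ × Ω => u k p.1 p.2) M) →
      (∀ k, G.IsState P (x₀ k) (W k) (u k) (fun t _ => z t) (y k)) →
      (∀ k, ∀ t ∈ Icc 0 G.T, ∫ ω, y k t ω ∂P = z t) →
      ∀ (i : Fin N) {w : ℝ → Ω → Fin m → ℝ} {K : ℝ},
      L2Bd ((horizon G.T).prod P) (fun p : ℝ × Ω => w p.1 p.2) K →
      ∀ {X : Fin N → ℝ → Ω → Fin n → ℝ},
      G.IsGameState P x₀ W (Function.update u i fun t ω => u i t ω + w t ω) X →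
      (∃ K', G.SqBd P (G.triple (fun t ω => u i t ω + w t ω) (othersMean X i) (X i)) K') ∧
      |Real.sqrt (G.form P (G.triple (fun t ω => u i t ω + w t ω) (othersMean X i) (X i))
          (G.triple (fun t ω => u i t ω + w t ω) (othersMean X i) (X i)))
        - Real.sqrt (G.form P
            (G.triple (u i) (fun t _ => z t) (y i) + G.triple w (fun _ _ => 0) (G.resp w))
            (G.triple (u i) (fun t _ => z t) (y i) + G.triple w (fun _ _ => 0) (G.resp w)))|
        ≤ c * (1 + K) / Real.sqrt N := by
  have hT := G.T_pos.le
  obtain ⟨cs, hcs, hst⟩ := G.exists_L2Bd_state hν hz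
  obtain ⟨cr, hcr, hresp⟩ := G.exists_L2Bd_resp
  obtain ⟨cd, hcd, hdec⟩ := G.exists_L2Bd_sub_decoupled hz
  obtain ⟨ct, hct, htr⟩ := G.exists_sqBd_triple
  obtain ⟨cf, hcf, hform⟩ := G.exists_sqrt_form_le
  obtain ⟨c1, hc1, hst1⟩ := G.exists_sqBd_state hν hz
  obtain ⟨c2, hc2, hrs⟩ := G.exists_sqBd_resp
  -- The first summand is the law of large numbers for the trajectories `y k`; the second is the
  -- share of the deviating player in the averages.
  set D : ℝ := n * (2 * (cs * (1 + M))) + 2 * cr with hD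
  have hD0 : 0 ≤ D := by positivity
  refine ⟨cf * (ct * (2 * cd + 1)) * D, by positivity, ?_⟩
  intro Ω _ P _ N hN x₀ W hd u y hu huM hy hmean i w K hw X hX
  have hK := hw.nonneg
  have h2 : (2 : ℝ) ≤ N := by exact_mod_cast hN
  have hsN : 1 ≤ Real.sqrt N := by rw [Real.one_le_sqrt]; linarith
  have hsN0 : 0 < Real.sqrt N := by linarith
  set ε : ℝ := D * (1 + K) / Real.sqrt N with hε
  have hε0 : 0 ≤ ε := by positivity
  -- The decoupled states under the deviated controls: in the frozen mean field the deviation of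
  -- player `i` affects no other state.
  let b : Fin N → ℝ → Ω → Fin n → ℝ :=
    Function.update y i fun t ω => y i t ω + G.resp w t ω
  have hbi : b i = fun t ω => y i t ω + G.resp w t ω := Function.update_self _ _ _
  have hb : ∀ j, G.IsState P (x₀ j) (W j) ((Function.update u i fun t ω => u i t ω + w t ω) j)
      (fun t _ => z t) (b j) := by
    intro j
    rcases eq_or_ne j i with rfl | hj
    · rw [hbi, Function.update_self]
      exact (hy j).add_resp hw.memLp
    · rw [Function.update_of_ne hj]
      simp only [b, Function.update_of_ne hj]
      exact hy j
  have hyL : ∀ k, ∀ t ∈ Icc 0 G.T, L2Bd P (y k t) (cs * (1 + M)) := fun k t ht =>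
    hst (hd.law_init k) (hd.wiener k) (huM k) (hy k) t ht
  have hym : ∀ k, ∀ t ∈ Icc 0 G.T,
      AEStronglyMeasurable[playerInfo (x₀ k) (W k) G.T] (y k t) P := by
    intro k t ht
    refine (hy k).aestronglyMeasurable_info hz
      (playerInfo_le (hd.measurable_init k) (hd.wiener k).measurable _) (hd.wiener k) (hu k).memLp
      ?_ le_rfl (L2Bd_of_hasLaw hν (hd.law_init k)).memLp ht
    filter_upwards [(hu k).adapted, ae_horizon_mem G.T] with s hs hsT
    exact hs.mono (playerInfo_mono _ _ hsT.2)
  have hρ : ∀ j, ∀ t ∈ Icc 0 G.T, L2Bd P (fun ω => othersMean b j t ω - z t) ε := by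
    intro j t ht
    have h3 := L2Bd_othersMean_sub hN hd (fun k => hyL k t ht) (fun k => hym k t ht)
      (fun k => hmean k t ht) j
    have hN1 : (0 : ℝ) < (N : ℝ) - 1 := by linarith
    have hdiff : ∀ k ω, b k t ω - y k t ω = if k = i then G.resp w t ω else 0 := by
      intro k ω
      rcases eq_or_ne k i with rfl | hk
      · rw [hbi, if_pos rfl]; simp
      · simp only [b, Function.update_of_ne hk, if_neg hk, sub_self]
    have h4 : L2Bd P (othersMean (fun k t ω => b k t ω - y k t ω) j t)
        (((N : ℝ) - 1)⁻¹ * (cr * K)) := by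
      have h5 : AEStronglyMeasurable (othersMean (fun k t ω => b k t ω - y k t ω) j t) P := by
        have h6 : ∀ k, L2Bd P (fun ω => b k t ω - y k t ω) (cr * K) := by
          intro k
          simp only [hdiff]
          rcases eq_or_ne k i with rfl | hk
          · simpa using hresp hw t ht
          · simp only [if_neg hk]
            exact ⟨aestronglyMeasurable_const, by positivity, by simp⟩
        exact (L2Bd.othersMean hN h6 j).aesm
      refine (hresp hw t ht).of_norm_le (inv_pos.2 hN1).le h5 (Eventually.of_forall fun ω => ?_)
      refine (norm_othersMean_le hN _ j t ω).trans ?_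
      gcongr
      refine (Finset.sum_le_sum_of_subset_of_nonneg (Finset.subset_univ _)
        fun k _ _ => norm_nonneg _).trans (le_of_eq ?_)
      rw [Finset.sum_eq_single i (fun k _ hk => by rw [hdiff, if_neg hk, norm_zero])
        (fun h => absurd (Finset.mem_univ i) h), hdiff, if_pos rfl]
    refine ((h3.add h4).mono ?_).congr (Eventually.of_forall fun ω => ?_)
    -- The contribution of the deviation is of order `1/N`; the weaker rate `1/√N` of the averages
    -- is all that is needed.
    · have h5 : ((N : ℝ) - 1)⁻¹ ≤ 2 / Real.sqrt N := by
        rw [inv_le_comm₀ hN1 (by positivity), inv_div, div_le_iff₀ (by norm_num)]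
        have h6 := Real.sq_sqrt (show (0 : ℝ) ≤ N by positivity)
        nlinarith
      have h6 := mul_le_mul_of_nonneg_right h5 (show 0 ≤ cr * K by positivity)
      have h7 : n * (2 * (cs * (1 + M)) / Real.sqrt N) + 2 / Real.sqrt N * (cr * K)
          = (n * (2 * (cs * (1 + M))) + 2 * cr * K) / Real.sqrt N := by ring
      refine (add_le_add_right h6 _).trans (h7.le.trans ?_)
      rw [hε]
      gcongr
      rw [hD]
      have h8 : 0 ≤ n * (2 * (cs * (1 + M))) * K := by positivity
      nlinarith
    · have h5 := othersMean_sub b y j t ω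
      simp only [← h5]
      abel
  have he := hdec hN hd.wiener hX hb hε0 hρ
  -- With the same control on both sides, the game triple is the mean field triple plus the triple
  -- with control `0`, mean field error `p` and state error `q`, all small.
  let p : ℝ → Ω → Fin n → ℝ := fun t ω => othersMean X i t ω - z t
  let q : ℝ → Ω → Fin n → ℝ := fun t ω => X i t ω - b i t ω
  have hp : ∀ t ∈ Icc 0 G.T, L2Bd P (p t) (cd * ε + ε) := by
    intro t ht
    refine ((L2Bd.othersMean (e := fun k t ω => X k t ω - b k t ω) hN (fun k => he k t ht) i).add
      (hρ i t ht)).congr (Eventually.of_forall fun ω => ?_)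
    simp only [p, ← othersMean_sub]
    abel
  have hpc : ∀ᵐ ω ∂P, ContinuousOn (fun t => p t ω) (Icc 0 G.T) := by
    filter_upwards [ae_all_iff.2 fun j => (hX j).continuousOn] with ω hω
    exact (continuousOn_othersMean hω i).sub hz
  have hqc : ∀ᵐ ω ∂P, ContinuousOn (fun t => q t ω) (Icc 0 G.T) := by
    filter_upwards [(hX i).continuousOn, (hb i).continuousOn] with ω h3 h4 using h3.sub h4
  have h0 : L2Bd ((horizon G.T).prod P) (fun _ : ℝ × Ω => (0 : Fin m → ℝ)) (cd * ε) :=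
    ⟨aestronglyMeasurable_const, by positivity, by simp⟩
  have hη := htr (v := fun _ _ => 0) h0 (he i) hqc hp hpc
  have hξ := (hst1 (hd.law_init i) (hd.wiener i) (huM i) (hy i)).add (hrs hw)
  have heq : G.triple (fun t ω => u i t ω + w t ω) (othersMean X i) (X i)
      = (G.triple (u i) (fun t _ => z t) (y i) + G.triple w (fun _ _ => 0) (G.resp w))
        + G.triple (fun _ _ => 0) p q := by
    rw [triple_add, triple_add]
    congr 1
    · funext t ω; simp
    · funext t ω; simp [p]
    · funext t ω; simp [q, hbi]
  rw [heq]
  refine ⟨⟨_, hξ.add hη⟩, (abs_sqrt_form_sub_le hξ hη).trans ((hform hη).trans (le_of_eq ?_))⟩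
  rw [hε]
  ring

end Game

end LQMFG

end

/-! ### The approximate Nash property -/

theorem theorem4p4 {n m : ℕ} (G : LQMFG.Game n m)
    (ν : Measure (Fin n → ℝ)) (hν : MemLp id 2 ν) (z : ℝ → Fin n → ℝ) :
    ∃ C : ℝ, 0 ≤ C ∧
      ∀ (N : ℕ), 2 ≤ N →
      ∀ (Ω : Type*) [MeasurableSpace Ω] (P : Measure Ω) [IsProbabilityMeasure P]
        (x₀ : Fin N → Ω → Fin n → ℝ) (W : Fin N → ℝ≥0 → Ω → Fin n → ℝ),
        LQMFG.IsRandomData P ν x₀ W →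
      ∀ u : Fin N → ℝ → Ω → Fin m → ℝ,
        (∀ i, G.IsMeanFieldEquilibrium P (x₀ i) (W i) z (u i)) →
        G.IsEpsNash P x₀ W u (C / Real.sqrt N) := by
  -- Continuity of `z` is part of being an equilibrium. If it fails, the claim is vacuous, because
  -- `N ≥ 2` provides a player.
  by_cases hz : ContinuousOn z (Icc 0 G.T)
  swap
  · exact ⟨0, le_rfl, fun N hN _ _ _ _ _ _ _ _ hu =>
      absurd (hu ⟨0, by omega⟩).continuousOn hz⟩
  obtain ⟨M, hM, hbd⟩ := G.exists_equilibrium_bound hν hz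
  obtain ⟨c, hc, hcmp⟩ := G.exists_abs_sqrt_form_sub_le hν hz hM
  obtain ⟨c', hc', hctl⟩ := G.exists_control_le
  -- `M + c` bounds the root `a` of the undeviated cost, and `c' * (M + c) + M` the norm of a
  -- profitable deviation. The error `d` for such a deviation then gives `a² - b² = (a - b)(a + b) ≤
  -- 2 d · 2 (M + c)`.
  refine ⟨4 * (M + c) * (c * (1 + (c' * (M + c) + M))), by positivity, ?_⟩
  intro N hN Ω _ P _ x₀ W hd u hu
  choose y hy hmean hopt using fun i => (hu i).optimal
  have hadm : ∀ i, LQMFG.IsAdmissible P G.T (LQMFG.gameInfo x₀ W) (u i) := fun i =>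
    ⟨(hu i).admissible.memLp, (hu i).admissible.adapted.mono fun s hs =>
      hs.mono (le_iSup (fun j => LQMFG.playerInfo (x₀ j) (W j) s) i)⟩
  refine ⟨hadm, fun i v hv X Y hX hY => ?_⟩
  have hsN : 1 ≤ Real.sqrt N := by
    rw [Real.one_le_sqrt]
    exact_mod_cast (by omega : 1 ≤ N)
  have hsN0 : 0 < Real.sqrt N := by linarith
  have huM : ∀ k, LQMFG.L2Bd ((LQMFG.horizon G.T).prod P) (fun p : ℝ × Ω => u k p.1 p.2) M :=
    fun k => (hbd hd k (hu k).admissible (hy k) (hopt k)).2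
  have hαM := (hbd hd i (hu i).admissible (hy i) (hopt i)).1
  -- the game in which nobody deviates
  have h0 : LQMFG.L2Bd ((LQMFG.horizon G.T).prod P) (fun _ : ℝ × Ω => (0 : Fin m → ℝ)) 0 :=
    ⟨aestronglyMeasurable_const, le_rfl, by simp⟩
  have hr0 : G.resp (fun (_ : ℝ) (_ : Ω) => (0 : Fin m → ℝ)) = fun _ _ => 0 := by
    funext t ω
    simp [LQMFG.Game.resp, LQMFG.FundSol.flow]
  have ht0 : G.triple (fun (_ : ℝ) (_ : Ω) => (0 : Fin m → ℝ)) (fun _ _ => 0) (fun _ _ => 0)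
      = 0 := by
    refine Prod.ext rfl (Prod.ext ?_ rfl)
    funext t ω
    simp [LQMFG.Game.triple]
  obtain ⟨⟨K₁, hs₁⟩, he₁⟩ := hcmp hN hd (fun k => (hu k).admissible) huM hy hmean i
    (w := fun _ _ => 0) h0 (X := Y) (by simpa using hY)
  simp only [add_zero, hr0, ht0, mul_one] at hs₁ he₁
  -- the game in which player `i` deviates
  have hwi : LQMFG.IsAdmissible P G.T (LQMFG.gameInfo x₀ W) fun t ω => v t ω - u i t ω := by
    refine ⟨hv.memLp.sub (hadm i).memLp, ?_⟩
    filter_upwards [hv.adapted, (hadm i).adapted] with s h1 h2 using h1.sub h2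
  have hvw : (fun t ω => u i t ω + (v t ω - u i t ω)) = v := by
    funext t ω; abel
  -- Kept open in `K` because it is used twice: first with the unquantified norm of the deviation,
  -- only to know that its cost is finite, then with a bound independent of `v` and `N`.
  have hdev := fun {K : ℝ} (hK : LQMFG.L2Bd ((LQMFG.horizon G.T).prod P)
      (fun p : ℝ × Ω => v p.1 p.2 - u i p.1 p.2) K) =>
    hcmp hN hd (fun k => (hu k).admissible) huM hy hmean i (w := fun t ω => v t ω - u i t ω) hK
      (X := X) (by rw [hvw]; exact hX)
  simp only [hvw] at hdev
  obtain ⟨⟨K₂, hs₂⟩, -⟩ := hdev (LQMFG.L2Bd.of_memLp hwi.memLp)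
  have hαβ := Real.sqrt_le_sqrt
    (LQMFG.Game.form_le_form_of_optimal hν hd i hz (hu i).admissible (hy i) (hopt i) hwi)
  rw [LQMFG.Game.cost_eq_form hs₁, LQMFG.Game.cost_eq_form hs₂]
  have hfa := LQMFG.Game.form_self_nonneg (G := G) (P := P)
    (G.triple (u i) (LQMFG.Game.othersMean Y i) (Y i))
  have hfb := LQMFG.Game.form_self_nonneg (G := G) (P := P)
    (G.triple v (LQMFG.Game.othersMean X i) (X i))
  have hv₂ := hctl hs₂
  rw [← Real.sq_sqrt hfa, ← Real.sq_sqrt hfb]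
  set a := Real.sqrt (G.form P (G.triple (u i) (LQMFG.Game.othersMean Y i) (Y i))
    (G.triple (u i) (LQMFG.Game.othersMean Y i) (Y i)))
  set b := Real.sqrt (G.form P (G.triple v (LQMFG.Game.othersMean X i) (X i))
    (G.triple v (LQMFG.Game.othersMean X i) (X i)))
  have ha0 : 0 ≤ a := Real.sqrt_nonneg _
  have hb0 : 0 ≤ b := Real.sqrt_nonneg _
  have hCN : 0 ≤ 4 * (M + c) * (c * (1 + (c' * (M + c) + M))) / Real.sqrt N := by positivity
  -- If the deviation does not lower the cost there is nothing to prove; otherwise `b ≤ a ≤ M + c`,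
  -- and coercivity bounds the control `v`.
  rcases le_total a b with hab | hab
  · nlinarith
  have hcN : c / Real.sqrt N ≤ c := div_le_self hc hsN
  have haM : a ≤ M + c := by
    have := (abs_le.1 he₁).2
    linarith
  have hwK := (hv₂.sub (huM i)).mono (add_le_add_left
    (mul_le_mul_of_nonneg_left (hab.trans haM) hc') M)
  have he₂ := (hdev hwK).2
  set d : ℝ := c * (1 + (c' * (M + c) + M)) / Real.sqrt N with hd_def
  have hcd : c / Real.sqrt N ≤ d := by
    rw [hd_def]
    gcongr
    have : 0 ≤ c' * (M + c) + M := by positivity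
    nlinarith
  have h1 := (abs_le.1 he₁).2
  have h2 := (abs_le.1 he₂).1
  have hd0 : 0 ≤ d := by positivity
  -- The chain passes from `a` to the mean field root at `u i`, by optimality to the root at the
  -- deviation, and from there to `b`; the first and last steps cost at most `d` each.
  have h3 : a - b ≤ 2 * d := by linarith
  have h4 : (a - b) * (a + b) ≤ 2 * d * (2 * (M + c)) :=
    mul_le_mul h3 (by linarith) (by linarith) (by linarith)
  have h5 : 4 * (M + c) * (c * (1 + (c' * (M + c) + M))) / Real.sqrt N = 4 * (M + c) * d := by
    rw [hd_def]; ring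
  rw [h5]
  nlinarith
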